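/- **Setting.** Fix $V>0$ and $0<\delta<\frac1{100}$. Let $(\rho,e^{it})\in[0,2]\times S^1$ be polar coordinates on $S^2$, with smooth coordinates $\rho e^{it}$ on $\{\rho<2\}$ and $(2-\rho)e^{it}$ on $\{\rho>0\}$, and let $e^{i\theta}$ be the coordinate on $S^1$. Let $\hat g:[0,2]\to\mathbb R$ be smooth with $\hat g=0$ for $\rho\le 50\delta$ and for $\rho\ge 2-50\delta$, and $\hat g=2-\rho$ for $1-50\delta\le\rho<1+50\delta$. For $\frac9{10}<\sigma<\frac{11}{10}$ let $\hat h_\sigma:[0,2]\to\mathbb R$ be smooth with $\hat h_\sigma=\frac12\rho^2$ for $\rho\le 50\delta$, $\hat h_\sigma=\sigma+\frac12(\rho-2)$ for $1-50\delta\le\rho<1+50\delta$, $\hat h_\sigma=2\sigma-\frac12(\rho-2)^2$ for $\rho\ge 2-50\delta$, and $\hat h_\sigma'>0$ on $(0,2)$. Assume that every derivative $\partial_\rho^k\hat h_\sigma$, $k\ge 0$, is bounded on $[0,2]$ uniformly in $\sigma$, and that $\hat h'_\sigma$ is bounded below on $[50\delta,2-50\delta]$ by a positive constant independent of $\sigma$.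 For $r>20$ let $[r]$ be the integer part of $r$ and put $\sigma=[r]/r$. On $S^2\times S^1$ consider the stable Hamiltonian structure $(\hat a,2\hat\omega)$, $\hat a=V\,d\theta+\hat g\,dt$, $\hat\omega=\hat h_\sigma'\,dt\wedge d\rho$, and the metric $\hat a^2+d\rho^2+(\hat h_\sigma'\,dt)^2$, with oriented orthonormal frame $e_1=\partial_\rho$, $e_2=-\frac1{\hat h'_\sigma}(\partial_t-\frac{\hat g}{V}\partial_\theta)$, $e_3=\frac1V\partial_\theta$. The canonical spinor bundle is $\underline{\mathbb C}\oplus\hat K^{-1}$, where $\hat K^{-1}$ is spanned by the unit section $\kappa=\frac1{\sqrt2}(e_1-ie_2)$ for $0<\rho<2$; in the basis $(1,\kappa)$ Clifford multiplication is $$\mathrm{cl}(e_1)=\begin{pmatrix}0&-1\\1&0\end{pmatrix},\quad \mathrm{cl}(e_2)=\begin{pmatrix}0&i\\i&0\end{pmatrix},\quad \mathrm{cl}(e_3)=\begin{pmatrix}i&0\\0&-i\end{pmatrix}.$$ With $\theta_j^k$ the Levi-Civita connection forms, $\nabla e_j=\sum_k\theta_j^k\otimes e_k$, the canonical spin-c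 connection is $$\nabla_{\rm can}=d+\tfrac12\sum_{j<k}\theta_j^k\,\mathrm{cl}(e_j)\mathrm{cl}(e_k)+\tfrac i2(\theta_1^2-*d\hat a).$$ Let $\hat L_r\to S^2$ be the Hermitian line bundle of degree $2[r]$ with unitary sections $1_-$ over $\{\rho<2\}$ and $1_+$ over $\{\rho>0\}$ related by $e^{2i[r]t}1_+=1_-$, with the unitary connection $\hat A_r=d+ir(\hat h_\sigma+\frac12\hat g)\,dt$ with respect to $1_-$. Let $$\hat D_r=\mathrm{cl}\circ\big(\nabla_{\rm can}\otimes\hat A_r-\tfrac{ir}2\hat a\big)$$ be the resulting Dirac operator on sections of $\hat L_r\oplus\hat L_r\hat K^{-1}$. For $k\in\mathbb Z$ let $\bar\partial_{r,k}$, from smooth sections of $\hat L_r\to S^2$ to smooth sections of $\hat L_rK_{S^2}^{-1}$, be the Cauchy–Riemann operator of the connection $\hat A_r-i\frac kV\hat g\,dt$, where $S^2$ carries the complex structure with $J\partial_\rho=-\frac1{\hat h'_\sigma}\partial_t$ and $\kappa$ is identified with the $(0,1)$-form $\frac1{\sqrt2}(d\rho+i\hat h_\sigma'dt)$. **Proposition.**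 There is a constant $c_2>20$, depending only on $V$, $\delta$, $\hat g$ and the family $(\hat h_\sigma)_\sigma$, and not on $r$, such that the following holds for every $r\ge c_2$. 1. The spectrum of $\hat D_r$ within $[-(\frac13r)^{1/2},(\frac13r)^{1/2}]$ is exactly $$\Big\{\frac r2-\frac kV\ \Big|\ k\in\mathbb Z,\ \Big|\frac r2-\frac kV\Big|\le\big(\tfrac13r\big)^{1/2}\Big\}.$$ 2. For every $k\in\mathbb Z$ with $|\frac r2-\frac kV|\le(\frac13r)^{1/2}$, the eigenspace of $\hat D_r$ for the eigenvalue $\frac r2-\frac kV$ (in the space of smooth sections of $\hat L_r\oplus\hat L_r\hat K^{-1}$) has complex dimension $2[r]+1$, and $$\hat\alpha\longmapsto\frac1{\sqrt{2\pi}}e^{ik\theta}(\hat\alpha,0)$$ is a linear isomorphism from $\ker\bar\partial_{r,k}$ onto it. -/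

import Mathlib

open scoped ContDiff

noncomputable section

namespace DiracHat

/-! ## Profile functions

`g` and `h σ` are the functions of `ρ ∈ [0,2]` defining the geometry of `S² × S¹`.  They are the
restrictions to `[0,2]` of smooth functions on `ℝ`; only their values on `[0,2]` matter. -/

/-- The function `ĝ`: it is `0` near both poles and `2 - ρ` near `ρ = 1`. -/
structure IsProfileG (δ : ℝ) (g : ℝ → ℝ) : Prop where
  smooth : ContDiff ℝ ∞ g
  near_zero : ∀ ρ ∈ Set.Icc (0 : ℝ) (50 * δ), g ρ = 0
  near_one : ∀ ρ ∈ Set.Ico (1 - 50 * δ) (1 + 50 * δ), g ρ = 2 - ρ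
  near_two : ∀ ρ ∈ Set.Icc (2 - 50 * δ) 2, g ρ = 0

/-- The family `ĥ_σ`, `9/10 < σ < 11/10`, with uniformly bounded `C^k` norms and, away from the
poles, uniformly positive derivative. -/
structure IsProfileH (δ : ℝ) (h : ℝ → ℝ → ℝ) : Prop where
  smooth : ∀ σ ∈ Set.Ioo (9 / 10 : ℝ) (11 / 10), ContDiff ℝ ∞ (h σ)
  near_zero : ∀ σ ∈ Set.Ioo (9 / 10 : ℝ) (11 / 10),
    ∀ ρ ∈ Set.Icc (0 : ℝ) (50 * δ), h σ ρ = ρ ^ 2 / 2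
  near_one : ∀ σ ∈ Set.Ioo (9 / 10 : ℝ) (11 / 10),
    ∀ ρ ∈ Set.Ico (1 - 50 * δ) (1 + 50 * δ), h σ ρ = σ + (ρ - 2) / 2
  near_two : ∀ σ ∈ Set.Ioo (9 / 10 : ℝ) (11 / 10),
    ∀ ρ ∈ Set.Icc (2 - 50 * δ) 2, h σ ρ = 2 * σ - (ρ - 2) ^ 2 / 2
  deriv_pos : ∀ σ ∈ Set.Ioo (9 / 10 : ℝ) (11 / 10), ∀ ρ ∈ Set.Ioo (0 : ℝ) 2, 0 < deriv (h σ) ρ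
  bounded : ∀ k : ℕ, ∃ C : ℝ, ∀ σ ∈ Set.Ioo (9 / 10 : ℝ) (11 / 10), ∀ ρ ∈ Set.Icc (0 : ℝ) 2,
    |iteratedDeriv k (h σ) ρ| ≤ C
  deriv_lower : ∃ m : ℝ, 0 < m ∧ ∀ σ ∈ Set.Ioo (9 / 10 : ℝ) (11 / 10),
    ∀ ρ ∈ Set.Icc (50 * δ) (2 - 50 * δ), m ≤ deriv (h σ) ρ

/-! ## Geometry in polar coordinates

A triple `p = (ρ, t, θ) : ℝ × ℝ × ℝ` with `0 < ρ < 2` and `t`, `θ` modulo `2π` describes a point of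
the dense open set of `S² × S¹` where the point of `S²` is neither of the two poles.  Here
`(ρ, e^{it})` are the polar coordinates of `S²`: `S²` is the union of the two discs with smooth
coordinates `ρ e^{it}` (for `0 ≤ ρ < 2`) and `(2 - ρ) e^{it}` (for `0 < ρ ≤ 2`).
A tangent vector is its triple of components in `∂_ρ, ∂_t, ∂_θ`.  Below `h` is one function `ĥ_σ`. -/

/-- The `1`-form `â = V dθ + ĝ dt`. -/
def aHat (V : ℝ) (g : ℝ → ℝ) (p u : ℝ × ℝ × ℝ) : ℝ := V * u.2.2 + g p.1 * u.2.1

/-- Its exterior derivative, `dâ(u, w) = u(â(w)) - w(â(u))` for constant vector fields `u`, `w`. -/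
def daHat (V : ℝ) (g : ℝ → ℝ) (p u w : ℝ × ℝ × ℝ) : ℝ :=
  fderiv ℝ (fun x => aHat V g x w) p u - fderiv ℝ (fun x => aHat V g x u) p w

/-- The `2`-form `ω̂ = ĥ' dt ∧ dρ`; the stable Hamiltonian structure is `(â, 2ω̂)`. -/
def omegaHat (h : ℝ → ℝ) (p u w : ℝ × ℝ × ℝ) : ℝ :=
  deriv h p.1 * (u.2.1 * w.1 - w.2.1 * u.1)

/-- The Riemannian metric `â² + dρ² + (ĥ' dt)²`. -/
def metric (V : ℝ) (g h : ℝ → ℝ) (p u w : ℝ × ℝ × ℝ) : ℝ :=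
  aHat V g p u * aHat V g p w + u.1 * w.1 + (deriv h p.1 * u.2.1) * (deriv h p.1 * w.2.1)

/-- The oriented orthonormal frame `e₁ = ∂_ρ`, `e₂ = J e₁ = -(1/ĥ')(∂_t - (ĝ/V) ∂_θ)`,
`e₃ = (1/V) ∂_θ` (the Reeb field of the stable Hamiltonian structure), with indices `0, 1, 2`. -/
def frame (V : ℝ) (g h : ℝ → ℝ) : Fin 3 → (ℝ × ℝ × ℝ → ℝ × ℝ × ℝ) :=
  ![fun _ => (1, 0, 0),
    fun p => (0, -(1 / deriv h p.1), (1 / deriv h p.1) * (g p.1 / V)),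
    fun _ => (0, 0, 1 / V)]

theorem metric_frame {V : ℝ} {g h : ℝ → ℝ} {p : ℝ × ℝ × ℝ} (hV : V ≠ 0) (hp : deriv h p.1 ≠ 0)
    (i j : Fin 3) :
    metric V g h p (frame V g h i p) (frame V g h j p) = if i = j then 1 else 0 := by
  fin_cases i <;> fin_cases j <;> simp [metric, aHat, frame] <;> field_simp <;> simp

theorem omegaHat_frame {V : ℝ} {g h : ℝ → ℝ} {p : ℝ × ℝ × ℝ} (hp : deriv h p.1 ≠ 0) :
    omegaHat h p (frame V g h 0 p) (frame V g h 1 p) = 1 ∧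
      ∀ u, omegaHat h p (frame V g h 2 p) u = 0 := by
  constructor
  · simp [omegaHat, frame]
    field_simp
  · intro u
    simp [omegaHat, frame]

/-- The Levi-Civita connection in the orthonormal frame: `θ_a^b(e_j) = ⟨∇_{e_j} e_a, e_b⟩`, by
Koszul's formula. -/
def leviCivita (V : ℝ) (g h : ℝ → ℝ) (a b j : Fin 3) (p : ℝ × ℝ × ℝ) : ℝ :=
  (metric V g h p (VectorField.lieBracket ℝ (frame V g h j) (frame V g h a) p) (frame V g h b p)
    - metric V g h p (VectorField.lieBracket ℝ (frame V g h a) (frame V g h b) p) (frame V g h j p)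
    + metric V g h p (VectorField.lieBracket ℝ (frame V g h b) (frame V g h j) p)
        (frame V g h a p)) / 2

/-- The Hodge dual of `dâ` on the frame: `(*dâ)(e_j) = dâ(e_{j+1}, e_{j+2})`, indices modulo `3`. -/
def starDaHat (V : ℝ) (g h : ℝ → ℝ) (j : Fin 3) (p : ℝ × ℝ × ℝ) : ℝ :=
  daHat V g p (frame V g h (j + 1) p) (frame V g h (j + 2) p)

/-! ## The spin-c Dirac operator

Over `0 < ρ < 2` the bundle `L̂_r ⊕ L̂_r K̂⁻¹` is trivialized by the unitary sections `1₋` and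
`1₋ ⊗ κ`, `κ = (1/√2)(e₁ - i e₂)`. -/

/-- Clifford multiplication by `e₁`, `e₂`, `e₃` in the basis `1`, `κ`. -/
def clifford : Fin 3 → Matrix (Fin 2) (Fin 2) ℂ :=
  ![!![0, -1; 1, 0], !![0, Complex.I; Complex.I, 0], !![Complex.I, 0; 0, -Complex.I]]

/-- The connection `A_r = d + i r (ĥ + ĝ/2) dt` on `L̂_r`, in the trivialization `1₋`:
the value of its connection form on `u`. -/
def lineForm (r : ℝ) (g h : ℝ → ℝ) (p u : ℝ × ℝ × ℝ) : ℂ :=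
  Complex.I * ((r * (h p.1 + g p.1 / 2) * u.2.1 : ℝ) : ℂ)

/-- The connection matrix, evaluated on `e_j`, of `∇_can ⊗ A_r - (i r/2) â`, where the canonical
spin-c connection is
`∇_can = d + ½ ∑_{a<b} θ_a^b cl(e_a) cl(e_b) + (i/2)(θ_1^2 - *dâ)`. -/
def spinForm (V r : ℝ) (g h : ℝ → ℝ) (j : Fin 3) (p : ℝ × ℝ × ℝ) : Matrix (Fin 2) (Fin 2) ℂ :=
  (1 / 2 : ℂ) • (∑ a : Fin 3, ∑ b ∈ Finset.Ioi a,
      (leviCivita V g h a b j p : ℂ) • (clifford a * clifford b))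
    + ((Complex.I / 2) * ((leviCivita V g h 0 1 j p : ℂ) - (starDaHat V g h j p : ℂ))
        + lineForm r g h p (frame V g h j p)
        - (Complex.I * (r : ℂ) / 2) * (aHat V g p (frame V g h j p) : ℂ))
      • (1 : Matrix (Fin 2) (Fin 2) ℂ)

/-- The Dirac operator `D̂_r ψ = ∑_j cl(e_j) ∇_{e_j} ψ`. -/
def dirac (V r : ℝ) (g h : ℝ → ℝ) (ψ : ℝ × ℝ × ℝ → Fin 2 → ℂ) (p : ℝ × ℝ × ℝ) : Fin 2 → ℂ :=
  ∑ j : Fin 3, (clifford j).mulVec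
    (fderiv ℝ ψ p (frame V g h j p) + (spinForm V r g h j p).mulVec (ψ p))

/-- `e^{imt}` -/
def expI (m : ℤ) (t : ℝ) : ℂ := Complex.exp (m * t * Complex.I)

/-- Smooth sections of `L ⊕ L K̂⁻¹ → S² × S¹`, where `L` has degree `2N`.
A section is recorded by its components `(α, β)` in the trivialization `(1₋, 1₋ ⊗ κ)` over the dense
open set `0 < ρ < 2` (with value `0` assigned outside the coordinate range).
Smooth trivializations are `(1₋, 1₋ ⊗ e^{it} κ)` over `ρ < 2`, and `(1₊, 1₊ ⊗ e^{-it} κ)` over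
`0 < ρ`, where `e^{2iNt} 1₊ = 1₋`; the components in both have to extend to smooth functions
across the pole. -/
def spinorSections (N : ℤ) : Submodule ℂ (ℝ × ℝ × ℝ → Fin 2 → ℂ) where
  carrier := {ψ | (∀ p : ℝ × ℝ × ℝ, p.1 ∉ Set.Ioo (0 : ℝ) 2 → ψ p = 0) ∧
    (∀ ρ t θ : ℝ, ψ (ρ, t, θ + 2 * Real.pi) = ψ (ρ, t, θ)) ∧
    (∃ F : ℂ × ℝ → Fin 2 → ℂ, ContDiffOn ℝ ∞ F (Metric.ball 0 2 ×ˢ Set.univ) ∧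
      ∀ ρ ∈ Set.Ioo (0 : ℝ) 2, ∀ t θ : ℝ,
        F (ρ * expI 1 t, θ) = ![ψ (ρ, t, θ) 0, expI (-1) t * ψ (ρ, t, θ) 1]) ∧
    (∃ F : ℂ × ℝ → Fin 2 → ℂ, ContDiffOn ℝ ∞ F (Metric.ball 0 2 ×ˢ Set.univ) ∧
      ∀ ρ ∈ Set.Ioo (0 : ℝ) 2, ∀ t θ : ℝ,
        F ((2 - ρ) * expI 1 t, θ) =
          ![expI (2 * N) t * ψ (ρ, t, θ) 0, expI (2 * N + 1) t * ψ (ρ, t, θ) 1])}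
  zero_mem' := by
    refine ⟨fun _ _ => rfl, fun _ _ _ => rfl, ⟨0, contDiffOn_const, ?_⟩, ⟨0, contDiffOn_const, ?_⟩⟩
    all_goals
      intro ρ _ t θ
      ext i
      fin_cases i <;> simp
  add_mem' := by
    rintro ψ φ ⟨h1, h2, ⟨F, hF, hF'⟩, ⟨G, hG, hG'⟩⟩ ⟨k1, k2, ⟨P, hP, hP'⟩, ⟨Q, hQ, hQ'⟩⟩
    refine ⟨fun p hp => by simp [h1 p hp, k1 p hp], fun ρ t θ => by simp [h2, k2],
      ⟨F + P, hF.add hP, ?_⟩, ⟨G + Q, hG.add hQ, ?_⟩⟩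
    · intro ρ hρ t θ
      rw [Pi.add_apply, hF' ρ hρ, hP' ρ hρ]
      ext i
      fin_cases i <;> simp <;> ring
    · intro ρ hρ t θ
      rw [Pi.add_apply, hG' ρ hρ, hQ' ρ hρ]
      ext i
      fin_cases i <;> simp <;> ring
  smul_mem' := by
    rintro c ψ ⟨h1, h2, ⟨F, hF, hF'⟩, ⟨G, hG, hG'⟩⟩
    refine ⟨fun p hp => by simp [h1 p hp], fun ρ t θ => by simp [h2],
      ⟨c • F, hF.const_smul c, ?_⟩, ⟨c • G, hG.const_smul c, ?_⟩⟩
    · intro ρ hρ t θ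
      rw [Pi.smul_apply, hF' ρ hρ]
      ext i
      fin_cases i <;> simp
      ring
    · intro ρ hρ t θ
      rw [Pi.smul_apply, hG' ρ hρ]
      ext i
      fin_cases i <;> simp <;> ring

theorem expI_mul_neg (m : ℤ) (t : ℝ) : expI m t * expI (-m) t = 1 := by
  simp [expI, ← Complex.exp_add]

theorem norm_expI (m : ℤ) (t : ℝ) : ‖expI m t‖ = 1 := by
  have := Complex.norm_exp_ofReal_mul_I (m * t)
  simpa [expI] using this

theorem contDiff_expI (m : ℤ) : ContDiff ℝ ∞ (expI m) := by
  unfold expI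
  have : ContDiff ℝ ∞ (fun t : ℝ => (t : ℂ)) := Complex.ofRealCLM.contDiff
  fun_prop

/-- A smooth section is a differentiable function of the polar coordinates. -/
theorem differentiableAt_of_mem {N : ℤ} {ψ : ℝ × ℝ × ℝ → Fin 2 → ℂ} (hψ : ψ ∈ spinorSections N)
    {p : ℝ × ℝ × ℝ} (hp : p.1 ∈ Set.Ioo (0 : ℝ) 2) : DifferentiableAt ℝ ψ p := by
  obtain ⟨-, -, ⟨F, hF, hF'⟩, -⟩ := hψ
  have hof : ContDiff ℝ ∞ (fun t : ℝ => (t : ℂ)) := Complex.ofRealCLM.contDiff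
  have hexp := contDiff_expI 1
  have hmap : ContDiff ℝ ∞ (fun q : ℝ × ℝ × ℝ => (((q.1 : ℂ) * expI 1 q.2.1, q.2.2) : ℂ × ℝ)) := by
    refine ContDiff.prodMk (ContDiff.mul (hof.comp contDiff_fst)
      (hexp.comp (contDiff_fst.comp contDiff_snd))) (contDiff_snd.comp contDiff_snd)
  have hmem : (((p.1 : ℂ) * expI 1 p.2.1, p.2.2) : ℂ × ℝ) ∈
      (Metric.ball (0 : ℂ) 2 ×ˢ (Set.univ : Set ℝ)) := by
    refine ⟨?_, trivial⟩
    simp only [mem_ball_zero_iff, norm_mul, norm_expI, mul_one, Complex.norm_real,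
      Real.norm_eq_abs, abs_of_pos hp.1]
    exact hp.2
  have hFat : DifferentiableAt ℝ F ((p.1 : ℂ) * expI 1 p.2.1, p.2.2) :=
    (hF.contDiffAt ((Metric.isOpen_ball.prod isOpen_univ).mem_nhds hmem)).differentiableAt
      (by simp)
  have hcomp : DifferentiableAt ℝ (fun q : ℝ × ℝ × ℝ => F ((q.1 : ℂ) * expI 1 q.2.1, q.2.2)) p :=
    DifferentiableAt.comp p hFat (hmap.differentiable (by simp) p)
  have hnear : ∀ᶠ q : ℝ × ℝ × ℝ in nhds p, q.1 ∈ Set.Ioo (0 : ℝ) 2 :=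
    continuous_fst.continuousAt.eventually (isOpen_Ioo.mem_nhds hp)
  rw [differentiableAt_pi] at hcomp ⊢
  have hexp' : DifferentiableAt ℝ (fun q : ℝ × ℝ × ℝ => expI 1 q.2.1) p :=
    (hexp.comp (contDiff_fst.comp contDiff_snd)).differentiable (by simp) p
  intro i
  fin_cases i
  · refine (hcomp 0).congr_of_eventuallyEq ?_
    filter_upwards [hnear] with q hq
    have := hF' q.1 hq q.2.1 q.2.2
    simp [this]
  · refine (hexp'.mul (hcomp 1)).congr_of_eventuallyEq ?_
    filter_upwards [hnear] with q hq
    have := hF' q.1 hq q.2.1 q.2.2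
    have h1 := expI_mul_neg 1 q.2.1
    simp only [Fin.mk_one, this, Matrix.cons_val_one, Matrix.cons_val_fin_one, Pi.mul_apply]
    rw [← mul_assoc, h1, one_mul]

theorem dirac_add (V r : ℝ) (g h : ℝ → ℝ) {ψ φ : ℝ × ℝ × ℝ → Fin 2 → ℂ} {p : ℝ × ℝ × ℝ}
    (hψ : DifferentiableAt ℝ ψ p) (hφ : DifferentiableAt ℝ φ p) :
    dirac V r g h (ψ + φ) p = dirac V r g h ψ p + dirac V r g h φ p := by
  simp only [dirac, ← Finset.sum_add_distrib]
  refine Finset.sum_congr rfl fun j _ => ?_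
  rw [fderiv_add hψ hφ, ← Matrix.mulVec_add, Pi.add_apply, Matrix.mulVec_add, add_apply]
  simp only [Matrix.mulVec_add]
  exact add_add_add_comm _ _ _ _

theorem dirac_smul (V r : ℝ) (g h : ℝ → ℝ) {ψ : ℝ × ℝ × ℝ → Fin 2 → ℂ} {p : ℝ × ℝ × ℝ}
    (hψ : DifferentiableAt ℝ ψ p) (c : ℂ) :
    dirac V r g h (c • ψ) p = c • dirac V r g h ψ p := by
  simp only [dirac, Finset.smul_sum]
  refine Finset.sum_congr rfl fun j _ => ?_
  rw [fderiv_const_smul hψ, ← Matrix.mulVec_smul, Pi.smul_apply, Matrix.mulVec_smul, smul_apply,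
    smul_add]

/-- The eigenspace of `D̂_r` for `lam`, in the space of smooth sections of `L̂_r ⊕ L̂_r K̂⁻¹`,
`L̂_r` of degree `2[r]`.  (The equation holds everywhere once it holds on a dense set.) -/
def eigenspace (V r : ℝ) (g h : ℝ → ℝ) (lam : ℝ) : Submodule ℂ (ℝ × ℝ × ℝ → Fin 2 → ℂ) where
  carrier := {ψ | ψ ∈ spinorSections ⌊r⌋ ∧
    ∀ p : ℝ × ℝ × ℝ, p.1 ∈ Set.Ioo (0 : ℝ) 2 → dirac V r g h ψ p = (lam : ℂ) • ψ p}
  zero_mem' := by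
    refine ⟨Submodule.zero_mem _, fun p _ => ?_⟩
    simp [dirac]
  add_mem' := by
    rintro ψ φ ⟨h1, h2⟩ ⟨k1, k2⟩
    refine ⟨Submodule.add_mem _ h1 k1, fun p hp => ?_⟩
    rw [dirac_add V r g h (differentiableAt_of_mem h1 hp) (differentiableAt_of_mem k1 hp),
      h2 p hp, k2 p hp, Pi.add_apply, smul_add]
  smul_mem' := by
    rintro c ψ ⟨h1, h2⟩
    refine ⟨Submodule.smul_mem _ c h1, fun p hp => ?_⟩
    rw [dirac_smul V r g h (differentiableAt_of_mem h1 hp), h2 p hp, Pi.smul_apply, smul_comm]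

/-- The square of the `L²` norm of a spinor, for the volume form `V ĥ' dρ dt dθ` of the metric. -/
def sqNorm (V : ℝ) (h : ℝ → ℝ) (ψ : ℝ × ℝ × ℝ → Fin 2 → ℂ) : ℝ :=
  ∫ p in Set.Ioo (0 : ℝ) 2 ×ˢ Set.Ioc (0 : ℝ) (2 * Real.pi) ×ˢ Set.Ioc (0 : ℝ) (2 * Real.pi),
    (‖ψ p 0‖ ^ 2 + ‖ψ p 1‖ ^ 2) * (V * deriv h p.1)

/-- The spectrum of (the `L²` closure of) `D̂_r`.  Being a symmetric elliptic operator on a closed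
manifold, `D̂_r` is essentially self-adjoint on smooth sections, so a real number `lam` lies in the
spectrum exactly if `D̂_r - lam` is not bounded below there; eigenvalues belong to this set. -/
def diracSpectrum (V r : ℝ) (g h : ℝ → ℝ) : Set ℝ :=
  {lam | ∀ ε : ℝ, 0 < ε → ∃ ψ ∈ spinorSections ⌊r⌋, sqNorm V h ψ = 1 ∧
    sqNorm V h (fun p => dirac V r g h ψ p - (lam : ℂ) • ψ p) < ε}

/-! ## The Cauchy–Riemann operator on `S²` -/

/-- Smooth sections of the line bundle of degree `2N` over `S²`, recorded as functions of
`(ρ, t)` in the trivialization `1₋`, with value `0` assigned outside `0 < ρ < 2`; here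
`e^{2iNt} 1₊ = 1₋`, and `1₋`, `1₊` are smooth over `ρ < 2`, `0 < ρ`. -/
def lineSections (N : ℤ) : Submodule ℂ (ℝ × ℝ → ℂ) where
  carrier := {s | (∀ q : ℝ × ℝ, q.1 ∉ Set.Ioo (0 : ℝ) 2 → s q = 0) ∧
    (∃ F : ℂ → ℂ, ContDiffOn ℝ ∞ F (Metric.ball 0 2) ∧
      ∀ ρ ∈ Set.Ioo (0 : ℝ) 2, ∀ t : ℝ, F (ρ * expI 1 t) = s (ρ, t)) ∧
    (∃ F : ℂ → ℂ, ContDiffOn ℝ ∞ F (Metric.ball 0 2) ∧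
      ∀ ρ ∈ Set.Ioo (0 : ℝ) 2, ∀ t : ℝ,
        F ((2 - ρ) * expI 1 t) = expI (2 * N) t * s (ρ, t))}
  zero_mem' := by
    refine ⟨fun _ _ => rfl, ⟨0, contDiffOn_const, ?_⟩, ⟨0, contDiffOn_const, ?_⟩⟩ <;> simp
  add_mem' := by
    rintro s u ⟨h1, ⟨F, hF, hF'⟩, ⟨G, hG, hG'⟩⟩ ⟨k1, ⟨P, hP, hP'⟩, ⟨Q, hQ, hQ'⟩⟩
    refine ⟨fun p hp => by simp [h1 p hp, k1 p hp],
      ⟨F + P, hF.add hP, ?_⟩, ⟨G + Q, hG.add hQ, ?_⟩⟩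
    · intro ρ hρ t
      rw [Pi.add_apply, hF' ρ hρ, hP' ρ hρ, Pi.add_apply]
    · intro ρ hρ t
      rw [Pi.add_apply, hG' ρ hρ, hQ' ρ hρ, Pi.add_apply, mul_add]
  smul_mem' := by
    rintro c s ⟨h1, ⟨F, hF, hF'⟩, ⟨G, hG, hG'⟩⟩
    refine ⟨fun p hp => by simp [h1 p hp],
      ⟨c • F, hF.const_smul c, ?_⟩, ⟨c • G, hG.const_smul c, ?_⟩⟩
    · intro ρ hρ t
      rw [Pi.smul_apply, hF' ρ hρ, Pi.smul_apply]
    · intro ρ hρ t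
      rw [Pi.smul_apply, hG' ρ hρ, Pi.smul_apply, smul_eq_mul, smul_eq_mul]
      ring

theorem differentiableAt_of_mem_line {N : ℤ} {s : ℝ × ℝ → ℂ} (hs : s ∈ lineSections N)
    {q : ℝ × ℝ} (hq : q.1 ∈ Set.Ioo (0 : ℝ) 2) : DifferentiableAt ℝ s q := by
  obtain ⟨-, ⟨F, hF, hF'⟩, -⟩ := hs
  have hof : ContDiff ℝ ∞ (fun t : ℝ => (t : ℂ)) := Complex.ofRealCLM.contDiff
  have hmap : ContDiff ℝ ∞ (fun q : ℝ × ℝ => (q.1 : ℂ) * expI 1 q.2) :=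
    ContDiff.mul (hof.comp contDiff_fst) ((contDiff_expI 1).comp contDiff_snd)
  have hmem : (q.1 : ℂ) * expI 1 q.2 ∈ Metric.ball (0 : ℂ) 2 := by
    simp only [mem_ball_zero_iff, norm_mul, norm_expI, mul_one, Complex.norm_real,
      Real.norm_eq_abs, abs_of_pos hq.1]
    exact hq.2
  have hFat : DifferentiableAt ℝ F ((q.1 : ℂ) * expI 1 q.2) :=
    (hF.contDiffAt (Metric.isOpen_ball.mem_nhds hmem)).differentiableAt (by simp)
  have hcomp : DifferentiableAt ℝ (fun q : ℝ × ℝ => F ((q.1 : ℂ) * expI 1 q.2)) q :=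
    DifferentiableAt.comp q hFat (hmap.differentiable (by simp) q)
  refine hcomp.congr_of_eventuallyEq ?_
  have hnear : ∀ᶠ x : ℝ × ℝ in nhds q, x.1 ∈ Set.Ioo (0 : ℝ) 2 :=
    continuous_fst.continuousAt.eventually (isOpen_Ioo.mem_nhds hq)
  filter_upwards [hnear] with x hx
  exact (hF' x.1 hx x.2).symm

/-- The connection `A_r - i (k/V) ĝ dt` on `L̂_r → S²`, in the trivialization `1₋`: the covariant
derivative of `s` in the direction `u`. -/
def nablaS2 (V r : ℝ) (g h : ℝ → ℝ) (k : ℤ) (s : ℝ × ℝ → ℂ) (q u : ℝ × ℝ) : ℂ :=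
  fderiv ℝ s q u
    + Complex.I * (((r * (h q.1 + g q.1 / 2) - (k : ℝ) / V * g q.1) * u.2 : ℝ) : ℂ) * s q

/-- The Cauchy–Riemann operator `∂̄_{r,k}`: the `(0,1)` part of the connection, for the complex
structure of `S²` with `J ∂_ρ = -(1/ĥ') ∂_t`.  It takes values in `L̂_r K⁻¹`; this is the component
along `1₋ ⊗ κ`, where `κ` is identified with the unit `(0,1)`-form `(1/√2)(dρ + i ĥ' dt)`:
`∂̄ s = ½ (∇_{∂_ρ} s + i ∇_{J∂_ρ} s)(dρ + i ĥ' dt)`. -/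
def dbar (V r : ℝ) (g h : ℝ → ℝ) (k : ℤ) (s : ℝ × ℝ → ℂ) (q : ℝ × ℝ) : ℂ :=
  (1 / (Real.sqrt 2 : ℂ)) * (nablaS2 V r g h k s q (1, 0)
    + Complex.I * nablaS2 V r g h k s q (0, -(1 / deriv h q.1)))

/-- The kernel of `∂̄_{r,k}` on smooth sections of `L̂_r → S²`. -/
def kerDbar (V r : ℝ) (g h : ℝ → ℝ) (k : ℤ) : Submodule ℂ (ℝ × ℝ → ℂ) where
  carrier := {s | s ∈ lineSections ⌊r⌋ ∧
    ∀ q : ℝ × ℝ, q.1 ∈ Set.Ioo (0 : ℝ) 2 → dbar V r g h k s q = 0}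
  zero_mem' := by
    refine ⟨Submodule.zero_mem _, fun q _ => ?_⟩
    simp [dbar, nablaS2]
  add_mem' := by
    rintro s u ⟨h1, h2⟩ ⟨k1, k2⟩
    refine ⟨Submodule.add_mem _ h1 k1, fun q hq => ?_⟩
    have e : dbar V r g h k (s + u) q = dbar V r g h k s q + dbar V r g h k u q := by
      simp only [dbar, nablaS2]
      rw [fderiv_add (differentiableAt_of_mem_line h1 hq) (differentiableAt_of_mem_line k1 hq)]
      simp only [add_apply, Pi.add_apply]
      ring
    rw [e, h2 q hq, k2 q hq, add_zero]
  smul_mem' := by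
    rintro c s ⟨h1, h2⟩
    refine ⟨Submodule.smul_mem _ c h1, fun q hq => ?_⟩
    have e : dbar V r g h k (c • s) q = c * dbar V r g h k s q := by
      simp only [dbar, nablaS2]
      rw [fderiv_const_smul (differentiableAt_of_mem_line h1 hq)]
      simp only [smul_apply, Pi.smul_apply, smul_eq_mul]
      ring
    rw [e, h2 q hq, mul_zero]

end DiracHat

end

/-! Write f = ĥ', T = r/2 + (i/V)∂_θ, S = i∂_t − rĥ − ĝT, B = ∂_ρ − S/f, and B* for the formal
adjoint of B. By `dirac_apply`, D̂(α, β) = (Tα + B*β, Bα − Tβ + (ĝ'/2f)β). All coefficients depend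
on ρ alone, so T commutes with S and B, while [∂_ρ, S] = −(rf + ĝ'T) carries the large curvature r.

Let χ, η be the components of (D̂ − μ)(α, β) and γ = (T − μ)α. The identity Bγ = (T − μ)Bα is paired
with β. Since γ = χ − B*β and Bα = η + Tβ + μβ − (ĝ'/2f)β, this controls ‖B*β‖² + ‖Tβ‖² − μ²‖β‖² by
χ and η. Half of ‖B*β‖² is expanded through the commutator and yields (r/2)‖β‖², which beats μ²‖β‖²
≤ (r/3)‖β‖² once r is large compared with ĝ'/f and f''/f. Everything is done on each torus ρ =
const: T and S are symmetric there, and what remains is the ρ-derivative of a single function, the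
torus integral of `fluxDensity` (`bochner_pointwise`, `bochner_slice`). That function tends to 0 at
both poles, because S and f'' ∘-type zero-order terms meet the twists of the smooth trivializations
in such a way that the singular parts cancel (`IsPole.norm_opS_sub_le`).

There are two consequences. If χ = η = 0, the flux is monotone with zero end values, so β = 0
(`IsAdmissible.snd_eq_zero`). For μ = r/2 − k/V the remaining equations (T − μ)α = 0 and Bα = 0 say
that α = e^{ikθ}s with s in the kernel of the Cauchy–Riemann operator. If μ is none of the numbers
r/2 − k/V, then T − μ is bounded below on the θ-circles, so γ controls α, and integration in ρ gives
a resolvent estimate (`IsAdmissible.exists_integral_le`); hence μ is not in the spectrum.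

The kernel on S² is found by Fourier expansion in t. The n-th mode solves a first-order linear
equation in ρ whose solutions behave like ρ^{−n} at one pole and (2 − ρ)^{n + 2[r]} at the other.
They are smooth sections exactly for −2[r] ≤ n ≤ 0, which gives dimension 2[r] + 1 and, in
particular, an eigenspinor for every k. -/

namespace DiracHat

open MeasureTheory Set Filter Topology

/-! ## Calculus in polar coordinates -/

/-- The range of the polar coordinates. -/
def polarDomain : Set (ℝ × ℝ × ℝ) := Ioo (0 : ℝ) 2 ×ˢ univ

/-- A fundamental domain for the torus of the angles `(t, θ)`. -/
def torusBox : Set (ℝ × ℝ) := Ioc (0 : ℝ) (2 * Real.pi) ×ˢ Ioc (0 : ℝ) (2 * Real.pi)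

section

variable {E : Type*} [NormedAddCommGroup E] [NormedSpace ℝ E]

/-- The partial derivative in `ρ`. -/
noncomputable def dRho (u : ℝ × ℝ × ℝ → E) (p : ℝ × ℝ × ℝ) : E := fderiv ℝ u p (1, 0, 0)

/-- The partial derivative in `t`. -/
noncomputable def dT (u : ℝ × ℝ × ℝ → E) (p : ℝ × ℝ × ℝ) : E := fderiv ℝ u p (0, 1, 0)

/-- The partial derivative in `θ`. -/
noncomputable def dTheta (u : ℝ × ℝ × ℝ → E) (p : ℝ × ℝ × ℝ) : E := fderiv ℝ u p (0, 0, 1)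

/-- Functions of `(ρ, t, θ)`, smooth for `0 < ρ < 2` and `2π`-periodic in `t` and `θ`. -/
structure SmoothPeriodic (u : ℝ × ℝ × ℝ → E) : Prop where
  smooth : ContDiffOn ℝ ∞ u polarDomain
  per_t : ∀ ρ t θ : ℝ, u (ρ, t + 2 * Real.pi, θ) = u (ρ, t, θ)
  per_theta : ∀ ρ t θ : ℝ, u (ρ, t, θ + 2 * Real.pi) = u (ρ, t, θ)

theorem isOpen_polarDomain : IsOpen polarDomain := isOpen_Ioo.prod isOpen_univ

theorem mem_polarDomain {p : ℝ × ℝ × ℝ} : p ∈ polarDomain ↔ p.1 ∈ Ioo (0 : ℝ) 2 := by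
  simp [polarDomain]

theorem mem_nhds_polarDomain {p : ℝ × ℝ × ℝ} (hp : p ∈ polarDomain) : polarDomain ∈ 𝓝 p :=
  isOpen_polarDomain.mem_nhds hp

theorem fderiv_translate {u : ℝ × ℝ × ℝ → E} {a : ℝ × ℝ × ℝ} (h : ∀ p, u (p + a) = u p)
    (p : ℝ × ℝ × ℝ) : fderiv ℝ u (p + a) = fderiv ℝ u p := by
  conv_rhs => rw [show u = fun x => u (x + a) from funext fun x => (h x).symm]
  rw [fderiv_comp_add_right]

namespace SmoothPeriodic

variable {u v : ℝ × ℝ × ℝ → E}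

theorem dir (hu : SmoothPeriodic u) (w : ℝ × ℝ × ℝ) :
    SmoothPeriodic (fun p => fderiv ℝ u p w) where
  smooth := (hu.smooth.fderiv_of_isOpen isOpen_polarDomain (by simp)).clm_apply contDiffOn_const
  per_t ρ t θ := by
    have := fderiv_translate (u := u) (a := (0, 2 * Real.pi, 0))
      (fun ⟨x, y, z⟩ => by simpa using hu.per_t x y z) (ρ, t, θ)
    simp only [Prod.mk_add_mk, add_zero] at this
    rw [this]
  per_theta ρ t θ := by
    have := fderiv_translate (u := u) (a := (0, 0, 2 * Real.pi))
      (fun ⟨x, y, z⟩ => by simpa using hu.per_theta x y z) (ρ, t, θ)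
    simp only [Prod.mk_add_mk, add_zero] at this
    rw [this]

theorem dRho (hu : SmoothPeriodic u) : SmoothPeriodic (dRho u) := hu.dir _
theorem dT (hu : SmoothPeriodic u) : SmoothPeriodic (dT u) := hu.dir _
theorem dTheta (hu : SmoothPeriodic u) : SmoothPeriodic (dTheta u) := hu.dir _

theorem add (hu : SmoothPeriodic u) (hv : SmoothPeriodic v) :
    SmoothPeriodic (fun p => u p + v p) :=
  ⟨hu.smooth.add hv.smooth, fun ρ t θ => by rw [hu.per_t, hv.per_t],
    fun ρ t θ => by rw [hu.per_theta, hv.per_theta]⟩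

theorem sub (hu : SmoothPeriodic u) (hv : SmoothPeriodic v) :
    SmoothPeriodic (fun p => u p - v p) :=
  ⟨hu.smooth.sub hv.smooth, fun ρ t θ => by rw [hu.per_t, hv.per_t],
    fun ρ t θ => by rw [hu.per_theta, hv.per_theta]⟩

theorem neg (hu : SmoothPeriodic u) : SmoothPeriodic (fun p => -u p) :=
  ⟨hu.smooth.neg, fun ρ t θ => by rw [hu.per_t], fun ρ t θ => by rw [hu.per_theta]⟩

theorem clm {F : Type*} [NormedAddCommGroup F] [NormedSpace ℝ F] (L : E →L[ℝ] F)
    (hu : SmoothPeriodic u) : SmoothPeriodic (fun p => L (u p)) :=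
  ⟨L.contDiff.comp_contDiffOn hu.smooth, fun ρ t θ => by rw [hu.per_t],
    fun ρ t θ => by rw [hu.per_theta]⟩

theorem comp_fst {a : ℝ → E} (ha : ContDiffOn ℝ ∞ a (Ioo 0 2)) :
    SmoothPeriodic (fun p : ℝ × ℝ × ℝ => a p.1) :=
  ⟨ha.comp contDiffOn_fst fun _ hp => mem_polarDomain.1 hp, fun _ _ _ => rfl, fun _ _ _ => rfl⟩

theorem mul {u v : ℝ × ℝ × ℝ → ℂ} (hu : SmoothPeriodic u) (hv : SmoothPeriodic v) :
    SmoothPeriodic (fun p => u p * v p) :=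
  ⟨hu.smooth.mul hv.smooth, fun ρ t θ => by rw [hu.per_t, hv.per_t],
    fun ρ t θ => by rw [hu.per_theta, hv.per_theta]⟩

theorem const_mul {u : ℝ × ℝ × ℝ → ℂ} (c : ℂ) (hu : SmoothPeriodic u) :
    SmoothPeriodic (fun p => c * u p) :=
  ⟨contDiffOn_const.mul hu.smooth, fun ρ t θ => by rw [hu.per_t],
    fun ρ t θ => by rw [hu.per_theta]⟩

theorem rho_mul {u : ℝ × ℝ × ℝ → ℂ} {a : ℝ → ℝ} (ha : ContDiffOn ℝ ∞ a (Ioo 0 2))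
    (hu : SmoothPeriodic u) : SmoothPeriodic (fun p => (a p.1 : ℂ) * u p) :=
  ((comp_fst ha).clm Complex.ofRealCLM).mul hu

theorem rho_smul {a : ℝ → ℝ} (ha : ContDiffOn ℝ ∞ a (Ioo 0 2))
    (hu : SmoothPeriodic u) : SmoothPeriodic (fun p => a p.1 • u p) :=
  ⟨(comp_fst ha).smooth.smul hu.smooth, fun ρ t θ => by rw [hu.per_t],
    fun ρ t θ => by rw [hu.per_theta]⟩

theorem inner {u v : ℝ × ℝ × ℝ → ℂ} (hu : SmoothPeriodic u) (hv : SmoothPeriodic v) :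
    SmoothPeriodic (fun p => inner ℝ (u p) (v p)) :=
  ⟨hu.smooth.inner ℝ hv.smooth, fun ρ t θ => by rw [hu.per_t, hv.per_t],
    fun ρ t θ => by rw [hu.per_theta, hv.per_theta]⟩

theorem contDiffAt (hu : SmoothPeriodic u) {p : ℝ × ℝ × ℝ} (hp : p ∈ polarDomain) :
    ContDiffAt ℝ ∞ u p := hu.smooth.contDiffAt (mem_nhds_polarDomain hp)

theorem differentiableAt (hu : SmoothPeriodic u) {p : ℝ × ℝ × ℝ} (hp : p ∈ polarDomain) :
    DifferentiableAt ℝ u p := (hu.contDiffAt hp).differentiableAt (by simp)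

theorem dir_comm (hu : SmoothPeriodic u) {p : ℝ × ℝ × ℝ} (hp : p ∈ polarDomain)
    (a b : ℝ × ℝ × ℝ) :
    fderiv ℝ (fun x => fderiv ℝ u x a) p b = fderiv ℝ (fun x => fderiv ℝ u x b) p a := by
  have hd : DifferentiableAt ℝ (fderiv ℝ u) p :=
    ((hu.smooth.fderiv_of_isOpen (m := ∞) isOpen_polarDomain (by simp)).contDiffAt
      (mem_nhds_polarDomain hp)).differentiableAt (by simp)
  have hs : IsSymmSndFDerivAt ℝ u p := (hu.contDiffAt hp).isSymmSndFDerivAt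
    (by rw [minSmoothness_of_isRCLikeNormedField]; exact WithTop.coe_le_coe.2 (le_top (a := (2 : ℕ∞))))
  rw [fderiv_clm_apply hd (differentiableAt_const a), fderiv_clm_apply hd (differentiableAt_const b)]
  simpa using hs b a

theorem hasDerivAt_rho (hu : SmoothPeriodic u) {ρ : ℝ} (hρ : ρ ∈ Ioo (0 : ℝ) 2) (q : ℝ × ℝ) :
    HasDerivAt (fun x => u (x, q)) (DiracHat.dRho u (ρ, q)) ρ := by
  have h1 : HasFDerivAt u (fderiv ℝ u (ρ, q)) (ρ, q) :=
    (hu.differentiableAt (mem_polarDomain.2 hρ)).hasFDerivAt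
  exact h1.comp_hasDerivAt ρ ((hasDerivAt_id ρ).prodMk (hasDerivAt_const ρ q))

theorem hasDerivAt_t (hu : SmoothPeriodic u) {ρ : ℝ} (hρ : ρ ∈ Ioo (0 : ℝ) 2) (t θ : ℝ) :
    HasDerivAt (fun x => u (ρ, x, θ)) (DiracHat.dT u (ρ, t, θ)) t := by
  have h1 : HasFDerivAt u (fderiv ℝ u (ρ, t, θ)) (ρ, t, θ) :=
    (hu.differentiableAt (mem_polarDomain.2 hρ)).hasFDerivAt
  exact h1.comp_hasDerivAt t
    ((hasDerivAt_const t ρ).prodMk ((hasDerivAt_id t).prodMk (hasDerivAt_const t θ)))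

theorem hasDerivAt_theta (hu : SmoothPeriodic u) {ρ : ℝ} (hρ : ρ ∈ Ioo (0 : ℝ) 2) (t θ : ℝ) :
    HasDerivAt (fun x => u (ρ, t, x)) (DiracHat.dTheta u (ρ, t, θ)) θ := by
  have h1 : HasFDerivAt u (fderiv ℝ u (ρ, t, θ)) (ρ, t, θ) :=
    (hu.differentiableAt (mem_polarDomain.2 hρ)).hasFDerivAt
  exact h1.comp_hasDerivAt θ
    ((hasDerivAt_const θ ρ).prodMk ((hasDerivAt_const θ t).prodMk (hasDerivAt_id θ)))

theorem continuous_slice (hu : SmoothPeriodic u) {ρ : ℝ} (hρ : ρ ∈ Ioo (0 : ℝ) 2) :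
    Continuous (fun q : ℝ × ℝ => u (ρ, q)) :=
  hu.smooth.continuousOn.comp_continuous (by fun_prop) fun _ => mem_polarDomain.2 hρ

end SmoothPeriodic

/-! ### Integration over the torus -/

theorem torusBox_subset :
    torusBox ⊆ Icc (0 : ℝ) (2 * Real.pi) ×ˢ Icc (0 : ℝ) (2 * Real.pi) :=
  prod_mono Ioc_subset_Icc_self Ioc_subset_Icc_self

theorem isCompact_closedBox :
    IsCompact (Icc (0 : ℝ) (2 * Real.pi) ×ˢ Icc (0 : ℝ) (2 * Real.pi)) :=
  isCompact_Icc.prod isCompact_Icc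

theorem measurableSet_torusBox : MeasurableSet torusBox := measurableSet_Ioc.prod measurableSet_Ioc

theorem volume_torusBox_lt_top : volume torusBox < ⊤ :=
  (measure_mono torusBox_subset).trans_lt isCompact_closedBox.measure_lt_top

theorem integrableOn_torusBox {F : Type*} [NormedAddCommGroup F] {v : ℝ × ℝ → F} (hv : Continuous v) :
    IntegrableOn v torusBox :=
  (hv.continuousOn.integrableOn_compact isCompact_closedBox).mono_set torusBox_subset

/-- The integral over the torus `{ρ} × S¹ × S¹`. -/
noncomputable def slice (u : ℝ × ℝ × ℝ → E) (ρ : ℝ) : E := ∫ q in torusBox, u (ρ, q)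

namespace SmoothPeriodic

variable {u v : ℝ × ℝ × ℝ → E}

theorem integrableOn_slice (hu : SmoothPeriodic u) {ρ : ℝ} (hρ : ρ ∈ Ioo (0 : ℝ) 2) :
    IntegrableOn (fun q : ℝ × ℝ => u (ρ, q)) torusBox :=
  integrableOn_torusBox (hu.continuous_slice hρ)

theorem slice_add (hu : SmoothPeriodic u) (hv : SmoothPeriodic v) {ρ : ℝ}
    (hρ : ρ ∈ Ioo (0 : ℝ) 2) :
    slice (fun p => u p + v p) ρ = slice u ρ + slice v ρ :=
  integral_add (hu.integrableOn_slice hρ) (hv.integrableOn_slice hρ)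

theorem hasDerivAt_slice [CompleteSpace E] (hu : SmoothPeriodic u) {ρ : ℝ}
    (hρ : ρ ∈ Ioo (0 : ℝ) 2) :
    HasDerivAt (slice u) (slice (DiracHat.dRho u) ρ) ρ := by
  obtain ⟨ε, hε, hball⟩ := Metric.nhds_basis_closedBall.mem_iff.1 (isOpen_Ioo.mem_nhds hρ)
  have hK : IsCompact (Metric.closedBall ρ ε ×ˢ
      (Icc (0 : ℝ) (2 * Real.pi) ×ˢ Icc (0 : ℝ) (2 * Real.pi))) :=
    (isCompact_closedBall ρ ε).prod isCompact_closedBox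
  have hsub : Metric.closedBall ρ ε ×ˢ
      (Icc (0 : ℝ) (2 * Real.pi) ×ˢ Icc (0 : ℝ) (2 * Real.pi)) ⊆ polarDomain :=
    fun p hp => mem_polarDomain.2 (hball hp.1)
  obtain ⟨C, hC⟩ := hK.exists_bound_of_continuousOn (hu.dRho.smooth.continuousOn.mono hsub)
  refine (hasDerivAt_integral_of_dominated_loc_of_deriv_le (μ := volume.restrict torusBox)
    (F := fun x q => u (x, q)) (F' := fun x q => DiracHat.dRho u (x, q)) (bound := fun _ => C)
    (Metric.closedBall_mem_nhds ρ hε) ?_ ?_ ?_ ?_ ?_ ?_).2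
  · filter_upwards [isOpen_Ioo.mem_nhds hρ] with x hx
    exact (hu.integrableOn_slice hx).aestronglyMeasurable
  · exact hu.integrableOn_slice hρ
  · exact (hu.dRho.integrableOn_slice hρ).aestronglyMeasurable
  · filter_upwards [ae_restrict_mem measurableSet_torusBox] with q hq x hx
    exact hC (x, q) ⟨hx, torusBox_subset hq⟩
  · exact integrableOn_const volume_torusBox_lt_top.ne
  · filter_upwards with q x hx
    exact hu.hasDerivAt_rho (hball hx) q

theorem slice_dTheta [CompleteSpace E] (hu : SmoothPeriodic u) {ρ : ℝ} (hρ : ρ ∈ Ioo (0 : ℝ) 2) :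
    slice (DiracHat.dTheta u) ρ = 0 := by
  have hc := hu.dTheta.continuous_slice hρ
  unfold slice torusBox
  rw [Measure.volume_eq_prod, setIntegral_prod _ (hu.dTheta.integrableOn_slice hρ)]
  refine integral_eq_zero_of_ae (Eventually.of_forall fun t => ?_)
  simp only [Pi.zero_apply]
  rw [← intervalIntegral.integral_of_le Real.two_pi_pos.le,
    intervalIntegral.integral_eq_sub_of_hasDerivAt (fun θ _ => hu.hasDerivAt_theta hρ t θ)
      ((hc.comp (Continuous.prodMk_right t)).intervalIntegrable _ _)]
  have := hu.per_theta ρ t 0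
  rw [zero_add] at this
  simp [this]

theorem slice_dT [CompleteSpace E] (hu : SmoothPeriodic u) {ρ : ℝ} (hρ : ρ ∈ Ioo (0 : ℝ) 2) :
    slice (DiracHat.dT u) ρ = 0 := by
  have hc := hu.dT.continuous_slice hρ
  unfold slice torusBox
  -- The order of integration is exchanged so that t is the inner variable.
  rw [Measure.volume_eq_prod, ← setIntegral_prod_swap]
  rw [setIntegral_prod (fun z => DiracHat.dT u (ρ, z.swap))
    (hu.dT.integrableOn_slice hρ).swap]
  refine integral_eq_zero_of_ae (Eventually.of_forall fun θ => ?_)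
  simp only [Prod.swap_prod_mk, Pi.zero_apply]
  rw [← intervalIntegral.integral_of_le Real.two_pi_pos.le,
    intervalIntegral.integral_eq_sub_of_hasDerivAt (fun t _ => hu.hasDerivAt_t hρ t θ)
      ((hc.comp (Continuous.prodMk_left θ)).intervalIntegrable _ _)]
  have := hu.per_t ρ 0 θ
  rw [zero_add] at this
  simp [this]

end SmoothPeriodic

end

/-! ## The Dirac operator in polar coordinates -/

section

variable {V r : ℝ} {g h : ℝ → ℝ} {p : ℝ × ℝ × ℝ}

theorem fderiv_frame_zero (w : ℝ × ℝ × ℝ) : fderiv ℝ (frame V g h 0) p w = 0 := by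
  have : frame V g h 0 = fun _ => (1, 0, 0) := rfl
  simp [this]

theorem fderiv_frame_two (w : ℝ × ℝ × ℝ) : fderiv ℝ (frame V g h 2) p w = 0 := by
  have : frame V g h 2 = fun _ => (0, 0, 1 / V) := rfl
  simp [this]

theorem fderiv_frame_one (hf : DifferentiableAt ℝ (deriv h) p.1) (hg : DifferentiableAt ℝ g p.1)
    (hp : deriv h p.1 ≠ 0) (w : ℝ × ℝ × ℝ) :
    fderiv ℝ (frame V g h 1) p w =
      (0, w.1 * (deriv (deriv h) p.1 / deriv h p.1 ^ 2),
        w.1 * (deriv g p.1 / (deriv h p.1 * V)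
          - deriv (deriv h) p.1 / deriv h p.1 ^ 2 * (g p.1 / V))) := by
  have h0 : HasDerivAt (fun x => 1 / deriv h x) (-(deriv (deriv h) p.1 / deriv h p.1 ^ 2)) p.1 := by
    refine ((hasDerivAt_const p.1 (1 : ℝ)).div hf.hasDerivAt hp).congr_deriv ?_
    simp only [zero_mul, one_mul, zero_sub]
    ring
  have h2 : HasDerivAt (fun x => (1 / deriv h x) * (g x / V))
      (deriv g p.1 / (deriv h p.1 * V)
        - deriv (deriv h) p.1 / deriv h p.1 ^ 2 * (g p.1 / V)) p.1 := by
    refine (h0.mul (hg.hasDerivAt.div_const V)).congr_deriv ?_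
    rw [← div_div]
    ring
  have h3 := (hasDerivAt_const p.1 (0 : ℝ)).prodMk (h0.neg.prodMk h2)
  have h4 : HasFDerivAt (frame V g h 1) _ p := h3.hasFDerivAt.comp p hasFDerivAt_fst
  rw [h4.fderiv]
  simp

theorem leviCivita_values (hV : V ≠ 0) (hf : DifferentiableAt ℝ (deriv h) p.1)
    (hg : DifferentiableAt ℝ g p.1) (hp : deriv h p.1 ≠ 0) (j : Fin 3) :
    leviCivita V g h 0 1 j p =
        ![0, deriv (deriv h) p.1 / deriv h p.1, -(deriv g p.1 / deriv h p.1) / 2] j ∧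
      leviCivita V g h 0 2 j p = ![0, -(deriv g p.1 / deriv h p.1) / 2, 0] j ∧
      leviCivita V g h 1 2 j p = ![(deriv g p.1 / deriv h p.1) / 2, 0, 0] j := by
  have h1 := fderiv_frame_one (V := V) hf hg hp
  have e0 : frame V g h 0 p = (1, 0, 0) := rfl
  have e1 : frame V g h 1 p = (0, -(1 / deriv h p.1), (1 / deriv h p.1) * (g p.1 / V)) := rfl
  have e2 : frame V g h 2 p = (0, 0, 1 / V) := rfl
  fin_cases j <;> refine ⟨?_, ?_, ?_⟩ <;>
    simp only [leviCivita, VectorField.lieBracket, Fin.zero_eta, Fin.mk_one, Fin.reduceFinMk,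
      fderiv_frame_zero, fderiv_frame_two, h1, e0, e1, e2, metric, aHat, Matrix.cons_val] <;>
    simp <;> field_simp <;> ring

theorem starDaHat_values (hg : DifferentiableAt ℝ g p.1) (hp : deriv h p.1 ≠ 0)
    (j : Fin 3) :
    starDaHat V g h j p = ![0, 0, -(deriv g p.1 / deriv h p.1)] j := by
  have h1 (w v : ℝ × ℝ × ℝ) : fderiv ℝ (fun x => aHat V g x w) p v
      = v.1 * deriv g p.1 * w.2.1 := by
    have := ((hg.hasDerivAt.comp_hasFDerivAt p
      (hasFDerivAt_fst (𝕜 := ℝ) (E := ℝ) (F := ℝ × ℝ) (p := p))).mul_const w.2.1).const_add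
      (V * w.2.2)
    have h2 : HasFDerivAt (fun x => aHat V g x w) _ p := this
    rw [h2.fderiv]
    simp
    ring
  have e0 : frame V g h 0 p = (1, 0, 0) := rfl
  have e1 : frame V g h 1 p = (0, -(1 / deriv h p.1), (1 / deriv h p.1) * (g p.1 / V)) := rfl
  have e2 : frame V g h 2 p = (0, 0, 1 / V) := rfl
  fin_cases j <;> simp [starDaHat, daHat, h1, e0, e1, e2]
  field_simp

/-- The operator `r/2 + (i/V) ∂_θ`. -/
noncomputable def opT (V r : ℝ) (u : ℝ × ℝ × ℝ → ℂ) (p : ℝ × ℝ × ℝ) : ℂ :=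
  (r / 2 : ℝ) * u p + (1 / V : ℝ) * (Complex.I * dTheta u p)

/-- The operator `i ∂_t - r ĥ - ĝ (r/2 + (i/V) ∂_θ)`. -/
noncomputable def opS (V r : ℝ) (g h : ℝ → ℝ) (u : ℝ × ℝ × ℝ → ℂ) (p : ℝ × ℝ × ℝ) : ℂ :=
  Complex.I * dT u p - (r * h p.1 : ℝ) * u p - (g p.1 : ℝ) * opT V r u p

/-- The operator `B` mapping the first component of a spinor to the second component. -/
noncomputable def opB (V r : ℝ) (g h : ℝ → ℝ) (u : ℝ × ℝ × ℝ → ℂ) (p : ℝ × ℝ × ℝ) : ℂ :=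
  dRho u p - (1 / deriv h p.1 : ℝ) * opS V r g h u p

/-- The formal adjoint of `opB`. -/
noncomputable def opBadj (V r : ℝ) (g h : ℝ → ℝ) (u : ℝ × ℝ × ℝ → ℂ) (p : ℝ × ℝ × ℝ) : ℂ :=
  -dRho u p - (1 / deriv h p.1 : ℝ) * opS V r g h u p
    - (deriv (deriv h) p.1 / deriv h p.1 : ℝ) * u p

/-- The zero-order terms built from ĝ' and ĥ'' (spin connection, θ_1^2, *dâ) cancel on the first
component of the spinor. On the second they leave ĥ''/ĥ', which turns `opBadj` into the adjoint for
the volume ĥ' dρ dt dθ, and ĝ'/(2ĥ'). -/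
theorem dirac_apply (hV : V ≠ 0) (hf : DifferentiableAt ℝ (deriv h) p.1)
    (hg : DifferentiableAt ℝ g p.1) (hp : deriv h p.1 ≠ 0) {ψ : ℝ × ℝ × ℝ → Fin 2 → ℂ}
    (hψ : DifferentiableAt ℝ ψ p) :
    dirac V r g h ψ p =
      ![opT V r (fun x => ψ x 0) p + opBadj V r g h (fun x => ψ x 1) p,
        opB V r g h (fun x => ψ x 0) p - opT V r (fun x => ψ x 1) p
          + (deriv g p.1 / deriv h p.1 / 2 : ℝ) * ψ p 1] := by
  have hd (i : Fin 2) (w : ℝ × ℝ × ℝ) :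
      fderiv ℝ ψ p w i = fderiv ℝ (fun x => ψ x i) p w := by
    rw [fderiv_apply hψ]
    rfl
  have hsplit (i : Fin 2) (a b c : ℝ) : fderiv ℝ (fun x => ψ x i) p (a, b, c) =
      a * dRho (fun x => ψ x i) p + b * dT (fun x => ψ x i) p + c * dTheta (fun x => ψ x i) p := by
    have : ((a, b, c) : ℝ × ℝ × ℝ) = a • (1, 0, 0) + b • (0, 1, 0) + c • (0, 0, 1) := by simp
    rw [this, map_add, map_add, map_smul, map_smul, map_smul]
    simp [dRho, dT, dTheta]
  have e0 : frame V g h 0 p = (1, 0, 0) := rfl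
  have e1 : frame V g h 1 p = (0, -(1 / deriv h p.1), (1 / deriv h p.1) * (g p.1 / V)) := rfl
  have e2 : frame V g h 2 p = (0, 0, 1 / V) := rfl
  have hI : Complex.I ^ 2 = -1 := Complex.I_sq
  have l := leviCivita_values hV hf hg hp
  have s := starDaHat_values (V := V) hg hp
  simp only [dirac, spinForm, Fin.sum_univ_three]
  rw [show Finset.Ioi (0 : Fin 3) = {1, 2} by decide, show Finset.Ioi (1 : Fin 3) = {2} by decide,
    show Finset.Ioi (2 : Fin 3) = ∅ by decide]
  simp only [Finset.sum_pair (show (1 : Fin 3) ≠ 2 by decide), Finset.sum_singleton,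
    Finset.sum_empty, (l _).1, (l _).2.1, (l _).2.2, s, e0, e1, e2, lineForm, aHat, clifford]
  have hfC : ((deriv h p.1 : ℝ) : ℂ) ≠ 0 := by exact_mod_cast hp
  have hVC : (V : ℂ) ≠ 0 := by exact_mod_cast hV
  have hvec (a b c : ℝ) : fderiv ℝ ψ p (a, b, c) =
      ![a * dRho (fun x => ψ x 0) p + b * dT (fun x => ψ x 0) p + c * dTheta (fun x => ψ x 0) p,
        a * dRho (fun x => ψ x 1) p + b * dT (fun x => ψ x 1) p
          + c * dTheta (fun x => ψ x 1) p] := by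
    ext i
    fin_cases i <;> simp [hd, hsplit]
  have hψv : ψ p = ![ψ p 0, ψ p 1] := by
    ext i
    fin_cases i <;> rfl
  rw [hψv]
  simp only [hvec, opT, opS, opB, opBadj]
  ext i
  fin_cases i <;>
    simp [Matrix.vecHead, Matrix.vecTail] <;> field_simp <;> ring_nf <;> simp only [hI] <;> ring

end

/-! ## Commutation and symmetry of the operators -/

section

variable {V r : ℝ} {g h : ℝ → ℝ} {u v : ℝ × ℝ × ℝ → ℂ} {p : ℝ × ℝ × ℝ}

theorem fderiv_mul_const_apply (c : ℂ) (hu : DifferentiableAt ℝ u p) (w : ℝ × ℝ × ℝ) :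
    fderiv ℝ (fun x => c * u x) p w = c * fderiv ℝ u p w := by
  rw [fderiv_const_mul hu]
  rfl

theorem fderiv_rho_mul_apply {a : ℝ → ℝ} (ha : DifferentiableAt ℝ a p.1)
    (hu : DifferentiableAt ℝ u p) (w : ℝ × ℝ × ℝ) :
    fderiv ℝ (fun x => (a x.1 : ℂ) * u x) p w
      = (a p.1 : ℂ) * fderiv ℝ u p w + (w.1 * deriv a p.1 : ℝ) * u p := by
  have h1 : HasFDerivAt (fun x : ℝ × ℝ × ℝ => (a x.1 : ℂ)) _ p :=
    (ha.hasDerivAt.ofReal_comp).hasFDerivAt.comp p hasFDerivAt_fst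
  have h2 : HasFDerivAt (fun x => (a x.1 : ℂ) * u x) _ p := h1.mul hu.hasFDerivAt
  rw [h2.fderiv]
  simp
  ring

theorem SmoothPeriodic.opT (hu : SmoothPeriodic u) : SmoothPeriodic (opT V r u) :=
  (hu.const_mul _).add ((hu.dTheta.const_mul _).const_mul _)

theorem SmoothPeriodic.opS (hg : ContDiffOn ℝ ∞ g (Ioo 0 2)) (hh : ContDiffOn ℝ ∞ h (Ioo 0 2))
    (hu : SmoothPeriodic u) : SmoothPeriodic (opS V r g h u) :=
  ((hu.dT.const_mul _).sub (SmoothPeriodic.rho_mul (a := fun x => r * h x)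
    (contDiffOn_const.mul hh) hu)).sub (hu.opT.rho_mul hg)

theorem fderiv_opT (hu : SmoothPeriodic u) (hp : p ∈ polarDomain) (w : ℝ × ℝ × ℝ) :
    fderiv ℝ (opT V r u) p w = opT V r (fun x => fderiv ℝ u x w) p := by
  have h1 := hu.differentiableAt hp
  have h2 := hu.dTheta.differentiableAt hp
  have h3 := (hu.dTheta.const_mul Complex.I).differentiableAt hp
  have h4 : fderiv ℝ (opT V r u) p = fderiv ℝ (fun x => ((r / 2 : ℝ) : ℂ) * u x) p
      + fderiv ℝ (fun x => ((1 / V : ℝ) : ℂ) * (Complex.I * dTheta u x)) p :=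
    fderiv_add (h1.const_mul _) (h3.const_mul _)
  rw [h4, add_apply, fderiv_mul_const_apply _ h1, fderiv_mul_const_apply _ h3,
    fderiv_mul_const_apply _ h2, opT, show fderiv ℝ (dTheta u) p w =
      dTheta (fun x => fderiv ℝ u x w) p from hu.dir_comm hp _ _]

theorem opT_const_mul (c : ℂ) (hu : SmoothPeriodic u) (hp : p ∈ polarDomain) :
    opT V r (fun x => c * u x) p = c * opT V r u p := by
  have : dTheta (fun x => c * u x) p = c * dTheta u p :=
    fderiv_mul_const_apply c (hu.differentiableAt hp) _
  rw [opT, opT, this]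
  ring

theorem opT_rho_mul {a : ℝ → ℝ} (ha : DifferentiableAt ℝ a p.1) (hu : SmoothPeriodic u)
    (hp : p ∈ polarDomain) :
    opT V r (fun x => (a x.1 : ℂ) * u x) p = (a p.1 : ℂ) * opT V r u p := by
  have : dTheta (fun x => (a x.1 : ℂ) * u x) p = (a p.1 : ℂ) * dTheta u p := by
    rw [dTheta, fderiv_rho_mul_apply ha (hu.differentiableAt hp)]
    simp [dTheta]
  rw [opT, opT, this]
  ring

theorem opT_sub (hu : SmoothPeriodic u) (hv : SmoothPeriodic v) (hp : p ∈ polarDomain) :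
    opT V r (fun x => u x - v x) p = opT V r u p - opT V r v p := by
  have : dTheta (fun x => u x - v x) p = dTheta u p - dTheta v p := by
    rw [dTheta, fderiv_fun_sub (hu.differentiableAt hp) (hv.differentiableAt hp)]
    rfl
  rw [opT, opT, opT, this]
  ring

theorem opT_opT_comm {r' : ℝ} (hu : SmoothPeriodic u) (hp : p ∈ polarDomain) :
    opT V r' (opT V r u) p = opT V r (opT V r' u) p := by
  have h1 (s : ℝ) : dTheta (opT V s u) p = opT V s (dTheta u) p := fderiv_opT hu hp _
  rw [opT, h1, opT.eq_def V r (opT V r' u), h1]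
  simp only [opT]
  ring

theorem opT_opS_comm {r' : ℝ} (hg : ContDiffOn ℝ ∞ g (Ioo 0 2)) (hh : ContDiffOn ℝ ∞ h (Ioo 0 2))
    (hu : SmoothPeriodic u) (hp : p ∈ polarDomain) :
    opT V r' (opS V r g h u) p = opS V r g h (opT V r' u) p := by
  have hn := isOpen_Ioo.mem_nhds (mem_polarDomain.1 hp)
  have hh' : ContDiffOn ℝ ∞ (fun x => r * h x) (Ioo 0 2) := contDiffOn_const.mul hh
  have e : opS V r g h u = fun x => (Complex.I * dT u x - ((fun y => r * h y) x.1 : ℝ) * u x)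
    - (g x.1 : ℂ) * opT V r u x := rfl
  rw [e, opT_sub ((hu.dT.const_mul _).sub (SmoothPeriodic.rho_mul hh' hu)) (hu.opT.rho_mul hg) hp,
    opT_sub (hu.dT.const_mul _) (SmoothPeriodic.rho_mul hh' hu) hp, opT_const_mul _ hu.dT hp,
    opT_rho_mul ((hh'.contDiffAt hn).differentiableAt (by simp)) hu hp,
    opT_rho_mul ((hg.contDiffAt hn).differentiableAt (by simp)) hu.opT hp, opT_opT_comm hu hp,
    opS, show dT (opT V r' u) p = opT V r' (dT u) p from fderiv_opT hu hp _]

/-- No coefficient depends on θ. The parameter `r'` is separate from `r` so that the result applies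
to T − μ, which is `opT` with parameter r − 2μ. -/
theorem opT_opB_comm {r' : ℝ} (hg : ContDiffOn ℝ ∞ g (Ioo 0 2)) (hh : ContDiffOn ℝ ∞ h (Ioo 0 2))
    (hf : ContDiffOn ℝ ∞ (fun x => 1 / deriv h x) (Ioo 0 2))
    (hu : SmoothPeriodic u) (hp : p ∈ polarDomain) :
    opT V r' (opB V r g h u) p = opB V r g h (opT V r' u) p := by
  have hn := isOpen_Ioo.mem_nhds (mem_polarDomain.1 hp)
  have e : opB V r g h u = fun x => dRho u x
    - (((fun y => 1 / deriv h y) x.1 : ℝ) : ℂ) * opS V r g h u x := rfl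
  rw [e, opT_sub hu.dRho ((hu.opS hg hh).rho_mul hf) hp,
    opT_rho_mul ((hf.contDiffAt hn).differentiableAt (by simp)) (hu.opS hg hh) hp,
    opT_opS_comm hg hh hu hp, opB,
    show dRho (opT V r' u) p = opT V r' (dRho u) p from fderiv_opT hu hp _]

/-- This commutator is the curvature of the connection: the term r ĥ' is the source of the spectral
gap on second components. -/
theorem dRho_opS (hg : ContDiffOn ℝ ∞ g (Ioo 0 2)) (hh : ContDiffOn ℝ ∞ h (Ioo 0 2))
    (hu : SmoothPeriodic u) (hp : p ∈ polarDomain) :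
    dRho (opS V r g h u) p = opS V r g h (dRho u) p
      - ((r * deriv h p.1 : ℝ) * u p + (deriv g p.1 : ℝ) * opT V r u p) := by
  have hn := isOpen_Ioo.mem_nhds (mem_polarDomain.1 hp)
  have hh1 := (hh.contDiffAt hn).differentiableAt (n := ∞) (by simp)
  have hg1 := (hg.contDiffAt hn).differentiableAt (n := ∞) (by simp)
  have hh' : ContDiffOn ℝ ∞ (fun x => r * h x) (Ioo 0 2) := contDiffOn_const.mul hh
  have e : opS V r g h u = fun x => (Complex.I * dT u x - ((fun y => r * h y) x.1 : ℝ) * u x)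
    - (g x.1 : ℂ) * opT V r u x := rfl
  have k1 : DifferentiableAt ℝ (fun x => Complex.I * dT u x) p :=
    (hu.dT.const_mul Complex.I).differentiableAt hp
  have k2 : DifferentiableAt ℝ (fun x => ((fun y => r * h y) x.1 : ℝ) * u x) p :=
    (SmoothPeriodic.rho_mul hh' hu).differentiableAt hp
  have k3 : DifferentiableAt ℝ (fun x => (g x.1 : ℂ) * opT V r u x) p :=
    ((hu.opT (V := V) (r := r)).rho_mul hg).differentiableAt hp
  have k4 : deriv (fun y => r * h y) p.1 = r * deriv h p.1 := deriv_const_mul _ hh1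
  rw [dRho, e, fderiv_fun_sub (k1.fun_sub k2) k3, fderiv_fun_sub k1 k2]
  simp only [sub_apply]
  rw [fderiv_mul_const_apply _ (hu.dT.differentiableAt hp),
    fderiv_rho_mul_apply (hh1.const_mul r) (hu.differentiableAt hp),
    fderiv_rho_mul_apply hg1 (hu.opT.differentiableAt hp), fderiv_opT hu hp,
    show fderiv ℝ (dT u) p (1, 0, 0) = dT (dRho u) p from hu.dir_comm hp _ _, k4, opS]
  simp only [one_mul]
  rw [show (fun x => fderiv ℝ u x (1, 0, 0)) = dRho u from rfl,
    show fderiv ℝ u p (1, 0, 0) = dRho u p from rfl]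
  ring

theorem inner_I_mul_right (z w : ℂ) : inner ℝ z (Complex.I * w) = -inner ℝ (Complex.I * z) w := by
  simp [Complex.inner]
  ring

theorem fderiv_inner_I (hu : SmoothPeriodic u) (hv : SmoothPeriodic v) (hp : p ∈ polarDomain)
    (w : ℝ × ℝ × ℝ) :
    fderiv ℝ (fun x => inner ℝ (u x) (Complex.I * v x)) p w =
      inner ℝ (u p) (Complex.I * fderiv ℝ v p w) - inner ℝ (Complex.I * fderiv ℝ u p w) (v p) := by
  rw [fderiv_inner_apply ℝ (hu.differentiableAt hp) ((hv.const_mul _).differentiableAt hp),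
    fderiv_mul_const_apply _ (hv.differentiableAt hp), inner_I_mul_right (fderiv ℝ u p w)]
  ring

theorem slice_congr {E : Type*} [NormedAddCommGroup E] [NormedSpace ℝ E] {u v : ℝ × ℝ × ℝ → E}
    {ρ : ℝ} (huv : ∀ q, u (ρ, q) = v (ρ, q)) : slice u ρ = slice v ρ := by
  simp only [slice, huv]

theorem slice_const_mul (a : ℝ) (F : ℝ × ℝ × ℝ → ℝ) (ρ : ℝ) :
    slice (fun p => a * F p) ρ = a * slice F ρ := integral_const_mul _ _

theorem inner_real_mul_right (a : ℝ) (z w : ℂ) : inner ℝ z ((a : ℂ) * w) = a * inner ℝ z w := by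
  rw [← Complex.real_smul, real_inner_smul_right]

theorem inner_real_mul_left (a : ℝ) (z w : ℂ) : inner ℝ ((a : ℂ) * z) w = a * inner ℝ z w := by
  rw [← Complex.real_smul, real_inner_smul_left]

/-- The defect of symmetry of an operator. -/
noncomputable def symDefect (A : (ℝ × ℝ × ℝ → ℂ) → ℝ × ℝ × ℝ → ℂ) (u v : ℝ × ℝ × ℝ → ℂ)
    (p : ℝ × ℝ × ℝ) : ℝ := inner ℝ (u p) (A v p) - inner ℝ (A u p) (v p)

/-- T differentiates along the torus only and its coefficients are constant there, so the defect is
an exact θ-derivative. Hence symmetry holds on each torus separately, before any integration in ρ;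
the same applies to S. -/
theorem symDefect_opT_eq (hu : SmoothPeriodic u) (hv : SmoothPeriodic v) (hp : p ∈ polarDomain) :
    symDefect (opT V r) u v p = 1 / V * dTheta (fun x => inner ℝ (u x) (Complex.I * v x)) p := by
  rw [dTheta, fderiv_inner_I hu hv hp]
  simp only [symDefect, opT, inner_add_right, inner_add_left, inner_real_mul_right,
    inner_real_mul_left, dTheta]
  ring

theorem symDefect_opS_eq (hu : SmoothPeriodic u) (hv : SmoothPeriodic v) (hp : p ∈ polarDomain) :
    symDefect (opS V r g h) u v p = dT (fun x => inner ℝ (u x) (Complex.I * v x)) p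
      + -(g p.1 / V) * dTheta (fun x => inner ℝ (u x) (Complex.I * v x)) p := by
  have h1 := symDefect_opT_eq (V := V) (r := r) hu hv hp
  have h2 : symDefect (opS V r g h) u v p = dT (fun x => inner ℝ (u x) (Complex.I * v x)) p
      - g p.1 * symDefect (opT V r) u v p := by
    rw [dT, fderiv_inner_I hu hv hp]
    simp only [symDefect, opS, inner_sub_right, inner_sub_left, inner_real_mul_right,
      inner_real_mul_left, dT]
    ring
  rw [h2, h1]
  ring

theorem SmoothPeriodic.symDefect_opT (hu : SmoothPeriodic u) (hv : SmoothPeriodic v) :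
    SmoothPeriodic (symDefect (DiracHat.opT V r) u v) :=
  (hu.inner hv.opT).sub (hu.opT.inner hv)

theorem SmoothPeriodic.symDefect_opS (hg : ContDiffOn ℝ ∞ g (Ioo 0 2))
    (hh : ContDiffOn ℝ ∞ h (Ioo 0 2)) (hu : SmoothPeriodic u) (hv : SmoothPeriodic v) :
    SmoothPeriodic (symDefect (DiracHat.opS V r g h) u v) :=
  (hu.inner (hv.opS hg hh)).sub ((hu.opS hg hh).inner hv)

theorem slice_symDefect_opT (hu : SmoothPeriodic u) (hv : SmoothPeriodic v) {ρ : ℝ}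
    (hρ : ρ ∈ Ioo (0 : ℝ) 2) : slice (symDefect (opT V r) u v) ρ = 0 := by
  rw [slice_congr (u := symDefect (opT V r) u v) (v := fun p => 1 / V *
    dTheta (fun x => inner ℝ (u x) (Complex.I * v x)) p)
      fun q => symDefect_opT_eq hu hv (mem_polarDomain.2 hρ), slice_const_mul,
    (hu.inner (hv.const_mul _)).slice_dTheta hρ, mul_zero]

theorem slice_symDefect_opS (hu : SmoothPeriodic u) (hv : SmoothPeriodic v) {ρ : ℝ}
    (hρ : ρ ∈ Ioo (0 : ℝ) 2) : slice (symDefect (opS V r g h) u v) ρ = 0 := by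
  have hW := hu.inner (hv.const_mul Complex.I)
  rw [slice_congr (v := fun p => dT (fun x => inner ℝ (u x) (Complex.I * v x)) p
      + -(g ρ / V) * dTheta (fun x => inner ℝ (u x) (Complex.I * v x)) p)
      fun q => symDefect_opS_eq hu hv (mem_polarDomain.2 hρ),
    SmoothPeriodic.slice_add (v := fun p => -(g ρ / V) *
      dTheta (fun x => inner ℝ (u x) (Complex.I * v x)) p) hW.dT
      (hW.dTheta.rho_smul (a := fun _ => -(g ρ / V)) contDiffOn_const) hρ, hW.slice_dT hρ,
    slice_const_mul, hW.slice_dTheta hρ, mul_zero, add_zero]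

end

/-! ## The pointwise Bochner inequality -/

/-- The letters are values at one point: b = β, γ = (T − μ)α, w = Bα, y = B*β, χ and η the
components of (D̂ − μ)(α, β), and f, f1, f2 = ĥ', ĥ'', ĥ'''. The right side is the ρ-derivative of
the flux density, corrected by three symmetry defects. Exactly half of ‖y‖² is expanded through the
commutator: the resulting cross term (g1/f)⟨b, Tb⟩/2 then cancels the one produced by the zero-order
term of η. -/
theorem bochner_pointwise {f f1 f2 g1 r μ : ℝ} (hf : 0 < f) (hr : 0 < r) (hμ : μ ^ 2 ≤ r / 3)
    (hk : r / 12 ≤ r / 2 - μ ^ 2 + μ * (g1 / f) / 2 - f2 / f / 2)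
    {b bρ Sb Tb Sbρ γ γρ Sγ w Tw y χ η : ℂ}
    (hy : y = -bρ - (1 / f : ℝ) * Sb - (f1 / f : ℝ) * b)
    (hχ : χ = γ + y)
    (hη : η = w - Tb - (μ : ℝ) * b + (g1 / f / 2 : ℝ) * b)
    (hc : γρ - (1 / f : ℝ) * Sγ = Tw) :
    f * (‖y‖ ^ 2 / 4 + r / 24 * ‖b‖ ^ 2 - ‖χ‖ ^ 2 - 3 * ‖η‖ ^ 2) ≤
      f1 * inner ℝ b γ + f * (inner ℝ bρ γ + inner ℝ b γρ)
        - (inner ℝ (Sbρ - ((r * f : ℝ) * b + (g1 : ℝ) * Tb) + ((f2 : ℝ) * b + (f1 : ℝ) * bρ)) b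
            + inner ℝ (Sb + (f1 : ℝ) * b) bρ) / 2
        - (inner ℝ b Sγ - inner ℝ Sb γ)
        - f * (inner ℝ b Tw - inner ℝ (Tb - (μ : ℝ) * b) w)
        + (inner ℝ b Sbρ - inner ℝ Sb bρ) / 2 := by
  obtain ⟨c, rfl⟩ : ∃ c, g1 = f * c := ⟨g1 / f, by field_simp⟩
  obtain ⟨k, rfl⟩ : ∃ k, f2 = f * k := ⟨f2 / f, by field_simp⟩
  rw [mul_div_cancel_left₀ _ hf.ne', mul_div_cancel_left₀ _ hf.ne'] at hk
  rw [mul_div_cancel_left₀ _ hf.ne'] at hη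
  have hfC : (f : ℂ) ≠ 0 := by exact_mod_cast hf.ne'
  obtain rfl : Sb = -(f : ℝ) * (y + bρ) - (f1 : ℝ) * b := by
    rw [hy]
    push_cast
    field_simp
    ring
  obtain rfl : Sγ = (f : ℝ) * (γρ - Tw) := by
    rw [← hc]
    push_cast
    field_simp
    ring
  obtain rfl : γ = χ - y := by rw [hχ]; ring
  obtain rfl : w = η + Tb + (μ : ℝ) * b - (c / 2 : ℝ) * b := by rw [hη]; ring
  -- The right side of `key` is the right side of the lemma divided by f, once Sb, Sγ, γ and w have
  -- been eliminated. The bound follows by completing three squares: y against χ, Tb against η, and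
  -- b against μη.
  have key : ‖y‖ ^ 2 / 4 + r / 24 * ‖b‖ ^ 2 - ‖χ‖ ^ 2 - 3 * ‖η‖ ^ 2 ≤
      ‖y‖ ^ 2 / 2 + ‖bρ‖ ^ 2 / 2 + ‖y + bρ‖ ^ 2 / 2 - inner ℝ y χ + ‖Tb‖ ^ 2
        + (r / 2 - μ ^ 2 + μ * c / 2 - k / 2) * ‖b‖ ^ 2 + inner ℝ (Tb - (μ : ℝ) * b) η := by
    have h1 := sq_nonneg ‖bρ‖
    have h2 := sq_nonneg ‖y + bρ‖
    have h3 : 0 ≤ ‖(1 / 2 : ℝ) • y - χ‖ ^ 2 := sq_nonneg _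
    have h4 : 0 ≤ ‖Tb + (1 / 2 : ℝ) • η‖ ^ 2 := sq_nonneg _
    have h5 : 0 ≤ ‖(r / 12 : ℝ) • b - μ • η‖ ^ 2 := sq_nonneg _
    rw [norm_sub_sq_real, norm_smul, real_inner_smul_left, Real.norm_eq_abs, mul_pow,
      sq_abs] at h3
    rw [norm_add_sq_real, norm_smul, real_inner_smul_right, Real.norm_eq_abs, mul_pow,
      sq_abs] at h4
    rw [norm_sub_sq_real, norm_smul, norm_smul, real_inner_smul_left, real_inner_smul_right,
      Real.norm_eq_abs, Real.norm_eq_abs, mul_pow, mul_pow, sq_abs, sq_abs] at h5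
    have h6 : r / 12 * ‖b‖ ^ 2 ≤ (r / 2 - μ ^ 2 + μ * c / 2 - k / 2) * ‖b‖ ^ 2 :=
      mul_le_mul_of_nonneg_right hk (sq_nonneg _)
    have h7 : μ ^ 2 * ‖η‖ ^ 2 ≤ r / 3 * ‖η‖ ^ 2 := mul_le_mul_of_nonneg_right hμ (sq_nonneg _)
    -- Half of the available (r/12)‖b‖² is spent here; μ² ≤ r/3 makes the price in ‖η‖² independent
    -- of r.
    have h8 : μ * inner ℝ b η ≤ r / 24 * ‖b‖ ^ 2 + 2 * ‖η‖ ^ 2 := by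
      have : r / 6 * (μ * inner ℝ b η) ≤ r / 6 * (r / 24 * ‖b‖ ^ 2 + 2 * ‖η‖ ^ 2) := by
        nlinarith
      exact le_of_mul_le_mul_left this (by positivity)
    rw [inner_sub_left, inner_real_mul_left]
    nlinarith [sq_nonneg ‖η‖]
  refine (mul_le_mul_of_nonneg_left key hf.le).trans (le_of_eq ?_)
  simp only [Complex.inner, ← Complex.normSq_eq_norm_sq, Complex.normSq_apply]
  simp
  ring

/-! ## A Poincaré inequality on the circle -/

/-- The variance of v about its mean m is nonnegative. -/
theorem sq_integral_le {v : ℝ → ℝ} (hv : Continuous v) {L : ℝ} (hL : 0 < L) :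
    (∫ x in Ioc 0 L, v x) ^ 2 ≤ L * ∫ x in Ioc 0 L, v x ^ 2 := by
  have hi {w : ℝ → ℝ} (hw : Continuous w) : IntegrableOn w (Ioc 0 L) :=
    (hw.integrableOn_Icc).mono_set Ioc_subset_Icc_self
  set m := (∫ x in Ioc 0 L, v x) / L with hm
  have h0 : 0 ≤ ∫ x in Ioc 0 L, (v x - m) ^ 2 := integral_nonneg fun x => sq_nonneg _
  have h1 : ∫ x in Ioc 0 L, (v x - m) ^ 2 =
      (∫ x in Ioc 0 L, v x ^ 2) - 2 * m * (∫ x in Ioc 0 L, v x) + m ^ 2 * L := by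
    have e (x : ℝ) : (v x - m) ^ 2 = (v x ^ 2 - 2 * m * v x) + m ^ 2 := by ring
    simp only [e]
    rw [integral_add (hi (w := fun x => v x ^ 2 - 2 * m * v x) (by fun_prop)) (hi continuous_const),
      integral_sub (hi (w := fun x => v x ^ 2) (by fun_prop)) (hi (by fun_prop)),
      integral_const_mul]
    simp [hL.le]
    ring
  have h2 : (∫ x in Ioc 0 L, v x) = m * L := by rw [hm]; field_simp
  rw [h1, h2] at h0
  rw [h2]
  nlinarith

/-- A periodic solution of `u' = i s u + w`, `s` not an integer, is controlled by `w`. -/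
theorem norm_sq_le_of_periodic {u w : ℝ → ℂ} {s : ℝ}
    (hu : ∀ x, HasDerivAt u (Complex.I * s * u x + w x) x) (hw : Continuous w)
    (hup : ∀ x, u (x + 2 * Real.pi) = u x) (hwp : ∀ x, w (x + 2 * Real.pi) = w x) (x : ℝ) :
    ‖Complex.exp (-(2 * Real.pi * s * Complex.I)) - 1‖ ^ 2 * ‖u x‖ ^ 2 ≤
      2 * Real.pi * ∫ θ in Ioc 0 (2 * Real.pi), ‖w θ‖ ^ 2 := by
  have hE (y : ℝ) : HasDerivAt (fun y : ℝ => Complex.exp (-(s * Complex.I) * (y - x)))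
      (Complex.exp (-(s * Complex.I) * (y - x)) * (-(s * Complex.I))) y := by
    have h1 : HasDerivAt (fun y : ℝ => -(s * Complex.I) * ((y : ℂ) - x)) (-(s * Complex.I)) y := by
      simpa using (((hasDerivAt_id y).ofReal_comp).sub_const (x : ℂ)).const_mul (-(s * Complex.I))
    exact h1.cexp
  have hv (y : ℝ) : HasDerivAt (fun y : ℝ => Complex.exp (-(s * Complex.I) * (y - x)) * u y)
      (Complex.exp (-(s * Complex.I) * (y - x)) * w y) y := by
    refine ((hE y).mul (hu y)).congr_deriv ?_
    ring
  have hc : Continuous fun y : ℝ => Complex.exp (-(s * Complex.I) * (y - x)) * w y := by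
    fun_prop
  have hftc := intervalIntegral.integral_eq_sub_of_hasDerivAt (a := x) (b := x + 2 * Real.pi)
    (fun y _ => hv y) (hc.intervalIntegrable _ _)
  have hn (y : ℝ) : ‖Complex.exp (-(s * Complex.I) * (y - x))‖ = 1 := by
    have := Complex.norm_exp_ofReal_mul_I (-s * (y - x))
    rw [← this]
    push_cast
    ring_nf
  have hbd : ‖(Complex.exp (-(2 * Real.pi * s * Complex.I)) - 1) * u x‖ ≤
      ∫ θ in Ioc 0 (2 * Real.pi), ‖w θ‖ := by
    -- With the integrating factor e^{−is(y − x)}, integration over one period returns u(x)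
    -- multiplied by e^{−2πis}, so the boundary terms combine into one multiple of u(x).
    have e1 : (Complex.exp (-(2 * Real.pi * s * Complex.I)) - 1) * u x
        = ∫ y in x..(x + 2 * Real.pi), Complex.exp (-(s * Complex.I) * (y - x)) * w y := by
      rw [hftc, hup]
      push_cast
      rw [add_sub_cancel_left, sub_self, mul_zero, Complex.exp_zero,
        show -(s * Complex.I) * (2 * Real.pi) = -(2 * Real.pi * s * Complex.I) by ring]
      ring
    have e2 : ∫ θ in Ioc 0 (2 * Real.pi), ‖w θ‖ = ∫ y in x..(x + 2 * Real.pi), ‖w y‖ := by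
      have hper : Function.Periodic (fun y => ‖w y‖) (2 * Real.pi) := fun y => by
        simp only [hwp]
      have := hper.intervalIntegral_add_eq 0 x
      rw [zero_add] at this
      rw [← this, intervalIntegral.integral_of_le Real.two_pi_pos.le]
    rw [e1, e2]
    refine (intervalIntegral.norm_integral_le_integral_norm (by linarith [Real.pi_pos])).trans ?_
    simp only [norm_mul, hn, one_mul]
    exact le_rfl
  rw [norm_mul] at hbd
  rw [← mul_pow]
  refine (pow_le_pow_left₀ (by positivity) hbd 2).trans ?_
  exact sq_integral_le hw.norm Real.two_pi_pos

/-! ## The Bochner inequality on the tori of constant `ρ` -/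

section

variable {V r μ : ℝ} {g h : ℝ → ℝ} {u v α β : ℝ × ℝ × ℝ → ℂ} {p : ℝ × ℝ × ℝ}

/-- The first component of `(D̂ - μ)(α, β)`. -/
noncomputable def resFst (V r : ℝ) (g h : ℝ → ℝ) (μ : ℝ) (α β : ℝ × ℝ × ℝ → ℂ)
    (p : ℝ × ℝ × ℝ) : ℂ := opT V (r - 2 * μ) α p + opBadj V r g h β p

/-- The second component of `(D̂ - μ)(α, β)`. -/
noncomputable def resSnd (V r : ℝ) (g h : ℝ → ℝ) (μ : ℝ) (α β : ℝ × ℝ × ℝ → ℂ)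
    (p : ℝ × ℝ × ℝ) : ℂ :=
  opB V r g h α p - opT V r β p - (μ : ℝ) * β p
    + (deriv g p.1 / deriv h p.1 / 2 : ℝ) * β p

/-- This lets T − μ inherit every statement proved for T. -/
theorem opT_shift (u : ℝ × ℝ × ℝ → ℂ) (p : ℝ × ℝ × ℝ) :
    opT V (r - 2 * μ) u p = opT V r u p - (μ : ℝ) * u p := by
  simp only [opT]
  push_cast
  ring

/-- The density of the function whose `ρ`-derivative controls spinors. -/
noncomputable def fluxDensity (V r : ℝ) (g h : ℝ → ℝ) (μ : ℝ) (α β : ℝ × ℝ × ℝ → ℂ)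
    (p : ℝ × ℝ × ℝ) : ℝ :=
  deriv h p.1 * inner ℝ (β p) (opT V (r - 2 * μ) α p)
    + (-(1 / 2) : ℝ) * inner ℝ (opS V r g h β p + (deriv (deriv h) p.1 : ℝ) * β p) (β p)

theorem contDiff_deriv {h : ℝ → ℝ} (hh : ContDiff ℝ ∞ h) : ContDiff ℝ ∞ (deriv h) :=
  (contDiff_infty_iff_deriv.1 hh).2

theorem SmoothPeriodic.fluxDensity (hg : ContDiff ℝ ∞ g) (hh : ContDiff ℝ ∞ h)
    (hα : SmoothPeriodic α) (hβ : SmoothPeriodic β) :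
    SmoothPeriodic (fluxDensity V r g h μ α β) := by
  have h1 := contDiff_deriv hh
  exact ((hβ.inner hα.opT).rho_smul h1.contDiffOn).add
    ((((hβ.opS hg.contDiffOn hh.contDiffOn).add
      (hβ.rho_mul (contDiff_deriv h1).contDiffOn)).inner hβ).rho_smul
      (a := fun _ => -(1 / 2)) contDiffOn_const)

theorem contDiffOn_inv_deriv (hh : ContDiff ℝ ∞ h) (hpos : ∀ ρ ∈ Ioo (0 : ℝ) 2, 0 < deriv h ρ) :
    ContDiffOn ℝ ∞ (fun x => 1 / deriv h x) (Ioo 0 2) :=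
  contDiffOn_const.div (contDiff_deriv hh).contDiffOn fun x hx => (hpos x hx).ne'

theorem SmoothPeriodic.opB (hg : ContDiff ℝ ∞ g) (hh : ContDiff ℝ ∞ h)
    (hpos : ∀ ρ ∈ Ioo (0 : ℝ) 2, 0 < deriv h ρ) (hu : SmoothPeriodic u) :
    SmoothPeriodic (opB V r g h u) :=
  hu.dRho.sub ((hu.opS hg.contDiffOn hh.contDiffOn).rho_mul (contDiffOn_inv_deriv hh hpos))

theorem SmoothPeriodic.opBadj (hg : ContDiff ℝ ∞ g) (hh : ContDiff ℝ ∞ h)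
    (hpos : ∀ ρ ∈ Ioo (0 : ℝ) 2, 0 < deriv h ρ) (hu : SmoothPeriodic u) :
    SmoothPeriodic (opBadj V r g h u) :=
  (hu.dRho.neg.sub
    ((hu.opS hg.contDiffOn hh.contDiffOn).rho_mul (contDiffOn_inv_deriv hh hpos))).sub
    (hu.rho_mul (a := fun x => deriv (deriv h) x / deriv h x)
      ((contDiff_deriv (contDiff_deriv hh)).contDiffOn.div (contDiff_deriv hh).contDiffOn
        fun x hx => (hpos x hx).ne'))

theorem SmoothPeriodic.resFst (hg : ContDiff ℝ ∞ g) (hh : ContDiff ℝ ∞ h)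
    (hpos : ∀ ρ ∈ Ioo (0 : ℝ) 2, 0 < deriv h ρ) (hα : SmoothPeriodic α)
    (hβ : SmoothPeriodic β) : SmoothPeriodic (resFst V r g h μ α β) :=
  hα.opT.add (hβ.opBadj hg hh hpos)

theorem SmoothPeriodic.resSnd (hg : ContDiff ℝ ∞ g) (hh : ContDiff ℝ ∞ h)
    (hpos : ∀ ρ ∈ Ioo (0 : ℝ) 2, 0 < deriv h ρ) (hα : SmoothPeriodic α)
    (hβ : SmoothPeriodic β) : SmoothPeriodic (resSnd V r g h μ α β) :=
  (((hα.opB hg hh hpos).sub hβ.opT).sub (hβ.const_mul _)).add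
    (hβ.rho_mul (a := fun x => deriv g x / deriv h x / 2)
      (((contDiff_deriv hg).contDiffOn.div (contDiff_deriv hh).contDiffOn
        fun x hx => (hpos x hx).ne').div_const _))

theorem dRho_fluxDensity (hg : ContDiff ℝ ∞ g) (hh : ContDiff ℝ ∞ h)
    (hα : SmoothPeriodic α) (hβ : SmoothPeriodic β) (hp : p ∈ polarDomain) :
    dRho (fluxDensity V r g h μ α β) p =
      deriv (deriv h) p.1 * inner ℝ (β p) (opT V (r - 2 * μ) α p)
        + deriv h p.1 * (inner ℝ (dRho β p) (opT V (r - 2 * μ) α p)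
          + inner ℝ (β p) (dRho (opT V (r - 2 * μ) α) p))
        - (inner ℝ (opS V r g h (dRho β) p - ((r * deriv h p.1 : ℝ) * β p
            + (deriv g p.1 : ℝ) * opT V r β p) + ((deriv (deriv (deriv h)) p.1 : ℝ) * β p
              + (deriv (deriv h) p.1 : ℝ) * dRho β p)) (β p)
          + inner ℝ (opS V r g h β p + (deriv (deriv h) p.1 : ℝ) * β p) (dRho β p)) / 2 := by
  have h1 := contDiff_deriv hh
  have h2 := contDiff_deriv h1
  have hq := mem_polarDomain.1 hp
  have hS := hβ.opS (V := V) (r := r) hg.contDiffOn hh.contDiffOn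
  have hT := hα.opT (V := V) (r := r - 2 * μ)
  have e1 := (h1.differentiable (by simp) p.1).hasDerivAt
  have e2 := (h2.differentiable (by simp) p.1).hasDerivAt
  have d1 := hβ.hasDerivAt_rho hq p.2
  have d2 := hT.hasDerivAt_rho hq p.2
  have d3 := hS.hasDerivAt_rho hq p.2
  have d4 := (e1.mul (d1.inner ℝ d2)).add
    (((d3.add (e2.ofReal_comp.mul d1)).inner ℝ d1).const_mul (-(1 / 2) : ℝ))
  have d5 := (SmoothPeriodic.fluxDensity (V := V) (r := r) (μ := μ) hg hh hα hβ).hasDerivAt_rho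
    hq p.2
  have := d5.unique d4
  rw [show ((p.1, p.2) : ℝ × ℝ × ℝ) = p from rfl] at this
  rw [this, dRho_opS hg.contDiffOn hh.contDiffOn hβ hp]
  simp only [Pi.add_apply, Pi.mul_apply]
  ring

/-- The defects in `bochner_pointwise` have zero integral over the torus, so after integration only
the derivative of the flux is left on the right. -/
theorem bochner_slice (hg : ContDiff ℝ ∞ g) (hh : ContDiff ℝ ∞ h)
    (hpos : ∀ ρ ∈ Ioo (0 : ℝ) 2, 0 < deriv h ρ) (hα : SmoothPeriodic α) (hβ : SmoothPeriodic β)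
    (hr : 0 < r) (hμ : μ ^ 2 ≤ r / 3) {ρ : ℝ} (hρ : ρ ∈ Ioo (0 : ℝ) 2)
    (hk : r / 12 ≤ r / 2 - μ ^ 2 + μ * (deriv g ρ / deriv h ρ) / 2
      - deriv (deriv (deriv h)) ρ / deriv h ρ / 2) :
    deriv h ρ * slice (fun p => ‖opBadj V r g h β p‖ ^ 2 / 4 + r / 24 * ‖β p‖ ^ 2
        - ‖resFst V r g h μ α β p‖ ^ 2 - 3 * ‖resSnd V r g h μ α β p‖ ^ 2) ρ
      ≤ slice (dRho (fluxDensity V r g h μ α β)) ρ := by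
  have hg' := hg.contDiffOn (s := Ioo 0 2)
  have hh' := hh.contDiffOn (s := Ioo 0 2)
  have hγ := hα.opT (V := V) (r := r - 2 * μ)
  have hw := hα.opB (V := V) (r := r) hg hh hpos
  have hfl := (SmoothPeriodic.fluxDensity (V := V) (r := r) (μ := μ) hg hh hα hβ).dRho
  have s1 := SmoothPeriodic.symDefect_opS (V := V) (r := r) hg' hh' hβ hγ
  have s2 := SmoothPeriodic.symDefect_opT (V := V) (r := r - 2 * μ) hβ hw
  have s3 := SmoothPeriodic.symDefect_opS (V := V) (r := r) hg' hh' hβ hβ.dRho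
  have i1 := s1.integrableOn_slice hρ
  have i2 := (s2.integrableOn_slice hρ).const_mul (deriv h ρ)
  have i3 := (s3.integrableOn_slice hρ).const_mul (1 / 2)
  have hy := hβ.opBadj (V := V) (r := r) hg hh hpos
  have hχ := hα.resFst (V := V) (r := r) (μ := μ) hg hh hpos hβ
  have hη := hα.resSnd (V := V) (r := r) (μ := μ) hg hh hpos hβ
  -- Three integrals equal to zero are inserted, to make the integrand the one of
  -- `bochner_pointwise`.
  have e : slice (dRho (fluxDensity V r g h μ α β)) ρ =
      ∫ q in torusBox, (dRho (fluxDensity V r g h μ α β) (ρ, q)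
        - symDefect (opS V r g h) β (opT V (r - 2 * μ) α) (ρ, q)
        - deriv h ρ * symDefect (opT V (r - 2 * μ)) β (opB V r g h α) (ρ, q)
        + 1 / 2 * symDefect (opS V r g h) β (dRho β) (ρ, q)) := by
    have j1 : IntegrableOn (fun q => dRho (fluxDensity V r g h μ α β) (ρ, q)
        - symDefect (opS V r g h) β (opT V (r - 2 * μ) α) (ρ, q)) torusBox :=
      (hfl.integrableOn_slice hρ).sub i1
    have j2 : IntegrableOn (fun q => dRho (fluxDensity V r g h μ α β) (ρ, q)
        - symDefect (opS V r g h) β (opT V (r - 2 * μ) α) (ρ, q)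
        - deriv h ρ * symDefect (opT V (r - 2 * μ)) β (opB V r g h α) (ρ, q)) torusBox :=
      j1.sub i2
    rw [integral_add j2 i3, integral_sub j1 i2,
      integral_sub (hfl.integrableOn_slice hρ) i1, integral_const_mul, integral_const_mul]
    have z1 := slice_symDefect_opS (V := V) (r := r) (g := g) (h := h) hβ hγ hρ
    have z2 := slice_symDefect_opT (V := V) (r := r - 2 * μ) hβ hw hρ
    have z3 := slice_symDefect_opS (V := V) (r := r) (g := g) (h := h) hβ hβ.dRho hρ
    simp only [slice] at z1 z2 z3
    rw [z1, z2, z3]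
    simp [slice]
  rw [e, slice, ← integral_const_mul]
  have hcont : Continuous fun q : ℝ × ℝ => deriv h ρ *
      (‖opBadj V r g h β (ρ, q)‖ ^ 2 / 4 + r / 24 * ‖β (ρ, q)‖ ^ 2
        - ‖resFst V r g h μ α β (ρ, q)‖ ^ 2 - 3 * ‖resSnd V r g h μ α β (ρ, q)‖ ^ 2) := by
    have c1 := hy.continuous_slice hρ
    have c2 := hβ.continuous_slice hρ
    have c3 := hχ.continuous_slice hρ
    have c4 := hη.continuous_slice hρ
    exact continuous_const.mul (((((c1.norm.pow 2).div_const 4).add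
      (continuous_const.mul (c2.norm.pow 2))).sub (c3.norm.pow 2)).sub
      (continuous_const.mul (c4.norm.pow 2)))
  refine integral_mono (integrableOn_torusBox hcont)
    ((((hfl.integrableOn_slice hρ).sub i1).sub i2).add i3) fun q => ?_
  have hp : (ρ, q) ∈ polarDomain := mem_polarDomain.2 hρ
  -- This is Bγ = (T − μ)Bα, the identity on which the whole estimate rests.
  have hBT : dRho (opT V (r - 2 * μ) α) (ρ, q) - (1 / deriv h ρ : ℝ) *
      opS V r g h (opT V (r - 2 * μ) α) (ρ, q) = opT V (r - 2 * μ) (opB V r g h α) (ρ, q) :=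
    (opT_opB_comm hg' hh' (contDiffOn_inv_deriv hh hpos) hα hp).symm
  have := bochner_pointwise (f := deriv h ρ) (f1 := deriv (deriv h) ρ)
    (f2 := deriv (deriv (deriv h)) ρ) (g1 := deriv g ρ) (hpos ρ hρ) hr hμ hk
    (b := β (ρ, q)) (bρ := dRho β (ρ, q)) (Sb := opS V r g h β (ρ, q)) (Tb := opT V r β (ρ, q))
    (Sbρ := opS V r g h (dRho β) (ρ, q)) (γ := opT V (r - 2 * μ) α (ρ, q))
    (w := opB V r g h α (ρ, q))
    (y := opBadj V r g h β (ρ, q)) (χ := resFst V r g h μ α β (ρ, q))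
    (η := resSnd V r g h μ α β (ρ, q)) rfl rfl rfl hBT
  refine this.trans (le_of_eq ?_)
  simp only [symDefect, dRho_fluxDensity hg hh hα hβ hp, opT_shift β]
  ring

end

/-! ### Lower bound for T − μ and the resolvent estimate on a torus -/

section

variable {V r μ : ℝ} {g h : ℝ → ℝ} {u v α β : ℝ × ℝ × ℝ → ℂ} {p : ℝ × ℝ × ℝ}

theorem slice_eq_iterated {E : Type*} [NormedAddCommGroup E] [NormedSpace ℝ E]
    {F : ℝ × ℝ × ℝ → E} (hF : SmoothPeriodic F) {ρ : ℝ}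
    (hρ : ρ ∈ Ioo (0 : ℝ) 2) :
    slice F ρ = ∫ t in Ioc 0 (2 * Real.pi), ∫ θ in Ioc 0 (2 * Real.pi), F (ρ, t, θ) := by
  unfold slice torusBox
  rw [Measure.volume_eq_prod, setIntegral_prod _ (hF.integrableOn_slice hρ)]

theorem SmoothPeriodic.norm_sq (hu : SmoothPeriodic u) : SmoothPeriodic (fun p => ‖u p‖ ^ 2) := by
  simpa only [real_inner_self_eq_norm_sq] using hu.inner hu

theorem SmoothPeriodic.integrableOn_iterated {F : ℝ × ℝ × ℝ → ℝ} (hF : SmoothPeriodic F) {ρ : ℝ}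
    (hρ : ρ ∈ Ioo (0 : ℝ) 2) :
    IntegrableOn (fun t => ∫ θ in Ioc 0 (2 * Real.pi), F (ρ, t, θ)) (Ioc 0 (2 * Real.pi)) := by
  have h1 := hF.integrableOn_slice hρ
  rw [torusBox, IntegrableOn, Measure.volume_eq_prod, ← Measure.prod_restrict] at h1
  exact h1.integral_prod_left

/-- If `μ` is not an eigenvalue `r/2 - k/V` of `r/2 + (i/V) ∂_θ`, then `r/2 + (i/V) ∂_θ - μ` is
bounded below. -/
theorem exists_slice_norm_sq_le (hV : 0 < V) (hμ : ∀ k : ℤ, μ ≠ r / 2 - k / V) :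
    ∃ K : ℝ, 0 ≤ K ∧ ∀ α : ℝ × ℝ × ℝ → ℂ, SmoothPeriodic α → ∀ ρ ∈ Ioo (0 : ℝ) 2,
      slice (fun p => ‖α p‖ ^ 2) ρ ≤ K * slice (fun p => ‖opT V (r - 2 * μ) α p‖ ^ 2) ρ := by
  set s : ℝ := V * (r / 2 - μ) with hs
  set d : ℝ := ‖Complex.exp (-(2 * Real.pi * s * Complex.I)) - 1‖ with hd
  -- The factor d vanishes only if s = V(r/2 − μ) is an integer k, that is, if μ = r/2 − k/V.
  have hd0 : 0 < d := by
    refine norm_pos_iff.2 (sub_ne_zero.2 fun he => ?_)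
    obtain ⟨n, hn⟩ := Complex.exp_eq_one_iff.1 he
    have h1 : (s : ℂ) = ((-n : ℤ) : ℂ) := by
      have h2 : (2 * Real.pi * Complex.I : ℂ) ≠ 0 := Complex.two_pi_I_ne_zero
      apply mul_left_cancel₀ h2
      push_cast
      linear_combination -hn
    have h2 : s = ((-n : ℤ) : ℝ) := by exact_mod_cast h1
    refine hμ (-n) ?_
    rw [← h2, hs]
    field_simp
    ring
  have hVC : (V : ℂ) ≠ 0 := by exact_mod_cast hV.ne'
  have h2π := Real.two_pi_pos
  refine ⟨(2 * Real.pi) ^ 2 * V ^ 2 / d ^ 2, by positivity, fun α hα ρ hρ => ?_⟩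
  have hγ := hα.opT (V := V) (r := r - 2 * μ)
  -- The equation (T − μ)α = γ solved for ∂_θα: it reads ∂_θα = isα − iVγ.
  have hode (t θ : ℝ) : HasDerivAt (fun x => α (ρ, t, x))
      (Complex.I * s * α (ρ, t, θ) + -(Complex.I * V) * opT V (r - 2 * μ) α (ρ, t, θ)) θ := by
    refine (hα.hasDerivAt_theta hρ t θ).congr_deriv ?_
    simp only [opT, hs]
    push_cast
    field_simp
    linear_combination (2 * dTheta α (ρ, t, θ)) * Complex.I_sq
  have hcont (t : ℝ) : Continuous fun θ => opT V (r - 2 * μ) α (ρ, t, θ) :=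
    (hγ.continuous_slice hρ).comp (Continuous.prodMk_right t)
  have hpt (t θ : ℝ) := norm_sq_le_of_periodic (u := fun x => α (ρ, t, x))
    (hode t) ((hcont t).const_mul _) (hα.per_theta ρ t) (fun x => by simp only [hγ.per_theta]) θ
  have hw (t θ : ℝ) : ‖-(Complex.I * V) * opT V (r - 2 * μ) α (ρ, t, θ)‖ ^ 2
      = V ^ 2 * ‖opT V (r - 2 * μ) α (ρ, t, θ)‖ ^ 2 := by
    rw [norm_mul, norm_neg, norm_mul, Complex.norm_I, one_mul, Complex.norm_real, mul_pow,
      Real.norm_eq_abs, sq_abs]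
  simp only [hw, integral_const_mul] at hpt
  have hθ (t : ℝ) : ∫ θ in Ioc 0 (2 * Real.pi), ‖α (ρ, t, θ)‖ ^ 2 ≤
      (2 * Real.pi) ^ 2 * V ^ 2 / d ^ 2 *
        ∫ θ in Ioc 0 (2 * Real.pi), ‖opT V (r - 2 * μ) α (ρ, t, θ)‖ ^ 2 := by
    set W := ∫ θ in Ioc 0 (2 * Real.pi), ‖opT V (r - 2 * μ) α (ρ, t, θ)‖ ^ 2 with hW
    have hc : Continuous fun θ => ‖α (ρ, t, θ)‖ ^ 2 :=
      (((hα.continuous_slice hρ).comp (Continuous.prodMk_right t)).norm.pow 2)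
    have h1 : ∫ θ in Ioc 0 (2 * Real.pi), ‖α (ρ, t, θ)‖ ^ 2 ≤
        ∫ θ in Ioc 0 (2 * Real.pi), 2 * Real.pi * V ^ 2 * W / d ^ 2 := by
      refine integral_mono (hc.integrableOn_Icc.mono_set Ioc_subset_Icc_self)
        (integrableOn_const measure_Ioc_lt_top.ne) fun θ => ?_
      simp only
      rw [le_div_iff₀ (by positivity)]
      linarith [hpt t θ]
    refine h1.trans (le_of_eq ?_)
    simp [h2π.le]
    ring
  rw [slice_eq_iterated hα.norm_sq hρ, slice_eq_iterated hγ.norm_sq hρ, ← integral_const_mul]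
  exact integral_mono (hα.norm_sq.integrableOn_iterated hρ)
    ((hγ.norm_sq.integrableOn_iterated hρ).const_mul _) hθ

theorem slice_nonneg {F : ℝ × ℝ × ℝ → ℝ} (hF : ∀ p, 0 ≤ F p) (ρ : ℝ) : 0 ≤ slice F ρ :=
  integral_nonneg fun _ => hF _

theorem bochner_slice_split (hg : ContDiff ℝ ∞ g) (hh : ContDiff ℝ ∞ h)
    (hpos : ∀ ρ ∈ Ioo (0 : ℝ) 2, 0 < deriv h ρ) (hα : SmoothPeriodic α) (hβ : SmoothPeriodic β)
    (hr : 0 < r) (hμ : μ ^ 2 ≤ r / 3) {ρ : ℝ} (hρ : ρ ∈ Ioo (0 : ℝ) 2)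
    (hk : r / 12 ≤ r / 2 - μ ^ 2 + μ * (deriv g ρ / deriv h ρ) / 2
      - deriv (deriv (deriv h)) ρ / deriv h ρ / 2) :
    deriv h ρ * (slice (fun p => ‖opBadj V r g h β p‖ ^ 2) ρ / 4
        + r / 24 * slice (fun p => ‖β p‖ ^ 2) ρ)
      ≤ slice (dRho (fluxDensity V r g h μ α β)) ρ
        + deriv h ρ * (slice (fun p => ‖resFst V r g h μ α β p‖ ^ 2) ρ
          + 3 * slice (fun p => ‖resSnd V r g h μ α β p‖ ^ 2) ρ) := by
  have i1 := (hβ.opBadj (V := V) (r := r) hg hh hpos).norm_sq.integrableOn_slice hρ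
  have i2 := hβ.norm_sq.integrableOn_slice hρ
  have i3 := (hα.resFst (V := V) (r := r) (μ := μ) hg hh hpos hβ).norm_sq.integrableOn_slice hρ
  have i4 := (hα.resSnd (V := V) (r := r) (μ := μ) hg hh hpos hβ).norm_sq.integrableOn_slice hρ
  have := bochner_slice (V := V) hg hh hpos hα hβ hr hμ hρ hk
  have e : slice (fun p => ‖opBadj V r g h β p‖ ^ 2 / 4 + r / 24 * ‖β p‖ ^ 2
        - ‖resFst V r g h μ α β p‖ ^ 2 - 3 * ‖resSnd V r g h μ α β p‖ ^ 2) ρ =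
      slice (fun p => ‖opBadj V r g h β p‖ ^ 2) ρ / 4 + r / 24 * slice (fun p => ‖β p‖ ^ 2) ρ
        - slice (fun p => ‖resFst V r g h μ α β p‖ ^ 2) ρ
        - 3 * slice (fun p => ‖resSnd V r g h μ α β p‖ ^ 2) ρ := by
    have j1 : IntegrableOn (fun q => ‖opBadj V r g h β (ρ, q)‖ ^ 2 / 4
        + r / 24 * ‖β (ρ, q)‖ ^ 2) torusBox := (i1.div_const 4).add (i2.const_mul _)
    have j2 : IntegrableOn (fun q => ‖opBadj V r g h β (ρ, q)‖ ^ 2 / 4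
        + r / 24 * ‖β (ρ, q)‖ ^ 2 - ‖resFst V r g h μ α β (ρ, q)‖ ^ 2) torusBox := j1.sub i3
    unfold slice
    rw [integral_sub j2 (i4.const_mul 3), integral_sub j1 i3,
      integral_add (i1.div_const 4) (i2.const_mul _), integral_const_mul, integral_const_mul,
      integral_div]
  rw [e] at this
  linarith

/-- The resolvent estimate on the tori of constant `ρ`. -/
theorem exists_slice_resolvent_le (hV : 0 < V) (hμ' : ∀ k : ℤ, μ ≠ r / 2 - k / V)
    (hg : ContDiff ℝ ∞ g) (hh : ContDiff ℝ ∞ h)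
    (hpos : ∀ ρ ∈ Ioo (0 : ℝ) 2, 0 < deriv h ρ)
    (hr : 0 < r) (hμ : μ ^ 2 ≤ r / 3)
    (hk : ∀ ρ ∈ Ioo (0 : ℝ) 2, r / 12 ≤ r / 2 - μ ^ 2 + μ * (deriv g ρ / deriv h ρ) / 2
      - deriv (deriv (deriv h)) ρ / deriv h ρ / 2) :
    ∃ C₁ C₂ : ℝ, 0 < C₂ ∧ ∀ α β : ℝ × ℝ × ℝ → ℂ, SmoothPeriodic α → SmoothPeriodic β →
      ∀ ρ ∈ Ioo (0 : ℝ) 2,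
      deriv h ρ * (slice (fun p => ‖α p‖ ^ 2) ρ + slice (fun p => ‖β p‖ ^ 2) ρ) ≤
        C₁ * slice (dRho (fluxDensity V r g h μ α β)) ρ
          + C₂ * (deriv h ρ * (slice (fun p => ‖resFst V r g h μ α β p‖ ^ 2) ρ
            + slice (fun p => ‖resSnd V r g h μ α β p‖ ^ 2) ρ)) := by
  obtain ⟨K, hK, hKle⟩ := exists_slice_norm_sq_le hV hμ'
  -- With X, E, Y, A, B the squared torus norms of χ, η, B*β, α, β, and M the right side of the
  -- Bochner inequality, one has fY ≤ 4M, fB ≤ (24/r)M and A ≤ 2K(X + Y). The sum is at most 2KfX +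
  -- (8K + 24/r)M, and the second constant dominates the coefficients of both fX and fE.
  refine ⟨8 * K + 24 / r, 2 * K + 3 * (8 * K + 24 / r), by positivity,
    fun α β hα hβ ρ hρ => ?_⟩
  have hb := bochner_slice_split (V := V) hg hh hpos hα hβ hr hμ hρ (hk ρ hρ)
  have hf := hpos ρ hρ
  have i1 := (hβ.opBadj (V := V) (r := r) hg hh hpos).norm_sq.integrableOn_slice hρ
  have i3 := (hα.resFst (V := V) (r := r) (μ := μ) hg hh hpos hβ).norm_sq.integrableOn_slice hρ
  have i5 := (hα.opT (V := V) (r := r - 2 * μ)).norm_sq.integrableOn_slice hρ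
  have hγ : slice (fun p => ‖opT V (r - 2 * μ) α p‖ ^ 2) ρ ≤
      2 * slice (fun p => ‖resFst V r g h μ α β p‖ ^ 2) ρ
        + 2 * slice (fun p => ‖opBadj V r g h β p‖ ^ 2) ρ := by
    unfold slice
    rw [← integral_const_mul, ← integral_const_mul,
      ← integral_add (i3.const_mul 2) (i1.const_mul 2)]
    refine integral_mono i5 ((i3.const_mul 2).add (i1.const_mul 2)) fun q => ?_
    have h1 : opT V (r - 2 * μ) α (ρ, q) =
        resFst V r g h μ α β (ρ, q) - opBadj V r g h β (ρ, q) := by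
      simp [resFst]
    have h2 := norm_sub_le (resFst V r g h μ α β (ρ, q)) (opBadj V r g h β (ρ, q))
    simp only [h1]
    nlinarith [norm_nonneg (resFst V r g h μ α β (ρ, q) - opBadj V r g h β (ρ, q)),
      sq_nonneg (‖resFst V r g h μ α β (ρ, q)‖ - ‖opBadj V r g h β (ρ, q)‖)]
  have hA := hKle α hα ρ hρ
  have hX : 0 ≤ slice (fun p => ‖resFst V r g h μ α β p‖ ^ 2) ρ :=
    slice_nonneg (fun p => sq_nonneg _) ρ
  have hE : 0 ≤ slice (fun p => ‖resSnd V r g h μ α β p‖ ^ 2) ρ :=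
    slice_nonneg (fun p => sq_nonneg _) ρ
  have hY : 0 ≤ slice (fun p => ‖opBadj V r g h β p‖ ^ 2) ρ :=
    slice_nonneg (fun p => sq_nonneg _) ρ
  have hB : 0 ≤ slice (fun p => ‖β p‖ ^ 2) ρ := slice_nonneg (fun p => sq_nonneg _) ρ
  generalize slice (fun p => ‖resFst V r g h μ α β p‖ ^ 2) ρ = X at *
  generalize slice (fun p => ‖resSnd V r g h μ α β p‖ ^ 2) ρ = E at *
  generalize slice (fun p => ‖opBadj V r g h β p‖ ^ 2) ρ = Y at *
  generalize slice (fun p => ‖β p‖ ^ 2) ρ = B at *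
  generalize slice (fun p => ‖α p‖ ^ 2) ρ = A at *
  generalize slice (fun p => ‖opT V (r - 2 * μ) α p‖ ^ 2) ρ = G at *
  generalize slice (dRho (fluxDensity V r g h μ α β)) ρ = Φ at *
  generalize deriv h ρ = f at *
  have hA' : A ≤ K * (2 * X + 2 * Y) := hA.trans (mul_le_mul_of_nonneg_left hγ hK)
  set M := Φ + f * (X + 3 * E) with hM
  have hYM : f * Y ≤ 4 * M := by
    have : 0 ≤ f * (r / 24 * B) := by positivity
    nlinarith
  have hBM : f * B ≤ 24 / r * M := by
    have h1 : 0 ≤ f * Y := by positivity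
    have h2 : r / 24 * (f * B) ≤ M := by nlinarith
    have h3 := mul_le_mul_of_nonneg_left h2 (show 0 ≤ 24 / r by positivity)
    calc f * B = 24 / r * (r / 24 * (f * B)) := by field_simp
      _ ≤ _ := h3
  calc f * (A + B) ≤ f * (K * (2 * X + 2 * Y)) + f * B := by
        rw [mul_add]
        exact add_le_add_left (mul_le_mul_of_nonneg_left hA' hf.le) _
    _ = 2 * K * (f * X) + 2 * K * (f * Y) + f * B := by ring
    _ ≤ 2 * K * (f * X) + 2 * K * (4 * M) + 24 / r * M := by gcongr
    _ = (8 * K + 24 / r) * Φ + (2 * K + (8 * K + 24 / r)) * (f * X)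
          + 3 * (8 * K + 24 / r) * (f * E) := by rw [hM]; ring
    _ ≤ (8 * K + 24 / r) * Φ + (2 * K + 3 * (8 * K + 24 / r)) * (f * X)
          + (2 * K + 3 * (8 * K + 24 / r)) * (f * E) := by
        have : 0 ≤ 8 * K + 24 / r := by positivity
        gcongr <;> linarith
    _ = _ := by ring

end

/-! ## Behaviour at the poles -/

/-- `e^{imt} u` extends smoothly across the pole `c + κ ρ = 0`. -/
def ExtendsAt (c κ : ℝ) (m : ℤ) (u : ℝ × ℝ × ℝ → ℂ) : Prop :=
  ∃ F : ℂ × ℝ → ℂ, ContDiffOn ℝ ∞ F (Metric.ball 0 2 ×ˢ univ) ∧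
    ∀ ρ ∈ Ioo (0 : ℝ) 2, ∀ t θ : ℝ,
      F (((c + κ * ρ : ℝ) : ℂ) * expI 1 t, θ) = expI m t * u (ρ, t, θ)

theorem hasDerivAt_expI (m : ℤ) (t : ℝ) : HasDerivAt (expI m) (Complex.I * m * expI m t) t := by
  unfold expI
  have h1 : HasDerivAt (fun t : ℝ => (m : ℂ) * (t : ℂ) * Complex.I) (m * Complex.I) t := by
    simpa using (((hasDerivAt_id t).ofReal_comp).const_mul (m : ℂ)).mul_const Complex.I
  refine h1.cexp.congr_deriv ?_
  ring

theorem expI_add_two_pi (m : ℤ) (t : ℝ) : expI m (t + 2 * Real.pi) = expI m t := by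
  unfold expI
  refine Complex.exp_eq_exp_iff_exists_int.2 ⟨m, ?_⟩
  push_cast
  ring

theorem expI_ne_zero (m : ℤ) (t : ℝ) : expI m t ≠ 0 := Complex.exp_ne_zero _

theorem expI_add (m n : ℤ) (t : ℝ) : expI (m + n) t = expI m t * expI n t := by
  unfold expI
  rw [← Complex.exp_add]
  push_cast
  ring_nf

section

variable {c κ : ℝ} {m : ℤ} {u : ℝ × ℝ × ℝ → ℂ}

theorem norm_pole_coord (hκ : ∀ ρ ∈ Ioo (0 : ℝ) 2, c + κ * ρ ∈ Ioo (0 : ℝ) 2) {ρ : ℝ}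
    (hρ : ρ ∈ Ioo (0 : ℝ) 2) (t : ℝ) : ‖((c + κ * ρ : ℝ) : ℂ) * expI 1 t‖ = c + κ * ρ := by
  rw [norm_mul, norm_expI, mul_one, Complex.norm_real, Real.norm_eq_abs, abs_of_pos (hκ ρ hρ).1]

theorem ExtendsAt.smoothPeriodic (hκ : ∀ ρ ∈ Ioo (0 : ℝ) 2, c + κ * ρ ∈ Ioo (0 : ℝ) 2)
    (hu : ExtendsAt c κ m u) (h0 : ∀ p : ℝ × ℝ × ℝ, p.1 ∉ Ioo (0 : ℝ) 2 → u p = 0)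
    (hθ : ∀ ρ t θ : ℝ, u (ρ, t, θ + 2 * Real.pi) = u (ρ, t, θ)) : SmoothPeriodic u := by
  obtain ⟨F, hF, hFu⟩ := hu
  have hex (ρ : ℝ) (hρ : ρ ∈ Ioo (0 : ℝ) 2) (t θ : ℝ) :
      u (ρ, t, θ) = expI (-m) t * F (((c + κ * ρ : ℝ) : ℂ) * expI 1 t, θ) := by
    rw [hFu ρ hρ, ← mul_assoc, mul_comm (expI (-m) t), expI_mul_neg, one_mul]
  refine ⟨?_, fun ρ t θ => ?_, hθ⟩
  · have hof : ContDiff ℝ ∞ (fun t : ℝ => (t : ℂ)) := Complex.ofRealCLM.contDiff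
    have hexp := contDiff_expI 1
    have hmap : ContDiff ℝ ∞ (fun q : ℝ × ℝ × ℝ =>
        ((((c + κ * q.1 : ℝ) : ℂ) * expI 1 q.2.1, q.2.2) : ℂ × ℝ)) :=
      ContDiff.prodMk (ContDiff.mul (hof.comp (by fun_prop))
        (hexp.comp (contDiff_fst.comp contDiff_snd))) (contDiff_snd.comp contDiff_snd)
    have hmaps : MapsTo (fun q : ℝ × ℝ × ℝ =>
        ((((c + κ * q.1 : ℝ) : ℂ) * expI 1 q.2.1, q.2.2) : ℂ × ℝ)) polarDomain
        (Metric.ball 0 2 ×ˢ univ) := fun q hq => by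
      refine ⟨?_, trivial⟩
      have hq' := mem_polarDomain.1 hq
      rw [mem_ball_zero_iff, norm_pole_coord hκ hq']
      exact (hκ _ hq').2
    have h1 : ContDiffOn ℝ ∞ (fun q : ℝ × ℝ × ℝ => expI (-m) q.2.1 *
        F (((c + κ * q.1 : ℝ) : ℂ) * expI 1 q.2.1, q.2.2)) polarDomain :=
      (((contDiff_expI (-m)).comp (contDiff_fst.comp contDiff_snd)).contDiffOn).mul
        (hF.comp hmap.contDiffOn hmaps)
    exact h1.congr fun q hq => hex q.1 (mem_polarDomain.1 hq) q.2.1 q.2.2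
  · by_cases hρ : ρ ∈ Ioo (0 : ℝ) 2
    · rw [hex ρ hρ, hex ρ hρ, expI_add_two_pi, expI_add_two_pi]
    · rw [h0 _ hρ, h0 _ hρ]

/-- Bounds for the derivatives of a function which extends smoothly across a pole. -/
theorem ExtendsAt.bounds (hκ : ∀ ρ ∈ Ioo (0 : ℝ) 2, c + κ * ρ ∈ Ioo (0 : ℝ) 2) (hκ1 : |κ| = 1)
    (hu : ExtendsAt c κ m u) (hs : SmoothPeriodic u) :
    ∃ C : ℝ, 0 ≤ C ∧ ∀ ρ ∈ Ioo (0 : ℝ) 2, c + κ * ρ ≤ 1 → ∀ q ∈ torusBox,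
      ‖u (ρ, q)‖ ≤ C ∧ ‖dRho u (ρ, q)‖ ≤ C ∧ ‖dTheta u (ρ, q)‖ ≤ C ∧
        ‖dT u (ρ, q) + Complex.I * m * u (ρ, q)‖ ≤ C * (c + κ * ρ) := by
  obtain ⟨F, hF, hFu⟩ := hu
  have hopen : IsOpen (Metric.ball (0 : ℂ) 2 ×ˢ (univ : Set ℝ)) :=
    Metric.isOpen_ball.prod isOpen_univ
  have hK : IsCompact (Metric.closedBall (0 : ℂ) 1 ×ˢ Icc (0 : ℝ) (2 * Real.pi)) :=
    (isCompact_closedBall _ _).prod isCompact_Icc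
  have hsub : Metric.closedBall (0 : ℂ) 1 ×ˢ Icc (0 : ℝ) (2 * Real.pi) ⊆
      Metric.ball (0 : ℂ) 2 ×ˢ (univ : Set ℝ) :=
    prod_mono (Metric.closedBall_subset_ball (by norm_num)) (subset_univ _)
  obtain ⟨C₁, hC₁⟩ := hK.exists_bound_of_continuousOn (hF.continuousOn.mono hsub)
  obtain ⟨C₂, hC₂⟩ := hK.exists_bound_of_continuousOn
    ((hF.continuousOn_fderiv_of_isOpen hopen (by simp)).mono hsub)
  refine ⟨max 0 (max C₁ C₂), le_max_left _ _, ?_⟩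
  rintro ρ hρ hle ⟨t, θ⟩ hq
  set C := max 0 (max C₁ C₂)
  have hz : ((((c + κ * ρ : ℝ) : ℂ) * expI 1 t, θ) : ℂ × ℝ) ∈
      Metric.closedBall (0 : ℂ) 1 ×ˢ Icc (0 : ℝ) (2 * Real.pi) := by
    refine ⟨?_, Ioc_subset_Icc_self hq.2⟩
    rw [mem_closedBall_zero_iff, norm_pole_coord hκ hρ]
    exact hle
  have b1 : ‖F (((c + κ * ρ : ℝ) : ℂ) * expI 1 t, θ)‖ ≤ C :=
    (hC₁ _ hz).trans ((le_max_left _ _).trans (le_max_right _ _))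
  have b2 : ‖fderiv ℝ F (((c + κ * ρ : ℝ) : ℂ) * expI 1 t, θ)‖ ≤ C :=
    (hC₂ _ hz).trans ((le_max_right _ _).trans (le_max_right _ _))
  have hFd : HasFDerivAt F (fderiv ℝ F (((c + κ * ρ : ℝ) : ℂ) * expI 1 t, θ))
      (((c + κ * ρ : ℝ) : ℂ) * expI 1 t, θ) :=
    ((hF.contDiffAt (hopen.mem_nhds (hsub hz))).differentiableAt (by simp)).hasFDerivAt
  generalize hL : fderiv ℝ F (((c + κ * ρ : ℝ) : ℂ) * expI 1 t, θ) = L at hFd b2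
  have hex (x : ℝ) (hx : x ∈ Ioo (0 : ℝ) 2) (t θ : ℝ) :
      u (x, t, θ) = expI (-m) t * F (((c + κ * x : ℝ) : ℂ) * expI 1 t, θ) := by
    rw [hFu x hx, ← mul_assoc, mul_comm (expI (-m) t), expI_mul_neg, one_mul]
  have hC : 0 ≤ C := le_max_left _ _
  refine ⟨?_, ?_, ?_, ?_⟩
  · rw [hex ρ hρ, norm_mul, norm_expI, one_mul]
    exact b1
  · have h1 : HasDerivAt (fun x : ℝ => ((((c + κ * x : ℝ) : ℂ) * expI 1 t, θ) : ℂ × ℝ))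
        ((κ : ℂ) * expI 1 t, 0) ρ := by
      have h2 : HasDerivAt (fun x : ℝ => c + κ * x) κ ρ := by
        simpa using ((hasDerivAt_id ρ).const_mul κ).const_add c
      exact (h2.ofReal_comp.mul_const _).prodMk (hasDerivAt_const _ _)
    have h3 := (hFd.comp_hasDerivAt ρ h1).const_mul (expI (-m) t)
    have h4 : HasDerivAt (fun x => u (x, t, θ)) _ ρ := h3.congr_of_eventuallyEq (by
      filter_upwards [isOpen_Ioo.mem_nhds hρ] with x hx
      exact hex x hx t θ)
    rw [(hs.hasDerivAt_rho hρ (t, θ)).unique h4, norm_mul, norm_expI, one_mul]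
    refine (L.le_opNorm _).trans ?_
    have : ‖(((κ : ℂ) * expI 1 t, 0) : ℂ × ℝ)‖ = 1 := by
      simp [Prod.norm_def, norm_expI, hκ1]
    rw [this, mul_one]
    exact b2
  · have h1 : HasDerivAt (fun x : ℝ => ((((c + κ * ρ : ℝ) : ℂ) * expI 1 t, x) : ℂ × ℝ))
        (0, 1) θ := (hasDerivAt_const _ _).prodMk (hasDerivAt_id _)
    have h3 := (hFd.comp_hasDerivAt θ h1).const_mul (expI (-m) t)
    have h4 : HasDerivAt (fun x => u (ρ, t, x)) _ θ := h3.congr_of_eventuallyEq (by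
      filter_upwards with x
      exact hex ρ hρ t x)
    rw [(hs.hasDerivAt_theta hρ t θ).unique h4, norm_mul, norm_expI, one_mul]
    refine (L.le_opNorm _).trans ?_
    have : ‖((0, 1) : ℂ × ℝ)‖ = 1 := by simp [Prod.norm_def]
    rw [this, mul_one]
    exact b2
  · have h1 : HasDerivAt (fun x : ℝ => ((((c + κ * ρ : ℝ) : ℂ) * expI 1 x, θ) : ℂ × ℝ))
        (((c + κ * ρ : ℝ) : ℂ) * (Complex.I * (1 : ℤ) * expI 1 t), 0) t :=
      ((hasDerivAt_expI 1 t).const_mul _).prodMk (hasDerivAt_const _ _)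
    have h3 := (hasDerivAt_expI (-m) t).mul (hFd.comp_hasDerivAt t h1)
    have h4 : HasDerivAt (fun x => u (ρ, x, θ)) _ t := h3.congr_of_eventuallyEq (by
      filter_upwards with x
      exact hex ρ hρ x θ)
    rw [(hs.hasDerivAt_t hρ t θ).unique h4, hex ρ hρ]
    simp only [Function.comp_apply]
    -- The term imu removes the derivative of the twist e^{−imt}. What remains is the derivative of
    -- F along the angular direction, a vector of length c + κρ.
    have e : Complex.I * ((-m : ℤ) : ℂ) * expI (-m) t * F (((c + κ * ρ : ℝ) : ℂ) * expI 1 t, θ)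
        + expI (-m) t * L (((c + κ * ρ : ℝ) : ℂ) * (Complex.I * (1 : ℤ) * expI 1 t), 0)
        + Complex.I * m * (expI (-m) t * F (((c + κ * ρ : ℝ) : ℂ) * expI 1 t, θ))
        = expI (-m) t * L (((c + κ * ρ : ℝ) : ℂ) * (Complex.I * (1 : ℤ) * expI 1 t), 0) := by
      push_cast
      ring
    rw [e, norm_mul, norm_expI, one_mul]
    refine (L.le_opNorm _).trans ?_
    have : ‖((((c + κ * ρ : ℝ) : ℂ) * (Complex.I * (1 : ℤ) * expI 1 t), 0) : ℂ × ℝ)‖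
        = c + κ * ρ := by
      have h5 := (hκ ρ hρ).1
      rw [Prod.norm_def]
      simp only [norm_mul, norm_expI, Complex.norm_I, Complex.norm_real, Real.norm_eq_abs,
        abs_of_pos h5, norm_zero]
      simp [h5.le]
    rw [this]
    exact mul_le_mul_of_nonneg_right b2 (hκ ρ hρ).1.le

end

/-- The shape of the profile functions near the pole `c + κ ρ = 0`. -/
structure IsPole (r : ℝ) (g h : ℝ → ℝ) (c κ a : ℝ) (m : ℤ) : Prop where
  coord : ∀ ρ ∈ Ioo (0 : ℝ) 2, c + κ * ρ ∈ Ioo (0 : ℝ) 2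
  abs_eq_one : |κ| = 1
  lt_one : a < 1
  g_zero : ∀ ρ ∈ Ioo (0 : ℝ) 2, c + κ * ρ < a → g ρ = 0
  deriv_g : ∀ ρ ∈ Ioo (0 : ℝ) 2, c + κ * ρ < a → deriv g ρ = 0
  deriv_h : ∀ ρ ∈ Ioo (0 : ℝ) 2, c + κ * ρ < a → deriv h ρ = c + κ * ρ
  deriv_deriv_h : ∀ ρ ∈ Ioo (0 : ℝ) 2, c + κ * ρ < a → deriv (deriv h) ρ = κ
  h_eq : ∀ ρ ∈ Ioo (0 : ℝ) 2, c + κ * ρ < a → r * h ρ = m + κ * (r * (c + κ * ρ) ^ 2 / 2)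

section

variable {V r μ c κ a : ℝ} {g h : ℝ → ℝ} {m n : ℤ} {u α β : ℝ × ℝ × ℝ → ℂ}

theorem norm_real_mul_le {C : ℝ} {z : ℂ} (hz : ‖z‖ ≤ C) (x : ℝ) : ‖(x : ℂ) * z‖ ≤ |x| * C := by
  rw [norm_mul, Complex.norm_real, Real.norm_eq_abs]
  exact mul_le_mul_of_nonneg_left hz (abs_nonneg x)

theorem norm_opT_le {C : ℝ} {p : ℝ × ℝ × ℝ} (h1 : ‖u p‖ ≤ C) (h2 : ‖dTheta u p‖ ≤ C) :
    ‖opT V r u p‖ ≤ (|r / 2| + |1 / V|) * C := by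
  rw [add_mul]
  refine (norm_add_le _ _).trans (add_le_add (norm_real_mul_le h1 _) (norm_real_mul_le ?_ _))
  rw [norm_mul, Complex.norm_I, one_mul]
  exact h2

/-- If e^{int}u is smooth at the pole then i∂_t u is n u up to O(s), where s = c + κρ, while rĥ is m
up to O(s²). For first components n = m, so S u = O(s). For second components n − m = −κ, so S u +
ĥ''u = O(s). This removes the singularity of 1/ĥ' = 1/s. -/
theorem IsPole.norm_opS_sub_le (hP : IsPole r g h c κ a m) {C : ℝ} {p : ℝ × ℝ × ℝ}
    (hρ : p.1 ∈ Ioo (0 : ℝ) 2) (hlt : c + κ * p.1 < a) (h1 : ‖u p‖ ≤ C)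
    (h2 : ‖dT u p + Complex.I * n * u p‖ ≤ C * (c + κ * p.1)) :
    ‖opS V r g h u p - ((n - m : ℤ) : ℂ) * u p‖ ≤ (1 + |r|) * C * (c + κ * p.1) := by
  have hs := hP.coord p.1 hρ
  have hC : 0 ≤ C := (norm_nonneg _).trans h1
  have e : opS V r g h u p - ((n - m : ℤ) : ℂ) * u p =
      Complex.I * (dT u p + Complex.I * n * u p)
        - ((κ * (r * (c + κ * p.1) ^ 2 / 2) : ℝ) : ℂ) * u p := by
    rw [opS, hP.g_zero _ hρ hlt, hP.h_eq _ hρ hlt]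
    push_cast
    linear_combination (-(n : ℂ) * u p) * Complex.I_sq
  rw [e]
  refine (norm_sub_le _ _).trans ?_
  rw [norm_mul, Complex.norm_I, one_mul]
  have h3 := norm_real_mul_le h1 (κ * (r * (c + κ * p.1) ^ 2 / 2))
  have h4 : |κ * (r * (c + κ * p.1) ^ 2 / 2)| ≤ |r| * (c + κ * p.1) := by
    rw [abs_mul, hP.abs_eq_one, one_mul, abs_div, abs_mul, abs_of_nonneg (sq_nonneg (c + κ * p.1)),
      abs_two, mul_div_assoc]
    exact mul_le_mul_of_nonneg_left (by nlinarith [hs.1, hs.2]) (abs_nonneg r)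
  nlinarith [mul_le_mul_of_nonneg_right h4 hC]

/-- S/ĥ' and ĥ''/ĥ' are each of size 1/s on β, and their singular parts cancel because n − m = −κ.
-/
theorem IsPole.exists_norm_resFst_le (hP : IsPole r g h c κ a m) (hα : ExtendsAt c κ m α)
    (hβ : ExtendsAt c κ n β) (hn : (n : ℝ) = m - κ) (hα' : SmoothPeriodic α)
    (hβ' : SmoothPeriodic β) :
    ∃ C : ℝ, ∀ ρ ∈ Ioo (0 : ℝ) 2, c + κ * ρ < a → ∀ q ∈ torusBox,
      ‖resFst V r g h μ α β (ρ, q)‖ ≤ C := by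
  obtain ⟨A, hA, hAb⟩ := hα.bounds hP.coord hP.abs_eq_one hα'
  obtain ⟨B, hB, hBb⟩ := hβ.bounds hP.coord hP.abs_eq_one hβ'
  refine ⟨(|(r - 2 * μ) / 2| + |1 / V|) * A + (B + (1 + |r|) * B), fun ρ hρ hlt q hq => ?_⟩
  obtain ⟨a1, -, a3, -⟩ := hAb ρ hρ (hlt.le.trans hP.lt_one.le) q hq
  obtain ⟨b1, b2, -, b4⟩ := hBb ρ hρ (hlt.le.trans hP.lt_one.le) q hq
  have hs := (hP.coord ρ hρ).1
  have hS := hP.norm_opS_sub_le (V := V) (p := (ρ, q)) hρ hlt b1 b4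
  have hnm : ((n - m : ℤ) : ℂ) = -(κ : ℂ) := by
    have : ((n - m : ℤ) : ℝ) = -κ := by push_cast; rw [hn]; ring
    exact_mod_cast congrArg (fun x : ℝ => (x : ℂ)) this
  rw [hnm] at hS
  have e : opBadj V r g h β (ρ, q) = -dRho β (ρ, q) -
      ((1 / (c + κ * ρ) : ℝ) : ℂ) * (opS V r g h β (ρ, q) - -(κ : ℂ) * β (ρ, q)) := by
    simp only [opBadj]
    rw [hP.deriv_h ρ hρ hlt, hP.deriv_deriv_h ρ hρ hlt]
    push_cast
    ring
  rw [resFst, e]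
  refine (norm_add_le _ _).trans (add_le_add (norm_opT_le a1 a3) ((norm_sub_le _ _).trans
    (add_le_add (by rwa [norm_neg]) ((norm_real_mul_le hS _).trans (le_of_eq ?_)))))
  rw [abs_of_pos (by positivity)]
  field_simp

/-- The twist of α agrees with the value m of rĥ at the pole, so Sα/ĥ' stays bounded. -/
theorem IsPole.exists_norm_resSnd_le (hP : IsPole r g h c κ a m) (hα : ExtendsAt c κ m α)
    (hβ : ExtendsAt c κ n β) (hα' : SmoothPeriodic α) (hβ' : SmoothPeriodic β) :
    ∃ C : ℝ, ∀ ρ ∈ Ioo (0 : ℝ) 2, c + κ * ρ < a → ∀ q ∈ torusBox,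
      ‖resSnd V r g h μ α β (ρ, q)‖ ≤ C := by
  obtain ⟨A, hA, hAb⟩ := hα.bounds hP.coord hP.abs_eq_one hα'
  obtain ⟨B, hB, hBb⟩ := hβ.bounds hP.coord hP.abs_eq_one hβ'
  refine ⟨(A + (1 + |r|) * A) + (|r / 2| + |1 / V|) * B + |μ| * B, fun ρ hρ hlt q hq => ?_⟩
  obtain ⟨a1, a2, -, a4⟩ := hAb ρ hρ (hlt.le.trans hP.lt_one.le) q hq
  obtain ⟨b1, -, b3, -⟩ := hBb ρ hρ (hlt.le.trans hP.lt_one.le) q hq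
  have hs := (hP.coord ρ hρ).1
  have hS := hP.norm_opS_sub_le (V := V) (p := (ρ, q)) hρ hlt a1 a4
  rw [sub_self, Int.cast_zero, zero_mul, sub_zero] at hS
  rw [resSnd, hP.deriv_g ρ hρ hlt, opB, hP.deriv_h ρ hρ hlt]
  simp only [zero_div, Complex.ofReal_zero, zero_mul, add_zero]
  refine (norm_sub_le _ _).trans (add_le_add ((norm_sub_le _ _).trans (add_le_add
    ((norm_sub_le _ _).trans (add_le_add a2 ((norm_real_mul_le hS _).trans (le_of_eq ?_))))
    (norm_opT_le b1 b3))) (norm_real_mul_le b1 _))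
  rw [abs_of_pos (by positivity)]
  field_simp

/-- The first term of the flux carries the factor ĥ' = s. The second is O(s) by the cancellation in
Sβ + ĥ''β. Hence no boundary contribution arises at the poles. -/
theorem IsPole.exists_abs_fluxDensity_le (hP : IsPole r g h c κ a m) (hα : ExtendsAt c κ m α)
    (hβ : ExtendsAt c κ n β) (hn : (n : ℝ) = m - κ) (hα' : SmoothPeriodic α)
    (hβ' : SmoothPeriodic β) :
    ∃ C : ℝ, ∀ ρ ∈ Ioo (0 : ℝ) 2, c + κ * ρ < a → ∀ q ∈ torusBox,
      |fluxDensity V r g h μ α β (ρ, q)| ≤ C * (c + κ * ρ) := by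
  obtain ⟨A, hA, hAb⟩ := hα.bounds hP.coord hP.abs_eq_one hα'
  obtain ⟨B, hB, hBb⟩ := hβ.bounds hP.coord hP.abs_eq_one hβ'
  refine ⟨B * ((|(r - 2 * μ) / 2| + |1 / V|) * A) + 1 / 2 * ((1 + |r|) * B * B),
    fun ρ hρ hlt q hq => ?_⟩
  obtain ⟨a1, -, a3, -⟩ := hAb ρ hρ (hlt.le.trans hP.lt_one.le) q hq
  obtain ⟨b1, -, -, b4⟩ := hBb ρ hρ (hlt.le.trans hP.lt_one.le) q hq
  have hs := (hP.coord ρ hρ).1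
  have hS := hP.norm_opS_sub_le (V := V) (p := (ρ, q)) hρ hlt b1 b4
  have hT := norm_opT_le (V := V) (r := r - 2 * μ) a1 a3
  have hnm : ((n - m : ℤ) : ℂ) = -(κ : ℂ) := by
    have : ((n - m : ℤ) : ℝ) = -κ := by push_cast; rw [hn]; ring
    exact_mod_cast congrArg (fun x : ℝ => (x : ℂ)) this
  rw [hnm, neg_mul, sub_neg_eq_add] at hS
  rw [fluxDensity, hP.deriv_h ρ hρ hlt, hP.deriv_deriv_h ρ hρ hlt]
  refine (abs_add_le _ _).trans ?_
  rw [abs_mul, abs_mul, abs_of_pos hs, abs_neg, abs_of_pos (by norm_num : (0 : ℝ) < 1 / 2)]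
  have i1 := (abs_real_inner_le_norm (β (ρ, q)) (opT V (r - 2 * μ) α (ρ, q))).trans
    (mul_le_mul b1 hT (norm_nonneg _) hB)
  have i2 := (abs_real_inner_le_norm (opS V r g h β (ρ, q) + (κ : ℂ) * β (ρ, q)) (β (ρ, q))).trans
    (mul_le_mul hS b1 (norm_nonneg _) (by positivity))
  have i3 := mul_le_mul_of_nonneg_left i1 hs.le
  simp only at i2 i3 ⊢
  linarith

end

/-! ## Integration in `ρ` -/

section

variable {V r μ : ℝ} {g h : ℝ → ℝ} {u v α β : ℝ × ℝ × ℝ → ℂ}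

theorem exists_norm_le_of_poles {a : ℝ} (ha : 0 < a) (hu : SmoothPeriodic u)
    (h0 : ∃ C : ℝ, ∀ ρ ∈ Ioo (0 : ℝ) 2, 0 + 1 * ρ < a → ∀ q ∈ torusBox, ‖u (ρ, q)‖ ≤ C)
    (h1 : ∃ C : ℝ, ∀ ρ ∈ Ioo (0 : ℝ) 2, 2 + -1 * ρ < a → ∀ q ∈ torusBox, ‖u (ρ, q)‖ ≤ C) :
    ∃ C : ℝ, ∀ ρ ∈ Ioo (0 : ℝ) 2, ∀ q ∈ torusBox, ‖u (ρ, q)‖ ≤ C := by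
  obtain ⟨C₀, h0⟩ := h0
  obtain ⟨C₁, h1⟩ := h1
  have hK : IsCompact (Icc a (2 - a) ×ˢ
      (Icc (0 : ℝ) (2 * Real.pi) ×ˢ Icc (0 : ℝ) (2 * Real.pi))) :=
    isCompact_Icc.prod isCompact_closedBox
  have hsub : Icc a (2 - a) ×ˢ (Icc (0 : ℝ) (2 * Real.pi) ×ˢ Icc (0 : ℝ) (2 * Real.pi)) ⊆
      polarDomain := fun p hp => mem_polarDomain.2
    ⟨ha.trans_le hp.1.1, hp.1.2.trans_lt (by linarith)⟩
  obtain ⟨C₂, h2⟩ := hK.exists_bound_of_continuousOn (hu.smooth.continuousOn.mono hsub)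
  refine ⟨max C₀ (max C₁ C₂), fun ρ hρ q hq => ?_⟩
  by_cases k0 : ρ < a
  · exact (h0 ρ hρ (by linarith) q hq).trans (le_max_left _ _)
  by_cases k1 : 2 - ρ < a
  · exact (h1 ρ hρ (by linarith) q hq).trans ((le_max_left _ _).trans (le_max_right _ _))
  · exact (h2 (ρ, q) ⟨⟨by linarith, by linarith⟩, torusBox_subset hq⟩).trans
      ((le_max_right _ _).trans (le_max_right _ _))

/-- Integration over the torus first. -/
theorem integral_polar_eq (hh : ContDiff ℝ ∞ h) (hu : SmoothPeriodic u) (hv : SmoothPeriodic v)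
    (hub : ∃ C : ℝ, ∀ ρ ∈ Ioo (0 : ℝ) 2, ∀ q ∈ torusBox, ‖u (ρ, q)‖ ≤ C)
    (hvb : ∃ C : ℝ, ∀ ρ ∈ Ioo (0 : ℝ) 2, ∀ q ∈ torusBox, ‖v (ρ, q)‖ ≤ C) :
    IntegrableOn (fun ρ => deriv h ρ * (slice (fun p => ‖u p‖ ^ 2) ρ
      + slice (fun p => ‖v p‖ ^ 2) ρ)) (Ioo 0 2) ∧
    ∫ p in Ioo (0 : ℝ) 2 ×ˢ torusBox, (‖u p‖ ^ 2 + ‖v p‖ ^ 2) * (V * deriv h p.1) =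
      V * ∫ ρ in Ioo (0 : ℝ) 2, deriv h ρ * (slice (fun p => ‖u p‖ ^ 2) ρ
        + slice (fun p => ‖v p‖ ^ 2) ρ) := by
  have hint : IntegrableOn (fun p : ℝ × ℝ × ℝ => deriv h p.1 * (‖u p‖ ^ 2 + ‖v p‖ ^ 2))
      (Ioo (0 : ℝ) 2 ×ˢ torusBox) := by
    obtain ⟨A, hA⟩ := hub
    obtain ⟨B, hB⟩ := hvb
    obtain ⟨D, hD⟩ := (isCompact_Icc (a := (0 : ℝ)) (b := 2)).exists_bound_of_continuousOn
      (contDiff_deriv hh).continuous.continuousOn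
    have hms : MeasurableSet (Ioo (0 : ℝ) 2 ×ˢ torusBox) :=
      measurableSet_Ioo.prod measurableSet_torusBox
    have hfin : volume (Ioo (0 : ℝ) 2 ×ˢ torusBox) ≠ ⊤ := by
      rw [Measure.volume_eq_prod, Measure.prod_prod]
      exact ENNReal.mul_ne_top measure_Ioo_lt_top.ne volume_torusBox_lt_top.ne
    have hsub : Ioo (0 : ℝ) 2 ×ˢ torusBox ⊆ polarDomain := prod_mono le_rfl (subset_univ _)
    have hcont : ContinuousOn (fun p : ℝ × ℝ × ℝ => deriv h p.1 * (‖u p‖ ^ 2 + ‖v p‖ ^ 2))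
        (Ioo (0 : ℝ) 2 ×ˢ torusBox) :=
      (((contDiff_deriv hh).continuous.comp continuous_fst).continuousOn).mul
        (((hu.smooth.continuousOn.mono hsub).norm.pow 2).add
          ((hv.smooth.continuousOn.mono hsub).norm.pow 2))
    refine IntegrableOn.of_bound hfin.lt_top (hcont.aestronglyMeasurable hms)
      (D * (A ^ 2 + B ^ 2)) ?_
    filter_upwards [ae_restrict_mem hms] with p hp
    rw [norm_mul]
    have k1 := hA p.1 hp.1 p.2 hp.2
    have k2 := hB p.1 hp.1 p.2 hp.2
    have k3 := hD p.1 (Ioo_subset_Icc_self hp.1)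
    have k4 := (norm_nonneg _).trans k3
    refine mul_le_mul k3 ?_ (norm_nonneg _) k4
    rw [Real.norm_of_nonneg (by positivity)]
    exact add_le_add (pow_le_pow_left₀ (norm_nonneg _) k1 2)
      (pow_le_pow_left₀ (norm_nonneg _) k2 2)
  have hin (ρ : ℝ) (hρ : ρ ∈ Ioo (0 : ℝ) 2) :
      ∫ q in torusBox, deriv h ρ * (‖u (ρ, q)‖ ^ 2 + ‖v (ρ, q)‖ ^ 2) =
      deriv h ρ * (slice (fun p => ‖u p‖ ^ 2) ρ + slice (fun p => ‖v p‖ ^ 2) ρ) := by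
    rw [integral_const_mul]
    exact congrArg _ (SmoothPeriodic.slice_add hu.norm_sq hv.norm_sq hρ)
  constructor
  · have h1 := hint
    rw [IntegrableOn, Measure.volume_eq_prod, ← Measure.prod_restrict] at h1
    refine (IntegrableOn.congr_fun (s := Ioo (0 : ℝ) 2) h1.integral_prod_left ?_ measurableSet_Ioo)
    exact fun ρ hρ => hin ρ hρ
  · have e (p : ℝ × ℝ × ℝ) : (‖u p‖ ^ 2 + ‖v p‖ ^ 2) * (V * deriv h p.1) =
        V * (deriv h p.1 * (‖u p‖ ^ 2 + ‖v p‖ ^ 2)) := by ring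
    simp only [e]
    rw [integral_const_mul, Measure.volume_eq_prod, setIntegral_prod _ hint]
    exact congrArg _ (setIntegral_congr_fun measurableSet_Ioo fun ρ hρ => hin ρ hρ)

/-- A function on `(0, 2)` which vanishes at both ends, extended by zero. -/
theorem continuousOn_extend_zero {Φ : ℝ → ℝ} (hΦ : ContinuousOn Φ (Ioo 0 2)) {a C₀ C₁ : ℝ}
    (ha : 0 < a) (h0 : ∀ ρ ∈ Ioo (0 : ℝ) 2, ρ < a → |Φ ρ| ≤ C₀ * ρ)
    (h1 : ∀ ρ ∈ Ioo (0 : ℝ) 2, 2 - ρ < a → |Φ ρ| ≤ C₁ * (2 - ρ)) :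
    ContinuousOn ((Ioo (0 : ℝ) 2).indicator Φ) (Icc 0 2) := by
  intro ρ hρ
  by_cases hin : ρ ∈ Ioo (0 : ℝ) 2
  · refine ContinuousAt.continuousWithinAt ?_
    refine (hΦ.continuousAt (isOpen_Ioo.mem_nhds hin)).congr ?_
    filter_upwards [isOpen_Ioo.mem_nhds hin] with x hx
    rw [indicator_of_mem hx]
  · have hz : (Ioo (0 : ℝ) 2).indicator Φ ρ = 0 := indicator_of_notMem hin _
    refine ContinuousAt.continuousWithinAt ?_
    rw [ContinuousAt, hz]
    have hcase : ρ = 0 ∨ ρ = 2 := by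
      by_contra hc
      push Not at hc
      exact hin ⟨lt_of_le_of_ne hρ.1 (Ne.symm hc.1), lt_of_le_of_ne hρ.2 hc.2⟩
    rcases hcase with rfl | rfl
    · refine squeeze_zero_norm' (a := fun x => |C₀ * x|) ?_ ?_
      · filter_upwards [Iio_mem_nhds ha] with x hx
        by_cases hx2 : x ∈ Ioo (0 : ℝ) 2
        · rw [indicator_of_mem hx2]
          exact (h0 x hx2 hx).trans (le_abs_self _)
        · rw [indicator_of_notMem hx2, norm_zero]
          exact abs_nonneg _
      · have : Continuous fun x : ℝ => |C₀ * x| := by fun_prop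
        simpa using this.tendsto 0
    · refine squeeze_zero_norm' (a := fun x => |C₁ * (2 - x)|) ?_ ?_
      · filter_upwards [Ioi_mem_nhds (show 2 - a < 2 by linarith)] with x hx
        by_cases hx2 : x ∈ Ioo (0 : ℝ) 2
        · rw [indicator_of_mem hx2]
          exact (h1 x hx2 (by linarith [mem_Ioi.1 hx])).trans (le_abs_self _)
        · rw [indicator_of_notMem hx2, norm_zero]
          exact abs_nonneg _
      · have : Continuous fun x : ℝ => |C₁ * (2 - x)| := by fun_prop
        simpa using this.tendsto 2

/-- The derivative Φ' of the flux is not known to be integrable; this form of the fundamental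
theorem asks for integrability of the lower bound φ only. -/
theorem integral_nonpos_of_le_deriv {Φ Φ' φ : ℝ → ℝ}
    (hΦ : ∀ ρ ∈ Ioo (0 : ℝ) 2, HasDerivAt Φ (Φ' ρ) ρ)
    (hc : ContinuousOn ((Ioo (0 : ℝ) 2).indicator Φ) (Icc 0 2))
    (hφ : IntegrableOn φ (Ioo 0 2)) (hle : ∀ ρ ∈ Ioo (0 : ℝ) 2, φ ρ ≤ Φ' ρ) :
    ∫ ρ in Ioo (0 : ℝ) 2, φ ρ ≤ 0 := by
  have h1 := intervalIntegral.integral_le_sub_of_hasDeriv_right_of_le (a := 0) (b := 2)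
    (g := (Ioo (0 : ℝ) 2).indicator Φ) (g' := Φ') (φ := φ) (by norm_num) hc
    (fun x hx => ?_) (by rwa [integrableOn_Icc_iff_integrableOn_Ioo]) hle
  · rw [intervalIntegral.integral_of_le (by norm_num), integral_Ioc_eq_integral_Ioo] at h1
    simpa using h1
  · refine ((hΦ x hx).congr_of_eventuallyEq ?_).hasDerivWithinAt
    filter_upwards [isOpen_Ioo.mem_nhds hx] with y hy
    rw [indicator_of_mem hy]

/-- A monotone function with value 0 at both ends is constant. -/
theorem eq_zero_of_deriv_nonneg {Φ Φ' : ℝ → ℝ}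
    (hΦ : ∀ ρ ∈ Ioo (0 : ℝ) 2, HasDerivAt Φ (Φ' ρ) ρ)
    (hc : ContinuousOn ((Ioo (0 : ℝ) 2).indicator Φ) (Icc 0 2))
    (hle : ∀ ρ ∈ Ioo (0 : ℝ) 2, 0 ≤ Φ' ρ) {ρ : ℝ} (hρ : ρ ∈ Ioo (0 : ℝ) 2) : Φ' ρ = 0 := by
  have hd (x : ℝ) (hx : x ∈ Ioo (0 : ℝ) 2) :
      HasDerivAt ((Ioo (0 : ℝ) 2).indicator Φ) (Φ' x) x := by
    refine (hΦ x hx).congr_of_eventuallyEq ?_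
    filter_upwards [isOpen_Ioo.mem_nhds hx] with y hy
    rw [indicator_of_mem hy]
  have hmono : MonotoneOn ((Ioo (0 : ℝ) 2).indicator Φ) (Icc 0 2) := by
    refine monotoneOn_of_deriv_nonneg (convex_Icc 0 2) hc ?_ ?_
    · rw [interior_Icc]
      exact fun x hx => (hd x hx).differentiableAt.differentiableWithinAt
    · rw [interior_Icc]
      intro x hx
      rw [(hd x hx).deriv]
      exact hle x hx
  have hz (x : ℝ) (hx : x ∈ Ioo (0 : ℝ) 2) : Φ x = 0 := by
    have h1 := hmono (left_mem_Icc.2 zero_le_two) (Ioo_subset_Icc_self hx) hx.1.le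
    have h2 := hmono (Ioo_subset_Icc_self hx) (right_mem_Icc.2 zero_le_two) hx.2.le
    simp only [indicator_of_mem hx] at h1 h2
    simp at h1 h2
    exact le_antisymm h2 h1
  have h3 : HasDerivAt Φ 0 ρ := (hasDerivAt_const ρ (0 : ℝ)).congr_of_eventuallyEq (by
    filter_upwards [isOpen_Ioo.mem_nhds hρ] with y hy
    exact hz y hy)
  exact (hΦ ρ hρ).unique h3

end

/-! ### Global vanishing and the global resolvent estimate -/

/-- Profile functions, for one parameter `σ = N / r`, with the shape required at both poles. -/
structure IsAdmissible (r : ℝ) (N : ℤ) (a : ℝ) (g h : ℝ → ℝ) : Prop where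
  g_smooth : ContDiff ℝ ∞ g
  h_smooth : ContDiff ℝ ∞ h
  deriv_pos : ∀ ρ ∈ Ioo (0 : ℝ) 2, 0 < deriv h ρ
  a_pos : 0 < a
  pole_zero : IsPole r g h 0 1 a 0
  pole_two : IsPole r g h 2 (-1) a (2 * N)

/-- The regularity of the two components of a smooth spinor. -/
structure IsSpinorPair (N : ℤ) (α β : ℝ × ℝ × ℝ → ℂ) : Prop where
  smooth_fst : SmoothPeriodic α
  smooth_snd : SmoothPeriodic β
  fst_zero : ExtendsAt 0 1 0 α
  fst_two : ExtendsAt 2 (-1) (2 * N) α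
  snd_zero : ExtendsAt 0 1 (-1) β
  snd_two : ExtendsAt 2 (-1) (2 * N + 1) β

theorem coord_zero (ρ : ℝ) (hρ : ρ ∈ Ioo (0 : ℝ) 2) : 0 + 1 * ρ ∈ Ioo (0 : ℝ) 2 := by
  simpa using hρ

theorem coord_two (ρ : ℝ) (hρ : ρ ∈ Ioo (0 : ℝ) 2) : 2 + -1 * ρ ∈ Ioo (0 : ℝ) 2 :=
  ⟨by linarith [hρ.2], by linarith [hρ.1]⟩

theorem isSpinorPair_of_mem {N : ℤ} {ψ : ℝ × ℝ × ℝ → Fin 2 → ℂ} (hψ : ψ ∈ spinorSections N) :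
    IsSpinorPair N (fun p => ψ p 0) (fun p => ψ p 1) := by
  obtain ⟨h0, hθ, ⟨F, hF, hF'⟩, ⟨G, hG, hG'⟩⟩ := hψ
  have a0 : ExtendsAt 0 1 0 (fun p => ψ p 0) := by
    refine ⟨fun z => F z 0, fun z hz => (contDiffWithinAt_pi.1 (hF z hz)) 0, fun ρ hρ t θ => ?_⟩
    have := congrFun (hF' ρ hρ t θ) 0
    simpa [expI] using this
  have b0 : ExtendsAt 0 1 (-1) (fun p => ψ p 1) := by
    refine ⟨fun z => F z 1, fun z hz => (contDiffWithinAt_pi.1 (hF z hz)) 1, fun ρ hρ t θ => ?_⟩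
    have := congrFun (hF' ρ hρ t θ) 1
    simpa using this
  refine ⟨a0.smoothPeriodic coord_zero (fun p hp => by rw [h0 p hp]; rfl)
    (fun ρ t θ => by rw [hθ]), b0.smoothPeriodic coord_zero (fun p hp => by rw [h0 p hp]; rfl)
    (fun ρ t θ => by rw [hθ]), a0, ?_, b0, ?_⟩
  · refine ⟨fun z => G z 0, fun z hz => (contDiffWithinAt_pi.1 (hG z hz)) 0, fun ρ hρ t θ => ?_⟩
    have := congrFun (hG' ρ hρ t θ) 0
    simpa [← sub_eq_add_neg] using this
  · refine ⟨fun z => G z 1, fun z hz => (contDiffWithinAt_pi.1 (hG z hz)) 1, fun ρ hρ t θ => ?_⟩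
    have := congrFun (hG' ρ hρ t θ) 1
    simpa [← sub_eq_add_neg] using this

theorem SmoothPeriodic.exists_mem_torusBox {E : Type*} [NormedAddCommGroup E] [NormedSpace ℝ E]
    {u : ℝ × ℝ × ℝ → E} (hu : SmoothPeriodic u) (ρ : ℝ) (q : ℝ × ℝ) :
    ∃ q' ∈ torusBox, u (ρ, q) = u (ρ, q') := by
  obtain ⟨t, θ⟩ := q
  obtain ⟨t', ht', e1⟩ := Function.Periodic.exists_mem_Ioc (f := fun x => u (ρ, x, θ))
    (fun x => hu.per_t ρ x θ) Real.two_pi_pos t 0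
  obtain ⟨θ', hθ', e2⟩ := Function.Periodic.exists_mem_Ioc (f := fun x => u (ρ, t', x))
    (fun x => hu.per_theta ρ t' x) Real.two_pi_pos θ 0
  rw [zero_add] at ht' hθ'
  exact ⟨(t', θ'), ⟨ht', hθ'⟩, e1.trans e2⟩

/-- A zero integral gives vanishing almost everywhere. Continuity extends this to the whole box,
which lies in the closure of its interior, and periodicity to all angles. -/
theorem SmoothPeriodic.eq_zero_of_slice {u : ℝ × ℝ × ℝ → ℂ} (hu : SmoothPeriodic u) {ρ : ℝ}
    (hρ : ρ ∈ Ioo (0 : ℝ) 2) (h : slice (fun p => ‖u p‖ ^ 2) ρ = 0) (q : ℝ × ℝ) :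
    u (ρ, q) = 0 := by
  obtain ⟨q', hq', e⟩ := hu.exists_mem_torusBox ρ q
  rw [e]
  have h1 := (integral_eq_zero_iff_of_nonneg (fun q => sq_nonneg ‖u (ρ, q)‖)
    (hu.norm_sq.integrableOn_slice hρ)).1 h
  have hcl : torusBox ⊆ closure (interior torusBox) := by
    rw [torusBox, interior_prod_eq, interior_Ioc, closure_prod_eq,
      closure_Ioo Real.two_pi_pos.ne]
    exact torusBox_subset
  have h2 := Measure.eqOn_of_ae_eq h1
    ((hu.norm_sq.continuous_slice hρ).continuousOn) continuousOn_const hcl hq'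
  simpa using h2

section

variable {V r μ a : ℝ} {N : ℤ} {g h : ℝ → ℝ} {α β : ℝ × ℝ × ℝ → ℂ}

theorem abs_slice_le {F : ℝ × ℝ × ℝ → ℝ} {ρ C : ℝ} (hF : ∀ q ∈ torusBox, |F (ρ, q)| ≤ C) :
    |slice F ρ| ≤ C * volume.real torusBox :=
  norm_setIntegral_le_of_norm_le_const (f := fun q => F (ρ, q)) volume_torusBox_lt_top hF

theorem IsAdmissible.continuousOn_flux (hA : IsAdmissible r N a g h) (hψ : IsSpinorPair N α β) :
    ContinuousOn ((Ioo (0 : ℝ) 2).indicator (slice (fluxDensity V r g h μ α β))) (Icc 0 2) := by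
  have hfl := SmoothPeriodic.fluxDensity (V := V) (r := r) (μ := μ) hA.g_smooth hA.h_smooth
    hψ.smooth_fst hψ.smooth_snd
  obtain ⟨C₀, h0⟩ := hA.pole_zero.exists_abs_fluxDensity_le (V := V) (μ := μ) hψ.fst_zero
    hψ.snd_zero (by norm_num) hψ.smooth_fst hψ.smooth_snd
  obtain ⟨C₁, h1⟩ := hA.pole_two.exists_abs_fluxDensity_le (V := V) (μ := μ) hψ.fst_two
    hψ.snd_two (by norm_num) hψ.smooth_fst hψ.smooth_snd
  refine continuousOn_extend_zero (C₀ := C₀ * volume.real torusBox)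
    (C₁ := C₁ * volume.real torusBox)
    (fun ρ hρ => (hfl.hasDerivAt_slice hρ).continuousAt.continuousWithinAt) hA.a_pos
    (fun ρ hρ hlt => ?_) fun ρ hρ hlt => ?_
  · refine (abs_slice_le (h0 ρ hρ (by linarith))).trans (le_of_eq ?_)
    ring
  · refine (abs_slice_le (h1 ρ hρ (by linarith))).trans (le_of_eq ?_)
    ring

/-- In the spectral window, the second component of an eigenspinor vanishes. -/
theorem IsAdmissible.snd_eq_zero (hA : IsAdmissible r N a g h) (hψ : IsSpinorPair N α β)
    (hr : 0 < r) (hμ : μ ^ 2 ≤ r / 3)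
    (hk : ∀ ρ ∈ Ioo (0 : ℝ) 2, r / 12 ≤ r / 2 - μ ^ 2 + μ * (deriv g ρ / deriv h ρ) / 2
      - deriv (deriv (deriv h)) ρ / deriv h ρ / 2)
    (h1 : ∀ p ∈ polarDomain, resFst V r g h μ α β p = 0)
    (h2 : ∀ p ∈ polarDomain, resSnd V r g h μ α β p = 0) {p : ℝ × ℝ × ℝ} (hp : p ∈ polarDomain) :
    β p = 0 := by
  have hb (ρ : ℝ) (hρ : ρ ∈ Ioo (0 : ℝ) 2) : deriv h ρ * (r / 24 * slice (fun p => ‖β p‖ ^ 2) ρ) ≤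
      slice (dRho (fluxDensity V r g h μ α β)) ρ := by
    have hb := bochner_slice_split (V := V) hA.g_smooth hA.h_smooth hA.deriv_pos hψ.smooth_fst
      hψ.smooth_snd hr hμ hρ (hk ρ hρ)
    have e1 : slice (fun p => ‖resFst V r g h μ α β p‖ ^ 2) ρ = 0 := by
      rw [slice_congr (v := fun _ => (0 : ℝ)) fun q => by
        simp [h1 (ρ, q) (mem_polarDomain.2 hρ)]]
      simp [slice]
    have e2 : slice (fun p => ‖resSnd V r g h μ α β p‖ ^ 2) ρ = 0 := by
      rw [slice_congr (v := fun _ => (0 : ℝ)) fun q => by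
        simp [h2 (ρ, q) (mem_polarDomain.2 hρ)]]
      simp [slice]
    rw [e1, e2] at hb
    have hY : 0 ≤ slice (fun p => ‖opBadj V r g h β p‖ ^ 2) ρ :=
      slice_nonneg (fun p => sq_nonneg _) ρ
    have := mul_nonneg (hA.deriv_pos ρ hρ).le hY
    linarith
  have hB (ρ : ℝ) : 0 ≤ slice (fun p => ‖β p‖ ^ 2) ρ := slice_nonneg (fun p => sq_nonneg _) ρ
  have hfl := SmoothPeriodic.fluxDensity (V := V) (r := r) (μ := μ) hA.g_smooth hA.h_smooth
    hψ.smooth_fst hψ.smooth_snd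
  have hρ := mem_polarDomain.1 hp
  have hz := eq_zero_of_deriv_nonneg (fun ρ hρ => hfl.hasDerivAt_slice hρ)
    (hA.continuousOn_flux hψ) (fun ρ hρ => le_trans
      (mul_nonneg (hA.deriv_pos ρ hρ).le (mul_nonneg (by positivity) (hB ρ))) (hb ρ hρ)) hρ
  have h3 := hb p.1 hρ
  rw [hz] at h3
  have hf := hA.deriv_pos p.1 hρ
  have h4 : slice (fun p => ‖β p‖ ^ 2) p.1 = 0 := by
    refine le_antisymm ?_ (hB _)
    by_contra hc
    push Not at hc
    exact absurd h3 (not_le.2 (by positivity))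
  exact hψ.smooth_snd.eq_zero_of_slice hρ h4 p.2

theorem SmoothPeriodic.exists_norm_le {u : ℝ × ℝ × ℝ → ℂ} {c κ : ℝ} {m : ℤ}
    (hκ : ∀ ρ ∈ Ioo (0 : ℝ) 2, c + κ * ρ ∈ Ioo (0 : ℝ) 2) (hκ1 : |κ| = 1) (ha : a < 1)
    (hu : ExtendsAt c κ m u) (hs : SmoothPeriodic u) :
    ∃ C : ℝ, ∀ ρ ∈ Ioo (0 : ℝ) 2, c + κ * ρ < a → ∀ q ∈ torusBox, ‖u (ρ, q)‖ ≤ C := by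
  obtain ⟨C, -, hC⟩ := hu.bounds hκ hκ1 hs
  exact ⟨C, fun ρ hρ hlt q hq => (hC ρ hρ (hlt.le.trans ha.le) q hq).1⟩

/-- The resolvent estimate. -/
theorem IsAdmissible.exists_integral_le (hA : IsAdmissible r N a g h) (hV : 0 < V)
    (hμ' : ∀ k : ℤ, μ ≠ r / 2 - k / V) (hr : 0 < r) (hμ : μ ^ 2 ≤ r / 3)
    (hk : ∀ ρ ∈ Ioo (0 : ℝ) 2, r / 12 ≤ r / 2 - μ ^ 2 + μ * (deriv g ρ / deriv h ρ) / 2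
      - deriv (deriv (deriv h)) ρ / deriv h ρ / 2) :
    ∃ C : ℝ, 0 < C ∧ ∀ α β : ℝ × ℝ × ℝ → ℂ, IsSpinorPair N α β →
      ∫ p in Ioo (0 : ℝ) 2 ×ˢ torusBox, (‖α p‖ ^ 2 + ‖β p‖ ^ 2) * (V * deriv h p.1) ≤
        C * ∫ p in Ioo (0 : ℝ) 2 ×ˢ torusBox, (‖resFst V r g h μ α β p‖ ^ 2
          + ‖resSnd V r g h μ α β p‖ ^ 2) * (V * deriv h p.1) := by
  obtain ⟨C₁, C₂, hC₂, hle⟩ := exists_slice_resolvent_le hV hμ' hA.g_smooth hA.h_smooth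
    hA.deriv_pos hr hμ hk
  refine ⟨C₂, hC₂, fun α β hψ => ?_⟩
  have hα := hψ.smooth_fst
  have hβ := hψ.smooth_snd
  have hχ := hα.resFst (V := V) (r := r) (μ := μ) hA.g_smooth hA.h_smooth hA.deriv_pos hβ
  have hη := hα.resSnd (V := V) (r := r) (μ := μ) hA.g_smooth hA.h_smooth hA.deriv_pos hβ
  have p0 := hA.pole_zero
  have p2 := hA.pole_two
  obtain ⟨i1, e1⟩ := integral_polar_eq (V := V) hA.h_smooth hα hβ
    (exists_norm_le_of_poles hA.a_pos hα
      (SmoothPeriodic.exists_norm_le p0.coord p0.abs_eq_one p0.lt_one hψ.fst_zero hα)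
      (SmoothPeriodic.exists_norm_le p2.coord p2.abs_eq_one p2.lt_one hψ.fst_two hα))
    (exists_norm_le_of_poles hA.a_pos hβ
      (SmoothPeriodic.exists_norm_le p0.coord p0.abs_eq_one p0.lt_one hψ.snd_zero hβ)
      (SmoothPeriodic.exists_norm_le p2.coord p2.abs_eq_one p2.lt_one hψ.snd_two hβ))
  obtain ⟨i2, e2⟩ := integral_polar_eq (V := V) hA.h_smooth hχ hη
    (exists_norm_le_of_poles hA.a_pos hχ
      (p0.exists_norm_resFst_le hψ.fst_zero hψ.snd_zero (by norm_num) hα hβ)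
      (p2.exists_norm_resFst_le hψ.fst_two hψ.snd_two (by norm_num) hα hβ))
    (exists_norm_le_of_poles hA.a_pos hη
      (p0.exists_norm_resSnd_le hψ.fst_zero hψ.snd_zero hα hβ)
      (p2.exists_norm_resSnd_le hψ.fst_two hψ.snd_two hα hβ))
  rw [e1, e2, mul_left_comm]
  refine mul_le_mul_of_nonneg_left ?_ hV.le
  have hfl := SmoothPeriodic.fluxDensity (V := V) (r := r) (μ := μ) hA.g_smooth hA.h_smooth
    hα hβ
  have hcont : ContinuousOn ((Ioo (0 : ℝ) 2).indicator
      (fun ρ => C₁ * slice (fluxDensity V r g h μ α β) ρ)) (Icc 0 2) := by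
    have h3 := (hA.continuousOn_flux (V := V) (μ := μ) hψ).const_smul C₁
    refine h3.congr fun ρ _ => ?_
    by_cases hρ : ρ ∈ Ioo (0 : ℝ) 2 <;> simp [hρ]
  -- The flux term in the torus estimate is a ρ-derivative of a function vanishing at both poles, so
  -- it drops out of the integral whatever the sign of `C₁`.
  have := integral_nonpos_of_le_deriv
    (fun ρ hρ => (hfl.hasDerivAt_slice hρ).const_mul C₁) hcont
    (i1.sub (i2.const_mul C₂)) (fun ρ hρ => by
      have := hle α β hα hβ ρ hρ
      simp only [Pi.sub_apply]
      linarith)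
  rw [integral_sub' i1 (i2.const_mul C₂), integral_const_mul] at this
  linarith

end

/-! ## The given profile functions -/

section

variable {δ σ : ℝ} {g : ℝ → ℝ} {h : ℝ → ℝ → ℝ}

theorem IsProfileH.derivs_near_zero (hh : IsProfileH δ h) (hσ : σ ∈ Ioo (9 / 10 : ℝ) (11 / 10))
    {ρ : ℝ} (hρ : ρ ∈ Ioo 0 (50 * δ)) :
    deriv (h σ) ρ = ρ ∧ deriv (deriv (h σ)) ρ = 1 ∧ deriv (deriv (deriv (h σ))) ρ = 0 := by
  have e0 : h σ =ᶠ[𝓝 ρ] fun x => x ^ 2 / 2 := by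
    filter_upwards [isOpen_Ioo.mem_nhds hρ] with x hx
    exact hh.near_zero σ hσ x (Ioo_subset_Icc_self hx)
  have e1 : deriv (h σ) =ᶠ[𝓝 ρ] fun x => x := by
    refine e0.deriv.trans (Eventually.of_forall fun x => ?_)
    simp
  have e2 : deriv (deriv (h σ)) =ᶠ[𝓝 ρ] fun _ => 1 := by
    refine e1.deriv.trans (Eventually.of_forall fun x => ?_)
    simp
  refine ⟨e1.eq_of_nhds, e2.eq_of_nhds, ?_⟩
  rw [e2.deriv_eq]
  simp

theorem IsProfileH.derivs_near_two (hh : IsProfileH δ h) (hσ : σ ∈ Ioo (9 / 10 : ℝ) (11 / 10))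
    {ρ : ℝ} (hρ : ρ ∈ Ioo (2 - 50 * δ) 2) :
    deriv (h σ) ρ = 2 - ρ ∧ deriv (deriv (h σ)) ρ = -1 ∧ deriv (deriv (deriv (h σ))) ρ = 0 := by
  have e0 : h σ =ᶠ[𝓝 ρ] fun x => 2 * σ - (x - 2) ^ 2 / 2 := by
    filter_upwards [isOpen_Ioo.mem_nhds hρ] with x hx
    exact hh.near_two σ hσ x (Ioo_subset_Icc_self hx)
  have e1 : deriv (h σ) =ᶠ[𝓝 ρ] fun x => 2 - x := by
    refine e0.deriv.trans (Eventually.of_forall fun x => ?_)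
    have : HasDerivAt (fun x : ℝ => 2 * σ - (x - 2) ^ 2 / 2) (2 - x) x := by
      refine (((((hasDerivAt_id x).sub_const 2).pow 2).div_const 2).const_sub (2 * σ)).congr_deriv ?_
      simp
    exact this.deriv
  have e2 : deriv (deriv (h σ)) =ᶠ[𝓝 ρ] fun _ => -1 := by
    refine e1.deriv.trans (Eventually.of_forall fun x => ?_)
    simp
  refine ⟨e1.eq_of_nhds, e2.eq_of_nhds, ?_⟩
  rw [e2.deriv_eq]
  simp

theorem IsProfileG.near_poles (hg : IsProfileG δ g) {ρ : ℝ}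
    (hρ : ρ ∈ Ioo 0 (50 * δ) ∨ ρ ∈ Ioo (2 - 50 * δ) 2) : g ρ = 0 ∧ deriv g ρ = 0 := by
  have e0 : g =ᶠ[𝓝 ρ] fun _ => 0 := by
    rcases hρ with hρ | hρ
    · filter_upwards [isOpen_Ioo.mem_nhds hρ] with x hx
      exact hg.near_zero x (Ioo_subset_Icc_self hx)
    · filter_upwards [isOpen_Ioo.mem_nhds hρ] with x hx
      exact hg.near_two x (Ioo_subset_Icc_self hx)
  exact ⟨e0.eq_of_nhds, by rw [e0.deriv_eq]; simp⟩

/-- The relation rσ = N makes rĥ equal to 2N at ρ = 2, matching the twist between 1₋ and 1₊; this is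
why σ = [r]/r is chosen. -/
theorem isAdmissible_of_profiles (hδ : 0 < δ) (hδ' : δ < 1 / 100) (hg : IsProfileG δ g)
    (hh : IsProfileH δ h) (hσ : σ ∈ Ioo (9 / 10 : ℝ) (11 / 10)) {r : ℝ} {N : ℤ}
    (hN : r * σ = N) : IsAdmissible r N (50 * δ) g (h σ) where
  g_smooth := hg.smooth
  h_smooth := hh.smooth σ hσ
  deriv_pos := hh.deriv_pos σ hσ
  a_pos := by positivity
  pole_zero := by
    have k (ρ : ℝ) (hρ : ρ ∈ Ioo (0 : ℝ) 2) (hlt : 0 + 1 * ρ < 50 * δ) : ρ ∈ Ioo 0 (50 * δ) :=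
      ⟨hρ.1, by linarith⟩
    refine ⟨coord_zero, by simp, by linarith, fun ρ hρ hlt => (hg.near_poles (.inl (k ρ hρ hlt))).1,
      fun ρ hρ hlt => (hg.near_poles (.inl (k ρ hρ hlt))).2, fun ρ hρ hlt => ?_,
      fun ρ hρ hlt => (hh.derivs_near_zero hσ (k ρ hρ hlt)).2.1, fun ρ hρ hlt => ?_⟩
    · rw [(hh.derivs_near_zero hσ (k ρ hρ hlt)).1]
      ring
    · rw [hh.near_zero σ hσ ρ (Ioo_subset_Icc_self (k ρ hρ hlt))]
      push_cast
      ring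
  pole_two := by
    have k (ρ : ℝ) (hρ : ρ ∈ Ioo (0 : ℝ) 2) (hlt : 2 + -1 * ρ < 50 * δ) :
        ρ ∈ Ioo (2 - 50 * δ) 2 := ⟨by linarith, hρ.2⟩
    refine ⟨coord_two, by simp, by linarith, fun ρ hρ hlt => (hg.near_poles (.inr (k ρ hρ hlt))).1,
      fun ρ hρ hlt => (hg.near_poles (.inr (k ρ hρ hlt))).2, fun ρ hρ hlt => ?_,
      fun ρ hρ hlt => (hh.derivs_near_two hσ (k ρ hρ hlt)).2.1, fun ρ hρ hlt => ?_⟩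
    · rw [(hh.derivs_near_two hσ (k ρ hρ hlt)).1]
      ring
    · rw [hh.near_two σ hσ ρ (Ioo_subset_Icc_self (k ρ hρ hlt))]
      push_cast
      rw [← hN]
      ring

/-- ĝ' and ĥ''' vanish near the poles, where ĥ' is small. In between, ĥ' has a lower bound and ĥ'''
an upper bound, both uniform in σ. This uniformity makes c₂ independent of r. -/
theorem exists_curvature_bound (hg : IsProfileG δ g) (hh : IsProfileH δ h) :
    ∃ C : ℝ, 0 ≤ C ∧ ∀ σ ∈ Ioo (9 / 10 : ℝ) (11 / 10), ∀ ρ ∈ Ioo (0 : ℝ) 2,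
      |deriv g ρ / deriv (h σ) ρ| ≤ C ∧ |deriv (deriv (deriv (h σ))) ρ / deriv (h σ) ρ| ≤ C := by
  obtain ⟨D, hD⟩ := hh.bounded 3
  obtain ⟨m, hm, hlow⟩ := hh.deriv_lower
  obtain ⟨G, hG⟩ := (isCompact_Icc (a := (0 : ℝ)) (b := 2)).exists_bound_of_continuousOn
    (contDiff_deriv hg.smooth).continuous.continuousOn
  refine ⟨max 0 (max (G / m) (D / m)), le_max_left _ _, fun σ hσ ρ hρ => ?_⟩
  by_cases k0 : ρ < 50 * δ
  · have h1 := (hh.derivs_near_zero hσ ⟨hρ.1, k0⟩).2.2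
    have h2 := (hg.near_poles (.inl ⟨hρ.1, k0⟩)).2
    simp [h1, h2]
  by_cases k1 : 2 - 50 * δ < ρ
  · have h1 := (hh.derivs_near_two hσ ⟨k1, hρ.2⟩).2.2
    have h2 := (hg.near_poles (.inr ⟨k1, hρ.2⟩)).2
    simp [h1, h2]
  · have h3 := hlow σ hσ ρ ⟨not_lt.1 k0, not_lt.1 k1⟩
    have h4 := hG ρ (Ioo_subset_Icc_self hρ)
    have h5 := hD σ hσ ρ (Ioo_subset_Icc_self hρ)
    rw [show iteratedDeriv 3 (h σ) = deriv (deriv (deriv (h σ))) by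
      simp [iteratedDeriv_succ, iteratedDeriv_zero]] at h5
    rw [Real.norm_eq_abs] at h4
    have h6 := hm.trans_le h3
    rw [abs_div, abs_div, abs_of_pos h6]
    refine ⟨(div_le_div₀ ((abs_nonneg _).trans h4) h4 hm h3).trans
      ((le_max_left _ _).trans (le_max_right _ _)),
      (div_le_div₀ ((abs_nonneg _).trans h5) h5 hm h3).trans
      ((le_max_right _ _).trans (le_max_right _ _))⟩

/-- From (μ + 2c)² ≥ 0 one gets μc/2 ≥ −μ²/8 − c²/2, and r/2 − (9/8)(r/3) = r/8. The surplus r/8 −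
r/12 = r/24 absorbs (C² + C)/2. -/
theorem curvature_estimate {r μ C c k : ℝ} (hμ : μ ^ 2 ≤ r / 3) (hr : 12 * (C ^ 2 + C) ≤ r)
    (hc : |c| ≤ C) (hk : |k| ≤ C) : r / 12 ≤ r / 2 - μ ^ 2 + μ * c / 2 - k / 2 := by
  have h1 : c ^ 2 ≤ C ^ 2 := sq_le_sq' (abs_le.1 hc).1 (abs_le.1 hc).2
  have h2 := (abs_le.1 hk).2
  nlinarith [sq_nonneg (μ + 2 * c)]

theorem floor_div_mem {r : ℝ} (hr : 20 < r) : (⌊r⌋ / r : ℝ) ∈ Ioo (9 / 10 : ℝ) (11 / 10) := by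
  have h0 : 0 < r := by linarith
  have h1 := Int.floor_le r
  have h2 := Int.lt_floor_add_one r
  constructor
  · rw [lt_div_iff₀ h0]
    linarith
  · rw [div_lt_iff₀ h0]
    linarith

end

/-! ## Fourier coefficients in `t` -/

/-- A continuous periodic function with vanishing Fourier coefficients is zero. -/
theorem eq_zero_of_fourier {w : ℝ → ℂ} (hw : Continuous w) (hp : Function.Periodic w (2 * Real.pi))
    (h : ∀ n : ℤ, ∫ t in Ioc 0 (2 * Real.pi), w t * expI (-n) t = 0) : w = 0 := by
  have : Fact (0 < 2 * Real.pi) := ⟨Real.two_pi_pos⟩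
  let f : C(AddCircle (2 * Real.pi), ℂ) := ⟨hp.lift, continuous_coinduced_dom.mpr hw⟩
  have hc (n : ℤ) : fourierCoeff f n = 0 := by
    rw [fourierCoeff_eq_intervalIntegral f n 0, zero_add,
      intervalIntegral.integral_of_le Real.two_pi_pos.le]
    have e : ∫ t in Ioc 0 (2 * Real.pi), fourier (-n) (t : AddCircle (2 * Real.pi)) •
        f (t : AddCircle (2 * Real.pi)) = ∫ t in Ioc 0 (2 * Real.pi), w t * expI (-n) t := by
      refine integral_congr_ae (Eventually.of_forall fun t => ?_)
      simp only [fourier_coe_apply, smul_eq_mul, expI]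
      have h1 : f (t : AddCircle (2 * Real.pi)) = w t := rfl
      rw [h1, mul_comm]
      congr 2
      have : (Real.pi : ℂ) ≠ 0 := by exact_mod_cast Real.pi_ne_zero
      push_cast
      field_simp
    rw [e, h n, smul_zero]
  have hs : Summable (fourierCoeff f) := by
    rw [show fourierCoeff f = fun _ => 0 from funext hc]
    exact summable_zero
  funext t
  have h1 := has_pointwise_sum_fourier_series_of_summable hs (t : AddCircle (2 * Real.pi))
  simp only [hc, zero_smul] at h1
  exact h1.unique hasSum_zero

theorem smoothPeriodic_expI (n : ℤ) : SmoothPeriodic (fun p : ℝ × ℝ × ℝ => expI n p.2.1) :=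
  ⟨((contDiff_expI n).comp (contDiff_fst.comp contDiff_snd)).contDiffOn,
    fun _ t _ => expI_add_two_pi n t, fun _ _ _ => rfl⟩

theorem dT_expI (n : ℤ) {p : ℝ × ℝ × ℝ} (hp : p ∈ polarDomain) :
    dT (fun p : ℝ × ℝ × ℝ => expI n p.2.1) p = Complex.I * n * expI n p.2.1 :=
  ((smoothPeriodic_expI n).hasDerivAt_t (mem_polarDomain.1 hp) p.2.1 p.2.2).unique
    (hasDerivAt_expI n p.2.1)

theorem dRho_expI (n : ℤ) {p : ℝ × ℝ × ℝ} (hp : p ∈ polarDomain) :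
    dRho (fun p : ℝ × ℝ × ℝ => expI n p.2.1) p = 0 :=
  ((smoothPeriodic_expI n).hasDerivAt_rho (mem_polarDomain.1 hp) p.2).unique
    (hasDerivAt_const p.1 (expI n p.2.1))

theorem slice_mul_left (c : ℂ) (F : ℝ × ℝ × ℝ → ℂ) (ρ : ℝ) :
    slice (fun p => c * F p) ρ = c * slice F ρ := integral_const_mul _ _

theorem slice_expI {n : ℤ} (hn : n ≠ 0) {ρ : ℝ} (hρ : ρ ∈ Ioo (0 : ℝ) 2) :
    slice (fun p : ℝ × ℝ × ℝ => expI n p.2.1) ρ = 0 := by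
  have h1 := (smoothPeriodic_expI n).slice_dT hρ
  rw [slice_congr (v := fun p => Complex.I * n * expI n p.2.1)
    fun q => dT_expI n (mem_polarDomain.2 hρ), slice_mul_left] at h1
  refine (mul_eq_zero.1 h1).resolve_left (mul_ne_zero Complex.I_ne_zero ?_)
  exact_mod_cast hn

theorem slice_expI_zero (ρ : ℝ) :
    slice (fun p : ℝ × ℝ × ℝ => expI 0 p.2.1) ρ = ((2 * Real.pi) ^ 2 : ℝ) := by
  have : volume.real torusBox = (2 * Real.pi) ^ 2 := by
    rw [torusBox, Measure.volume_eq_prod, measureReal_prod_prod]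
    simp [Real.pi_pos.le]
    ring
  simp [slice, expI, this]

/-- The Fourier coefficient of `u` on the torus at `ρ` (up to a factor). -/
noncomputable def torusCoeff (u : ℝ × ℝ × ℝ → ℂ) (n : ℤ) : ℝ → ℂ :=
  slice fun p => u p * expI (-n) p.2.1

section

variable {V r c κ a q : ℝ} {m n : ℤ} {g h : ℝ → ℝ} {u : ℝ × ℝ × ℝ → ℂ}

/-- The Fourier coefficients of a solution of `∂_ρ u = (1/ĥ') (i ∂_t - φ) u` solve an ordinary
differential equation. -/
theorem hasDerivAt_torusCoeff (hu : SmoothPeriodic u) {φ f : ℝ → ℝ}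
    (hode : ∀ p ∈ polarDomain,
      dRho u p = (1 / f p.1 : ℝ) * (Complex.I * dT u p - (φ p.1 : ℝ) * u p))
    (n : ℤ) {ρ : ℝ} (hρ : ρ ∈ Ioo (0 : ℝ) 2) :
    HasDerivAt (torusCoeff u n) (-((n + φ ρ) / f ρ : ℝ) * torusCoeff u n ρ) ρ := by
  have hE := smoothPeriodic_expI (-n)
  have hw := hu.mul hE
  refine (hw.hasDerivAt_slice hρ).congr_deriv ?_
  -- The derivative i∂_t is moved onto the product u e^{−int}, at the cost of −n u e^{−int}; the
  -- total t-derivative then integrates to zero.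
  have e (q : ℝ × ℝ) : dRho (fun p => u p * expI (-n) p.2.1) (ρ, q) =
      (1 / f ρ : ℝ) * (Complex.I * dT (fun p => u p * expI (-n) p.2.1) (ρ, q))
        + (-((n + φ ρ) / f ρ : ℝ) : ℂ) * (u (ρ, q) * expI (-n) q.1) := by
    have hp : (ρ, q) ∈ polarDomain := mem_polarDomain.2 hρ
    have h1 := (hw.hasDerivAt_rho hρ q).unique
      ((hu.hasDerivAt_rho hρ q).mul (hE.hasDerivAt_rho hρ q))
    have h2 := (hw.hasDerivAt_t hρ q.1 q.2).unique
      ((hu.hasDerivAt_t hρ q.1 q.2).mul (hE.hasDerivAt_t hρ q.1 q.2))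
    rw [dRho_expI _ hp] at h1
    have h3 := dT_expI (-n) hp
    simp only [Prod.mk.eta] at h2
    rw [h3] at h2
    rw [h1, h2, hode _ hp]
    push_cast
    linear_combination ((n : ℂ) * u (ρ, q) * expI (-n) q.1 / f ρ) * Complex.I_sq
  have hsp : SmoothPeriodic fun p => ((-((n + φ ρ) / f ρ) : ℝ) : ℂ) * (u p * expI (-n) p.2.1) :=
    hw.const_mul _
  rw [slice_congr (v := fun p => ((1 / f ρ : ℝ) : ℂ) *
      (Complex.I * dT (fun p => u p * expI (-n) p.2.1) p)
        + (-((n + φ ρ) / f ρ : ℝ) : ℂ) * (u p * expI (-n) p.2.1)) e,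
    SmoothPeriodic.slice_add ((hw.dT.const_mul _).const_mul _) (hw.const_mul _) hρ,
    slice_mul_left, slice_mul_left, slice_mul_left, hw.slice_dT hρ]
  simp [torusCoeff]

/-- The quotient A/b has zero derivative on an interval. -/
theorem eq_const_mul_of_ode {x y : ℝ} {A : ℝ → ℂ} {b q : ℝ → ℝ}
    (hA : ∀ ρ ∈ Ioo x y, HasDerivAt A (-(q ρ : ℝ) * A ρ) ρ)
    (hb : ∀ ρ ∈ Ioo x y, HasDerivAt b (-(q ρ) * b ρ) ρ) (hb0 : ∀ ρ ∈ Ioo x y, b ρ ≠ 0) :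
    ∃ C : ℂ, ∀ ρ ∈ Ioo x y, A ρ = C * b ρ := by
  have hd (ρ : ℝ) (hρ : ρ ∈ Ioo x y) : HasDerivAt (fun ρ => A ρ / (b ρ : ℂ)) 0 ρ := by
    have hbC : (b ρ : ℂ) ≠ 0 := by exact_mod_cast hb0 ρ hρ
    refine ((hA ρ hρ).div (hb ρ hρ).ofReal_comp hbC).congr_deriv ?_
    push_cast
    ring
  obtain ⟨C, hC⟩ := isOpen_Ioo.exists_is_const_of_deriv_eq_zero (convex_Ioo x y).isPreconnected
    (fun ρ hρ => (hd ρ hρ).differentiableAt.differentiableWithinAt) (fun ρ hρ => (hd ρ hρ).deriv)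
  refine ⟨C, fun ρ hρ => ?_⟩
  have hbC : (b ρ : ℂ) ≠ 0 := by exact_mod_cast hb0 ρ hρ
  rw [← hC ρ hρ]
  field_simp

/-- The positive solution of `G' = -q G`. -/
theorem exists_radial_solution {q : ℝ → ℝ} (hq : ContDiffOn ℝ ∞ q (Ioo 0 2)) :
    ∃ G : ℝ → ℝ, (∀ ρ, 0 < G ρ) ∧ (∀ ρ ∈ Ioo (0 : ℝ) 2, HasDerivAt G (-(q ρ) * G ρ) ρ) ∧
      ContDiffOn ℝ ∞ G (Ioo 0 2) := by
  set Q : ℝ → ℝ := fun ρ => ∫ x in (1 : ℝ)..ρ, q x with hQ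
  have hd (ρ : ℝ) (hρ : ρ ∈ Ioo (0 : ℝ) 2) : HasDerivAt Q (q ρ) ρ := by
    refine intervalIntegral.integral_hasDerivAt_right ?_ ?_ ?_
    · refine (hq.continuousOn.mono ?_).intervalIntegrable
      exact ordConnected_Ioo.uIcc_subset ⟨by norm_num, by norm_num⟩ hρ
    · exact hq.continuousOn.stronglyMeasurableAtFilter isOpen_Ioo ρ hρ
    · exact hq.continuousOn.continuousAt (isOpen_Ioo.mem_nhds hρ)
  have hQs : ContDiffOn ℝ ∞ Q (Ioo 0 2) := by
    rw [contDiffOn_infty_iff_deriv_of_isOpen isOpen_Ioo]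
    exact ⟨fun ρ hρ => (hd ρ hρ).differentiableAt.differentiableWithinAt,
      hq.congr fun ρ hρ => (hd ρ hρ).deriv⟩
  refine ⟨fun ρ => Real.exp (-Q ρ), fun ρ => Real.exp_pos _, fun ρ hρ => ?_, hQs.neg.exp⟩
  refine (hd ρ hρ).neg.exp.congr_deriv ?_
  simp only [Pi.neg_apply]
  ring

/-- The model solution near a pole. -/
theorem hasDerivAt_poleModel (r : ℝ) (e : ℤ) {ρ : ℝ} (hs : 0 < c + κ * ρ) :
    HasDerivAt (fun x => (c + κ * x) ^ e * Real.exp (-(r * (c + κ * x) ^ 2 / 4)))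
      (-((-κ * e + κ * (r * (c + κ * ρ) ^ 2 / 2)) / (c + κ * ρ)) *
        ((c + κ * ρ) ^ e * Real.exp (-(r * (c + κ * ρ) ^ 2 / 4)))) ρ := by
  have h1 : HasDerivAt (fun x : ℝ => c + κ * x) κ ρ := by
    simpa using ((hasDerivAt_id ρ).const_mul κ).const_add c
  have h2 : HasDerivAt (fun x => (c + κ * x) ^ e) (e * (c + κ * ρ) ^ (e - 1) * κ) ρ :=
    HasDerivAt.comp (h₂ := fun y : ℝ => y ^ e) ρ
      (hasDerivAt_zpow e (c + κ * ρ) (Or.inl hs.ne')) h1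
  have h3 := ((((h1.pow 2).const_mul r).div_const 4).neg).exp
  refine (h2.mul h3).congr_deriv ?_
  rw [zpow_sub_one₀ hs.ne']
  simp only [Pi.pow_apply, Pi.neg_apply]
  field_simp
  ring

end

/-! ## The kernel of the Cauchy–Riemann operator -/

section

variable {V r c κ a lam : ℝ} {m n N k : ℤ} {g h : ℝ → ℝ} {u : ℝ × ℝ × ℝ → ℂ}

/-- The coefficient of the radial equation of the `n`-th Fourier mode. -/
noncomputable def radialCoeff (r lam : ℝ) (g h : ℝ → ℝ) (n : ℤ) (ρ : ℝ) : ℝ :=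
  (n + (r * h ρ + lam * g ρ)) / deriv h ρ

theorem IsPole.sq_eq_one (hP : IsPole r g h c κ a m) : κ ^ 2 = 1 := by
  rw [← sq_abs, hP.abs_eq_one, one_pow]

theorem IsPole.radialCoeff_eq (hP : IsPole r g h c κ a m) {e : ℤ} (he : (e : ℝ) = -κ * (n + m))
    {ρ : ℝ} (hρ : ρ ∈ Ioo (0 : ℝ) 2) (hlt : c + κ * ρ < a) :
    radialCoeff r lam g h n ρ =
      (-κ * e + κ * (r * (c + κ * ρ) ^ 2 / 2)) / (c + κ * ρ) := by
  rw [radialCoeff, hP.g_zero ρ hρ hlt, hP.h_eq ρ hρ hlt, hP.deriv_h ρ hρ hlt, he]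
  congr 1
  linear_combination (-((n : ℝ) + m)) * hP.sq_eq_one

/-- Near a pole the profiles are explicit and the radial equation is solved exactly by s^e
exp(−rs²/4), s = c + κρ. The exponent e = −κ(n + m) decides whether the mode extends over the pole.
-/
theorem IsPole.eq_const_mul_model (hP : IsPole r g h c κ a m) {e : ℤ}
    (he : (e : ℝ) = -κ * (n + m)) {A : ℝ → ℂ} {x y : ℝ}
    (hxy : ∀ ρ ∈ Ioo x y, ρ ∈ Ioo (0 : ℝ) 2 ∧ c + κ * ρ < a)
    (hA : ∀ ρ ∈ Ioo (0 : ℝ) 2, HasDerivAt A (-(radialCoeff r lam g h n ρ : ℝ) * A ρ) ρ) :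
    ∃ C : ℂ, ∀ ρ ∈ Ioo x y, A ρ =
      C * ((c + κ * ρ) ^ e * Real.exp (-(r * (c + κ * ρ) ^ 2 / 4)) : ℝ) := by
  refine eq_const_mul_of_ode (q := radialCoeff r lam g h n) (fun ρ hρ => hA ρ (hxy ρ hρ).1)
    (b := fun ρ => (c + κ * ρ) ^ e * Real.exp (-(r * (c + κ * ρ) ^ 2 / 4)))
    (fun ρ hρ => ?_) fun ρ hρ => ?_
  · obtain ⟨h1, h2⟩ := hxy ρ hρ
    rw [hP.radialCoeff_eq he h1 h2]
    exact hasDerivAt_poleModel r e (hP.coord ρ h1).1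
  · have := (hP.coord ρ (hxy ρ hρ).1).1
    positivity

/-- A bounded solution of the radial equation with a negative exponent at a pole vanishes near
the pole. -/
theorem IsPole.eq_zero_of_bounded (hP : IsPole r g h c κ a m) (ha : 0 < a) {e : ℤ}
    (he : (e : ℝ) = -κ * (n + m)) (hneg : e < 0) {A : ℝ → ℂ} {B x y ρ₀ : ℝ}
    (hxy : ∀ ρ ∈ Ioo x y, ρ ∈ Ioo (0 : ℝ) 2 ∧ c + κ * ρ < a)
    (hsurj : ∀ s ∈ Ioo 0 a, ∃ ρ ∈ Ioo x y, c + κ * ρ = s)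
    (hA : ∀ ρ ∈ Ioo (0 : ℝ) 2, HasDerivAt A (-(radialCoeff r lam g h n ρ : ℝ) * A ρ) ρ)
    (hB : ∀ ρ ∈ Ioo x y, ‖A ρ‖ ≤ B) (hρ₀ : ρ₀ ∈ Ioo x y) : A ρ₀ = 0 := by
  obtain ⟨C, hC⟩ := hP.eq_const_mul_model he hxy hA
  -- Since e ≤ −1 and s < 1, boundedness by B forces ‖C‖ s⁻¹ exp(−|r|/4) ≤ B. Letting s → 0 gives C
  -- = 0.
  have hs (s : ℝ) (hs : s ∈ Ioo 0 a) : ‖C‖ * Real.exp (-(|r| / 4)) ≤ B * s := by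
    obtain ⟨ρ, hρ, rfl⟩ := hsurj s hs
    have h1 := hB ρ hρ
    rw [hC ρ hρ, norm_mul, Complex.norm_real, Real.norm_eq_abs] at h1
    have hs1 : c + κ * ρ < 1 := hs.2.trans hP.lt_one
    rw [abs_of_pos (mul_pos (zpow_pos hs.1 e) (Real.exp_pos _))] at h1
    have h2 : (c + κ * ρ) ^ (-1 : ℤ) ≤ (c + κ * ρ) ^ e :=
      zpow_le_zpow_right_of_le_one₀ hs.1 hs1.le (by omega)
    have h3 : Real.exp (-(|r| / 4)) ≤ Real.exp (-(r * (c + κ * ρ) ^ 2 / 4)) := by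
      refine Real.exp_le_exp.2 ?_
      have h4 : (c + κ * ρ) ^ 2 ≤ 1 := pow_le_one₀ hs.1.le hs1.le
      have h5 : r * (c + κ * ρ) ^ 2 ≤ |r| * 1 :=
        mul_le_mul (le_abs_self r) h4 (sq_nonneg _) (abs_nonneg r)
      linarith
    have h6 : ‖C‖ * ((c + κ * ρ) ^ (-1 : ℤ) * Real.exp (-(|r| / 4))) ≤ B :=
      (mul_le_mul_of_nonneg_left (mul_le_mul h2 h3 (Real.exp_pos _).le (zpow_pos hs.1 e).le)
        (norm_nonneg C)).trans h1
    rw [zpow_neg_one] at h6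
    calc ‖C‖ * Real.exp (-(|r| / 4)) =
        ‖C‖ * ((c + κ * ρ)⁻¹ * Real.exp (-(|r| / 4))) * (c + κ * ρ) := by
          have := hs.1.ne'
          field_simp
      _ ≤ B * (c + κ * ρ) := mul_le_mul_of_nonneg_right h6 hs.1.le
  have h0 : ‖C‖ * Real.exp (-(|r| / 4)) ≤ 0 := by
    have ht : Tendsto (fun s : ℝ => B * s) (𝓝[>] 0) (𝓝 0) := by
      have : Continuous fun s : ℝ => B * s := by fun_prop
      simpa using (this.tendsto 0).mono_left nhdsWithin_le_nhds
    refine ge_of_tendsto ht ?_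
    filter_upwards [Ioo_mem_nhdsGT ha] with s hs'
    exact hs s hs'
  have hC0 : C = 0 := by
    have := Real.exp_pos (-(|r| / 4))
    refine norm_le_zero_iff.1 ?_
    by_contra hc
    push Not at hc
    exact absurd h0 (not_le.2 (by positivity))
  rw [hC ρ₀ hρ₀, hC0, zero_mul]

theorem contDiffOn_radialCoeff (hg : ContDiff ℝ ∞ g) (hh : ContDiff ℝ ∞ h)
    (hpos : ∀ ρ ∈ Ioo (0 : ℝ) 2, 0 < deriv h ρ) :
    ContDiffOn ℝ ∞ (radialCoeff r lam g h n) (Ioo 0 2) :=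
  ((contDiff_const.add ((contDiff_const.mul hh).add (contDiff_const.mul hg))).contDiffOn).div
    (contDiff_deriv hh).contDiffOn fun ρ hρ => (hpos ρ hρ).ne'

/-- A solution of the radial equation which vanishes at one point vanishes. -/
theorem IsAdmissible.radial_eq_zero (hA : IsAdmissible r N a g h) {A : ℝ → ℂ}
    (hode : ∀ ρ ∈ Ioo (0 : ℝ) 2, HasDerivAt A (-(radialCoeff r lam g h n ρ : ℝ) * A ρ) ρ)
    {ρ₀ : ℝ} (hρ₀ : ρ₀ ∈ Ioo (0 : ℝ) 2) (h0 : A ρ₀ = 0) {ρ : ℝ} (hρ : ρ ∈ Ioo (0 : ℝ) 2) :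
    A ρ = 0 := by
  obtain ⟨G, hG0, hG, -⟩ := exists_radial_solution
    (contDiffOn_radialCoeff (r := r) (lam := lam) (n := n) hA.g_smooth hA.h_smooth hA.deriv_pos)
  obtain ⟨C, hC⟩ := eq_const_mul_of_ode hode hG fun ρ _ => (hG0 ρ).ne'
  have h1 := hC ρ₀ hρ₀
  rw [h0] at h1
  have h2 : C = 0 := (mul_eq_zero.1 h1.symm).resolve_right (by exact_mod_cast (hG0 ρ₀).ne')
  rw [hC ρ hρ, h2, zero_mul]

/-- Outside `-2N ≤ n ≤ 0`, a bounded solution of the radial equation vanishes. -/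
theorem IsAdmissible.radial_eq_zero_of_bounded (hA : IsAdmissible r N a g h) {A : ℝ → ℂ}
    (hode : ∀ ρ ∈ Ioo (0 : ℝ) 2, HasDerivAt A (-(radialCoeff r lam g h n ρ : ℝ) * A ρ) ρ)
    {B : ℝ} (hB : ∀ ρ ∈ Ioo (0 : ℝ) 2, ‖A ρ‖ ≤ B) (hn : 0 < n ∨ n < -(2 * N))
    {ρ : ℝ} (hρ : ρ ∈ Ioo (0 : ℝ) 2) : A ρ = 0 := by
  have ha := hA.a_pos
  have ha1 := hA.pole_zero.lt_one
  -- For n > 0 the exponent −n at ρ = 0 is negative; for n < −2N the exponent n + 2N at ρ = 2 is.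
  rcases hn with hn | hn
  · have hxy (ρ : ℝ) (hρ : ρ ∈ Ioo 0 a) : ρ ∈ Ioo (0 : ℝ) 2 ∧ 0 + 1 * ρ < a :=
      ⟨⟨hρ.1, by linarith [hρ.2]⟩, by linarith [hρ.2]⟩
    have hmid : a / 2 ∈ Ioo 0 a := ⟨by linarith, by linarith⟩
    refine hA.radial_eq_zero hode (hxy _ hmid).1 (hA.pole_zero.eq_zero_of_bounded ha (e := -n)
      (by push_cast; ring) (by omega) hxy (fun s hs => ⟨s, hs, by ring⟩) hode
      (fun ρ hρ => hB ρ (hxy ρ hρ).1) hmid) hρ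
  · have hxy (ρ : ℝ) (hρ : ρ ∈ Ioo (2 - a) 2) : ρ ∈ Ioo (0 : ℝ) 2 ∧ 2 + -1 * ρ < a :=
      ⟨⟨by linarith [hρ.1], hρ.2⟩, by linarith [hρ.1]⟩
    have hmid : 2 - a / 2 ∈ Ioo (2 - a) 2 := ⟨by linarith, by linarith⟩
    refine hA.radial_eq_zero hode (hxy _ hmid).1 (hA.pole_two.eq_zero_of_bounded ha
      (e := n + 2 * N) (by push_cast; ring) (by omega) hxy
      (fun s hs => ⟨2 - s, ⟨by linarith [hs.2], by linarith [hs.1]⟩, by ring⟩) hode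
      (fun ρ hρ => hB ρ (hxy ρ hρ).1) hmid) hρ

/-! ### Smooth extension of explicit sections -/

/-- Away from the origin ‖z‖ is smooth; near it the function depends only on ‖z‖², which is smooth
everywhere. -/
theorem exists_radial_extension {H : ℝ → ℝ} {C : ℝ} (ha : 0 < a)
    (hH : ContDiffOn ℝ ∞ H (Ioo 0 2))
    (h0 : ∀ s ∈ Ioo (0 : ℝ) 2, s < a → H s = C * Real.exp (-(r * s ^ 2 / 4))) :
    ∃ R : ℂ → ℂ, ContDiffOn ℝ ∞ R (Metric.ball 0 2) ∧
      ∀ z : ℂ, ‖z‖ ∈ Ioo (0 : ℝ) 2 → R z = H ‖z‖ := by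
  set R₀ : ℂ → ℝ := fun z => if ‖z‖ < a then C * Real.exp (-(r * ‖z‖ ^ 2 / 4)) else H ‖z‖ with hR
  have hex (z : ℂ) (hz : ‖z‖ ∈ Ioo (0 : ℝ) 2) : R₀ z = H ‖z‖ := by
    simp only [hR]
    split_ifs with hlt
    · exact (h0 _ hz hlt).symm
    · rfl
  have hsm : ContDiffOn ℝ ∞ R₀ (Metric.ball 0 2) := by
    intro z hz
    refine ContDiffAt.contDiffWithinAt ?_
    by_cases hlt : ‖z‖ < a
    · have h1 : ContDiff ℝ ∞ fun z : ℂ => C * Real.exp (-(r * ‖z‖ ^ 2 / 4)) :=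
        contDiff_const.mul
          (((contDiff_const.mul (contDiff_norm_sq ℝ)).div_const 4).neg.exp)
      refine h1.contDiffAt.congr_of_eventuallyEq ?_
      filter_upwards [(isOpen_lt continuous_norm continuous_const).mem_nhds hlt] with w hw
      exact if_pos hw
    · have hz0 : 0 < ‖z‖ := ha.trans_le (not_lt.1 hlt)
      have hz2 : ‖z‖ ∈ Ioo (0 : ℝ) 2 := ⟨hz0, mem_ball_zero_iff.1 hz⟩
      have h1 : ContDiffAt ℝ ∞ (fun w : ℂ => H ‖w‖) z :=
        (hH.contDiffAt (isOpen_Ioo.mem_nhds hz2)).comp z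
          (contDiffAt_norm ℝ (norm_pos_iff.1 hz0))
      refine h1.congr_of_eventuallyEq ?_
      filter_upwards [(isOpen_Ioo.preimage continuous_norm).mem_nhds hz2] with w hw
      exact hex w hw
  exact ⟨fun z => (R₀ z : ℂ), Complex.ofRealCLM.contDiff.comp_contDiffOn hsm,
    fun z hz => congrArg _ (hex z hz)⟩

theorem expI_pow (t : ℝ) (e : ℕ) : expI 1 t ^ e = expI e t := by
  unfold expI
  rw [← Complex.exp_nat_mul]
  push_cast
  ring_nf

theorem conj_expI_pow (t : ℝ) (e : ℕ) : (starRingEnd ℂ) (expI 1 t) ^ e = expI (-e) t := by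
  unfold expI
  rw [← Complex.exp_conj, ← Complex.exp_nat_mul]
  simp
  ring_nf

/-- `e^{± i e t} G` extends smoothly across the pole when `G` has the exponent `e ≥ 0`. -/
theorem IsPole.exists_extension (hP : IsPole r g h c κ a m) (ha : 0 < a) (hc : c + κ * c = 0)
    {e : ℕ} (he : ((e : ℤ) : ℝ) = -κ * (n + m)) {G : ℝ → ℝ} {x y : ℝ}
    (hxy : ∀ ρ ∈ Ioo x y, ρ ∈ Ioo (0 : ℝ) 2 ∧ c + κ * ρ < a)
    (hxy' : ∀ ρ ∈ Ioo (0 : ℝ) 2, c + κ * ρ < a → ρ ∈ Ioo x y)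
    (hG : ∀ ρ ∈ Ioo (0 : ℝ) 2, HasDerivAt G (-(radialCoeff r lam g h n ρ) * G ρ) ρ)
    (hGs : ContDiffOn ℝ ∞ G (Ioo 0 2)) :
    ∃ F : ℂ → ℂ, ContDiffOn ℝ ∞ F (Metric.ball 0 2) ∧
      ∀ ρ ∈ Ioo (0 : ℝ) 2, ∀ t : ℝ,
        F (((c + κ * ρ : ℝ) : ℂ) * expI 1 t) = expI (n + m) t * G ρ := by
  have hκ := hP.sq_eq_one
  obtain ⟨C, hC⟩ := hP.eq_const_mul_model he hxy (A := fun ρ => (G ρ : ℂ)) (lam := lam)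
    fun ρ hρ => (hG ρ hρ).ofReal_comp.congr_deriv (by push_cast; ring)
  -- The change of variable s = c + κρ is an involution, so ρ = c + κs.
  have hinv (s : ℝ) : c + κ * (c + κ * s) = s := by linear_combination hc + s * hκ
  have hmem (s : ℝ) (hs : s ∈ Ioo (0 : ℝ) 2) : c + κ * s ∈ Ioo (0 : ℝ) 2 := hP.coord s hs
  -- Dividing by s^e leaves the Gaussian factor, smooth in z. The constant C comes from a complex
  -- equation; since G is real, its real part suffices.
  obtain ⟨R, hR, hRe⟩ := exists_radial_extension (r := r) (a := a) (C := C.re)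
    (H := fun s => G (c + κ * s) / s ^ e) ha
    ((hGs.comp (contDiff_const.add (contDiff_const.mul contDiff_id)).contDiffOn hmem).div
      (contDiff_id.pow e).contDiffOn fun s hs => (pow_pos hs.1 e).ne')
    (fun s hs hlt => by
      have h1 := hC (c + κ * s) (hxy' _ (hmem s hs) (by rw [hinv]; exact hlt))
      rw [hinv] at h1
      have h2 := congrArg Complex.re h1
      rw [Complex.ofReal_re, Complex.re_mul_ofReal, zpow_natCast] at h2
      have := (pow_pos hs.1 e).ne'
      rw [h2]
      field_simp)
  have hRv (ρ : ℝ) (hρ : ρ ∈ Ioo (0 : ℝ) 2) (t : ℝ) :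
      R (((c + κ * ρ : ℝ) : ℂ) * expI 1 t) * ((c + κ * ρ : ℝ) : ℂ) ^ e = G ρ := by
    have hs := hP.coord ρ hρ
    have hsC : ((c + κ * ρ : ℝ) : ℂ) ≠ 0 := by exact_mod_cast hs.1.ne'
    rw [hRe _ (by rwa [norm_pole_coord hP.coord hρ]), norm_pole_coord hP.coord hρ, hinv]
    push_cast at hsC ⊢
    field_simp
  -- The factor s^e recombines with the angular factor to the conjugate power z̄^e at ρ = 0 and to
  -- z^e at ρ = 2, both smooth since e is a natural number.
  rcases (abs_eq zero_le_one).1 hP.abs_eq_one with h1 | h1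
  · have hne : n + m = -(e : ℤ) := by
      have : ((n + m : ℤ) : ℝ) = ((-(e : ℤ) : ℤ) : ℝ) := by
        push_cast at he ⊢
        rw [he, h1]
        ring
      exact_mod_cast this
    refine ⟨fun z => R z * (starRingEnd ℂ z) ^ e,
      hR.mul (Complex.conjCLE.contDiff.pow e).contDiffOn, fun ρ hρ t => ?_⟩
    simp only [map_mul, Complex.conj_ofReal]
    rw [mul_pow, ← mul_assoc, hRv ρ hρ t, conj_expI_pow, hne, mul_comm]
  · have hne : n + m = (e : ℤ) := by
      have : ((n + m : ℤ) : ℝ) = ((e : ℤ) : ℝ) := by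
        push_cast at he ⊢
        rw [he, h1]
        ring
      exact_mod_cast this
    refine ⟨fun z => R z * z ^ e, hR.mul (contDiff_id.pow e).contDiffOn, fun ρ hρ t => ?_⟩
    simp only
    rw [mul_pow, ← mul_assoc, hRv ρ hρ t, expI_pow, hne, mul_comm]

end

/-! ### Fourier modes of the kernel and its dimension -/

section

variable {V r a lam : ℝ} {n N k : ℤ} {g h : ℝ → ℝ} {s : ℝ × ℝ → ℂ}

/-- The pullback to `S² × S¹` of a function on `S²`. -/
def pullback (s : ℝ × ℝ → ℂ) (p : ℝ × ℝ × ℝ) : ℂ := s (p.1, p.2.1)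

theorem extendsAt_pullback {c κ : ℝ} {m : ℤ} {F : ℂ → ℂ} (hF : ContDiffOn ℝ ∞ F (Metric.ball 0 2))
    (hFs : ∀ ρ ∈ Ioo (0 : ℝ) 2, ∀ t : ℝ,
      F (((c + κ * ρ : ℝ) : ℂ) * expI 1 t) = expI m t * s (ρ, t)) :
    ExtendsAt c κ m (pullback s) :=
  ⟨fun z => F z.1, hF.comp contDiffOn_fst fun _ hz => hz.1, fun ρ hρ t _ => hFs ρ hρ t⟩

theorem extendsAt_zero_of_mem (hs : s ∈ lineSections N) : ExtendsAt 0 1 0 (pullback s) := by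
  obtain ⟨-, ⟨F, hF, hF'⟩, -⟩ := hs
  refine extendsAt_pullback hF fun ρ hρ t => ?_
  have := hF' ρ hρ t
  simpa [expI] using this

theorem extendsAt_two_of_mem (hs : s ∈ lineSections N) :
    ExtendsAt 2 (-1) (2 * N) (pullback s) := by
  obtain ⟨-, -, ⟨F, hF, hF'⟩⟩ := hs
  refine extendsAt_pullback hF fun ρ hρ t => ?_
  have := hF' ρ hρ t
  simpa [← sub_eq_add_neg] using this

theorem smoothPeriodic_pullback (hs : s ∈ lineSections N) : SmoothPeriodic (pullback s) :=
  (extendsAt_zero_of_mem hs).smoothPeriodic coord_zero (fun p hp => hs.1 (p.1, p.2.1) hp)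
    fun _ _ _ => rfl

theorem fderiv_pullback (hs : s ∈ lineSections N) {p : ℝ × ℝ × ℝ} (hp : p ∈ polarDomain)
    (w : ℝ × ℝ × ℝ) :
    fderiv ℝ (pullback s) p w = fderiv ℝ s (p.1, p.2.1) (w.1, w.2.1) := by
  have h1 := (differentiableAt_of_mem_line hs (q := (p.1, p.2.1)) (mem_polarDomain.1 hp)).hasFDerivAt
  have h2 : HasFDerivAt (fun p : ℝ × ℝ × ℝ => (p.1, p.2.1)) _ p :=
    ((ContinuousLinearMap.fst ℝ ℝ (ℝ × ℝ)).prod ((ContinuousLinearMap.fst ℝ ℝ ℝ).comp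
      (ContinuousLinearMap.snd ℝ ℝ (ℝ × ℝ)))).hasFDerivAt
  have h3 : HasFDerivAt (pullback s) _ p := h1.comp p h2
  rw [h3.fderiv]
  rfl

/-- Up to 1/√2 this is `opB` with T replaced by its eigenvalue r/2 − k/V on e^{ikθ}. -/
theorem dbar_eq (s : ℝ × ℝ → ℂ) (q : ℝ × ℝ) :
    dbar V r g h k s q = 1 / (Real.sqrt 2 : ℂ) * (fderiv ℝ s q (1, 0)
      - (1 / deriv h q.1 : ℝ) * (Complex.I * fderiv ℝ s q (0, 1)
        - (r * h q.1 + (r / 2 - k / V) * g q.1 : ℝ) * s q)) := by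
  have h1 : fderiv ℝ s q (0, -(1 / deriv h q.1))
      = (-(1 / deriv h q.1) : ℝ) • fderiv ℝ s q (0, 1) := by
    rw [← map_smul]
    simp
  rw [dbar, nablaS2, nablaS2, h1]
  simp only [Complex.real_smul]
  push_cast
  linear_combination (-(1 / (Real.sqrt 2 : ℂ)) * (1 / (deriv h q.1 : ℝ))
    * (r * h q.1 + (r / 2 - k / V) * g q.1) * s q) * Complex.I_sq

theorem dbar_eq_zero_iff {q : ℝ × ℝ} :
    dbar V r g h k s q = 0 ↔ fderiv ℝ s q (1, 0) = (1 / deriv h q.1 : ℝ) *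
      (Complex.I * fderiv ℝ s q (0, 1)
        - (r * h q.1 + (r / 2 - k / V) * g q.1 : ℝ) * s q) := by
  rw [dbar_eq, mul_eq_zero, sub_eq_zero]
  simp

theorem hasDerivAt_torusCoeff_ker (hs : s ∈ kerDbar V r g h k) (n : ℤ) {ρ : ℝ}
    (hρ : ρ ∈ Ioo (0 : ℝ) 2) :
    HasDerivAt (torusCoeff (pullback s) n)
      (-(radialCoeff r (r / 2 - k / V) g h n ρ : ℝ) * torusCoeff (pullback s) n ρ) ρ := by
  refine hasDerivAt_torusCoeff (smoothPeriodic_pullback hs.1)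
    (φ := fun ρ => r * h ρ + (r / 2 - k / V) * g ρ) (f := deriv h) (fun p hp => ?_) n hρ
  rw [dRho, dT, fderiv_pullback hs.1 hp, fderiv_pullback hs.1 hp]
  exact dbar_eq_zero_iff.1 (hs.2 (p.1, p.2.1) (mem_polarDomain.1 hp))

theorem exists_norm_torusCoeff_le (ha : 0 < a) (ha1 : a < 1) (hs : s ∈ lineSections N) (n : ℤ) :
    ∃ B : ℝ, ∀ ρ ∈ Ioo (0 : ℝ) 2, ‖torusCoeff (pullback s) n ρ‖ ≤ B := by
  have hu := smoothPeriodic_pullback hs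
  obtain ⟨C, hC⟩ := exists_norm_le_of_poles ha hu
    (SmoothPeriodic.exists_norm_le coord_zero (by simp) ha1 (extendsAt_zero_of_mem hs) hu)
    (SmoothPeriodic.exists_norm_le coord_two (by simp) ha1 (extendsAt_two_of_mem hs) hu)
  refine ⟨C * volume.real torusBox, fun ρ hρ => ?_⟩
  refine norm_setIntegral_le_of_norm_le_const volume_torusBox_lt_top fun q hq => ?_
  rw [norm_mul, norm_expI, mul_one]
  exact hC ρ hρ q hq

/-- The Fourier coefficients at `ρ = 1`. -/
noncomputable def coeffMap (V r : ℝ) (g h : ℝ → ℝ) (k : ℤ) (M : ℕ) :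
    kerDbar V r g h k →ₗ[ℂ] (Fin (2 * M + 1) → ℂ) where
  toFun s j := torusCoeff (pullback s) (-(j : ℕ)) 1
  map_add' s s' := by
    ext j
    have h1 := (smoothPeriodic_pullback s.2.1).mul (smoothPeriodic_expI (-(-((j : ℕ) : ℤ))))
    have h2 := (smoothPeriodic_pullback s'.2.1).mul (smoothPeriodic_expI (-(-((j : ℕ) : ℤ))))
    have h3 := SmoothPeriodic.slice_add h1 h2 (ρ := 1) (by norm_num)
    simp only [torusCoeff, Pi.add_apply]
    rw [← h3]
    refine slice_congr fun q => ?_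
    simp [pullback, add_mul]
  map_smul' c s := by
    ext j
    simp only [torusCoeff, Pi.smul_apply, RingHom.id_apply, smul_eq_mul]
    rw [← slice_mul_left]
    refine slice_congr fun q => ?_
    simp [pullback, mul_assoc]

/-- Modes outside −2[r] ≤ n ≤ 0 vanish by boundedness at a pole, those inside because their value at
ρ = 1 is zero. Then every Fourier coefficient on every circle is zero. -/
theorem coeffMap_injective (hA : IsAdmissible r ⌊r⌋ a g h) {M : ℕ} (hM : ⌊r⌋ = M) :
    Function.Injective (coeffMap V r g h k M) := by
  rw [injective_iff_map_eq_zero]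
  rintro ⟨s, hs⟩ h0
  have hz (n : ℤ) (ρ : ℝ) (hρ : ρ ∈ Ioo (0 : ℝ) 2) : torusCoeff (pullback s) n ρ = 0 := by
    have hode (ρ : ℝ) (hρ : ρ ∈ Ioo (0 : ℝ) 2) := hasDerivAt_torusCoeff_ker hs n hρ
    by_cases hn : 0 < n ∨ n < -(2 * ⌊r⌋)
    · obtain ⟨B, hB⟩ := exists_norm_torusCoeff_le hA.a_pos hA.pole_zero.lt_one hs.1 n
      exact hA.radial_eq_zero_of_bounded hode hB hn hρ
    · push Not at hn
      refine hA.radial_eq_zero hode (ρ₀ := 1) (by norm_num) ?_ hρ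
      have h1 := congrFun h0 ⟨(-n).toNat, by omega⟩
      have h2 : -(((-n).toNat : ℕ) : ℤ) = n := by omega
      change torusCoeff (pullback s) (-(((-n).toNat : ℕ) : ℤ)) 1 = 0 at h1
      rwa [h2] at h1
  refine Subtype.ext (funext fun q => ?_)
  change s q = 0
  obtain ⟨ρ, t⟩ := q
  by_cases hρ : ρ ∈ Ioo (0 : ℝ) 2
  swap
  · exact hs.1.1 (ρ, t) hρ
  have hu := smoothPeriodic_pullback hs.1
  have hcont : Continuous fun t => s (ρ, t) :=
    (hu.continuous_slice hρ).comp (Continuous.prodMk_left (0 : ℝ))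
  refine congrFun (eq_zero_of_fourier hcont (fun t => hu.per_t ρ t 0) fun n => ?_) t
  have h1 := hz n ρ hρ
  -- A pullback does not depend on θ, so the torus coefficient is 2π times the circle coefficient.
  rw [torusCoeff, slice_eq_iterated (hu.mul (smoothPeriodic_expI (-n))) hρ] at h1
  simp only [pullback, integral_const] at h1
  rw [integral_smul] at h1
  refine (smul_eq_zero.1 h1).resolve_left ?_
  simp [Real.pi_pos.le, Real.pi_ne_zero]

/-- The explicit section with one Fourier mode. -/
noncomputable def modeSection (n : ℤ) (G : ℝ → ℝ) (q : ℝ × ℝ) : ℂ :=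
  open scoped Classical in
  if q.1 ∈ Ioo (0 : ℝ) 2 then expI n q.2 * G q.1 else 0

/-- The two inequalities on n say that the exponents −n at ρ = 0 and n + 2[r] at ρ = 2 are
nonnegative, so the mode extends smoothly over both poles. -/
theorem modeSection_mem (hA : IsAdmissible r ⌊r⌋ a g h) (hn : n ≤ 0) (hn' : -(2 * ⌊r⌋) ≤ n)
    {G : ℝ → ℝ}
    (hG : ∀ ρ ∈ Ioo (0 : ℝ) 2,
      HasDerivAt G (-(radialCoeff r (r / 2 - k / V) g h n ρ) * G ρ) ρ)
    (hGs : ContDiffOn ℝ ∞ G (Ioo 0 2)) : modeSection n G ∈ kerDbar V r g h k := by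
  have ha := hA.a_pos
  have ha1 := hA.pole_zero.lt_one
  have hv (ρ : ℝ) (hρ : ρ ∈ Ioo (0 : ℝ) 2) (t : ℝ) : modeSection n G (ρ, t) = expI n t * G ρ :=
    if_pos hρ
  refine ⟨⟨fun q hq => if_neg hq, ?_, ?_⟩, fun q hq => ?_⟩
  · obtain ⟨F, hF, hFv⟩ := hA.pole_zero.exists_extension (n := n) ha (by ring)
      (e := (-n).toNat)
      (by rw [Int.toNat_of_nonneg (by omega)]; push_cast; ring) (x := 0) (y := a)
      (fun ρ hρ => ⟨⟨hρ.1, by linarith [hρ.2]⟩, by linarith [hρ.2]⟩)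
      (fun ρ hρ hlt => ⟨hρ.1, by linarith⟩) hG hGs
    refine ⟨F, hF, fun ρ hρ t => ?_⟩
    have := hFv ρ hρ t
    rw [hv ρ hρ]
    simpa using this
  · obtain ⟨F, hF, hFv⟩ := hA.pole_two.exists_extension (n := n) ha (by ring)
      (e := (n + 2 * ⌊r⌋).toNat)
      (by rw [Int.toNat_of_nonneg (by omega)]; push_cast; ring) (x := 2 - a) (y := 2)
      (fun ρ hρ => ⟨⟨by linarith [hρ.1], hρ.2⟩, by linarith [hρ.1]⟩)
      (fun ρ hρ hlt => ⟨by linarith, hρ.2⟩) hG hGs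
    refine ⟨F, hF, fun ρ hρ t => ?_⟩
    have := hFv ρ hρ t
    rw [hv ρ hρ, ← mul_assoc, ← expI_add, add_comm (2 * ⌊r⌋)]
    simpa [← sub_eq_add_neg] using this
  · obtain ⟨ρ, t⟩ := q
    rw [dbar_eq_zero_iff]
    have e : modeSection n G =ᶠ[𝓝 (ρ, t)] fun q => expI n q.2 * (G q.1 : ℂ) := by
      filter_upwards [(isOpen_Ioo.preimage continuous_fst).mem_nhds hq] with q hq
      exact hv q.1 hq q.2
    have h1 : HasFDerivAt (fun q : ℝ × ℝ => expI n q.2) _ (ρ, t) :=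
      HasFDerivAt.comp (g := expI n) (ρ, t) (hasDerivAt_expI n t).hasFDerivAt hasFDerivAt_snd
    have h2 : HasFDerivAt (fun q : ℝ × ℝ => (G q.1 : ℂ)) _ (ρ, t) :=
      HasFDerivAt.comp (g := fun x => (G x : ℂ)) (ρ, t) (hG ρ hq).ofReal_comp.hasFDerivAt
        hasFDerivAt_fst
    have h3 : HasFDerivAt (fun q : ℝ × ℝ => expI n q.2 * (G q.1 : ℂ)) _ (ρ, t) := h1.mul h2
    rw [e.fderiv_eq, h3.fderiv, hv ρ hq]
    simp [radialCoeff]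
    linear_combination (-(n : ℂ) * expI n t * G ρ / ((deriv h ρ : ℝ) : ℂ)) * Complex.I_sq

/-- By orthogonality of the exponentials, a section with the single mode −j has only its j-th
coefficient nonzero. -/
theorem coeffMap_surjective (hA : IsAdmissible r ⌊r⌋ a g h) {M : ℕ} (hM : ⌊r⌋ = M) :
    Function.Surjective (coeffMap V r g h k M) := by
  have hex (j : Fin (2 * M + 1)) : ∃ s : kerDbar V r g h k, ∃ c : ℂ, c ≠ 0 ∧
      coeffMap V r g h k M s = Pi.single j c := by
    obtain ⟨G, hG0, hG, hGs⟩ := exists_radial_solution (contDiffOn_radialCoeff (r := r)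
      (lam := r / 2 - k / V) (n := -(j : ℕ)) hA.g_smooth hA.h_smooth hA.deriv_pos)
    have hj := j.2
    refine ⟨⟨modeSection (-(j : ℕ)) G, modeSection_mem hA (by omega) (by omega) hG hGs⟩,
      -- The coefficients are unnormalized integrals over both angles, hence (2π)².
      G 1 * ((2 * Real.pi) ^ 2 : ℝ), ?_, ?_⟩
    · exact_mod_cast mul_ne_zero (hG0 1).ne' (pow_ne_zero 2 Real.two_pi_pos.ne')
    · ext i
      have h1 : (coeffMap V r g h k M ⟨modeSection (-(j : ℕ)) G,
          modeSection_mem hA (by omega) (by omega) hG hGs⟩) i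
          = G 1 * slice (fun p : ℝ × ℝ × ℝ => expI ((i : ℕ) - (j : ℕ)) p.2.1) 1 := by
        rw [← slice_mul_left]
        change slice (fun p => pullback (modeSection (-(j : ℕ)) G) p *
          expI (-(-((i : ℕ) : ℤ))) p.2.1) 1 = _
        refine slice_congr fun q => ?_
        have h2 : modeSection (-(j : ℕ)) G (1, q.1) = expI (-(j : ℕ)) q.1 * G 1 :=
          if_pos (by norm_num)
        simp only [pullback, neg_neg]
        rw [h2, sub_eq_add_neg, expI_add]
        ring
      rw [h1]
      by_cases hij : i = j
      · subst hij
        rw [sub_self, slice_expI_zero, Pi.single_eq_same]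
      · have h3 : ((i : ℕ) : ℤ) - (j : ℕ) ≠ 0 := by
          intro h4
          exact hij (Fin.ext (by omega))
        rw [slice_expI h3 (by norm_num), mul_zero, Pi.single_eq_of_ne hij]
  choose S c hc hS using hex
  intro v
  refine ⟨∑ j, (v j / c j) • S j, ?_⟩
  rw [map_sum]
  simp only [map_smul, hS]
  ext i
  rw [Finset.sum_apply, Finset.sum_eq_single i]
  · simp [div_mul_cancel₀ _ (hc i)]
  · intro j _ hji
    simp [Pi.single_eq_of_ne (Ne.symm hji)]
  · simp

theorem finrank_kerDbar (hA : IsAdmissible r ⌊r⌋ a g h) {M : ℕ} (hM : ⌊r⌋ = M) :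
    Module.finrank ℂ (kerDbar V r g h k) = 2 * M + 1 := by
  rw [(LinearEquiv.ofBijective (coeffMap V r g h k M)
    ⟨coeffMap_injective hA hM, coeffMap_surjective hA hM⟩).finrank_eq]
  simp

end

/-! ### From holomorphic sections to eigenspinors -/

section

variable {V r a μ : ℝ} {N k : ℤ} {g h : ℝ → ℝ} {s : ℝ × ℝ → ℂ} {p : ℝ × ℝ × ℝ}

theorem IsAdmissible.dirac_sub_smul (hA : IsAdmissible r N a g h) (hV : V ≠ 0)
    {ψ : ℝ × ℝ × ℝ → Fin 2 → ℂ} (hψ : ψ ∈ spinorSections N) (hp : p ∈ polarDomain) :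
    dirac V r g h ψ p - (μ : ℂ) • ψ p =
      ![resFst V r g h μ (fun x => ψ x 0) (fun x => ψ x 1) p,
        resSnd V r g h μ (fun x => ψ x 0) (fun x => ψ x 1) p] := by
  have hρ := mem_polarDomain.1 hp
  rw [dirac_apply hV ((contDiff_deriv hA.h_smooth).differentiable (by simp) _)
    (hA.g_smooth.differentiable (by simp) _) (hA.deriv_pos _ hρ).ne'
    (differentiableAt_of_mem hψ hρ), resFst, resSnd, opT_shift]
  ext i
  fin_cases i <;> simp <;> ring

theorem IsAdmissible.mem_eigenspace_iff (hA : IsAdmissible r ⌊r⌋ a g h) (hV : V ≠ 0)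
    {ψ : ℝ × ℝ × ℝ → Fin 2 → ℂ} (hψ : ψ ∈ spinorSections ⌊r⌋) :
    ψ ∈ eigenspace V r g h μ ↔ ∀ p ∈ polarDomain,
      resFst V r g h μ (fun x => ψ x 0) (fun x => ψ x 1) p = 0 ∧
        resSnd V r g h μ (fun x => ψ x 0) (fun x => ψ x 1) p = 0 := by
  have e (p : ℝ × ℝ × ℝ) (hp : p ∈ polarDomain) :
      dirac V r g h ψ p = (μ : ℂ) • ψ p ↔
        resFst V r g h μ (fun x => ψ x 0) (fun x => ψ x 1) p = 0 ∧
          resSnd V r g h μ (fun x => ψ x 0) (fun x => ψ x 1) p = 0 := by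
    rw [← sub_eq_zero, hA.dirac_sub_smul hV hψ hp]
    constructor
    · intro h0
      exact ⟨congrFun h0 0, congrFun h0 1⟩
    · rintro ⟨h1, h2⟩
      rw [h1, h2]
      ext i
      fin_cases i <;> rfl
  exact ⟨fun h0 p hp => (e p hp).1 (h0.2 p (mem_polarDomain.1 hp)),
    fun h0 => ⟨hψ, fun p hp => (e p (mem_polarDomain.2 hp)).2 (h0 p (mem_polarDomain.2 hp))⟩⟩

/-- The function `e^{ikθ} s` on `S² × S¹`. -/
noncomputable def thetaLift (k : ℤ) (s : ℝ × ℝ → ℂ) (p : ℝ × ℝ × ℝ) : ℂ :=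
  expI k p.2.2 * pullback s p

theorem lift_mem (k : ℤ) (hs : s ∈ lineSections N) :
    (fun p => ![thetaLift k s p, 0]) ∈ spinorSections N := by
  obtain ⟨h0, ⟨F, hF, hF'⟩, ⟨G, hG, hG'⟩⟩ := hs
  have ext_smooth {F : ℂ → ℂ} (hF : ContDiffOn ℝ ∞ F (Metric.ball 0 2)) :
      ContDiffOn ℝ ∞ (fun z : ℂ × ℝ => (![expI k z.2 * F z.1, 0] : Fin 2 → ℂ))
        (Metric.ball 0 2 ×ˢ univ) := by
    rw [contDiffOn_pi]
    intro i
    fin_cases i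
    · exact ((contDiff_expI k).comp contDiff_snd).contDiffOn.mul
        (hF.comp contDiffOn_fst fun z hz => hz.1)
    · exact contDiffOn_const
  refine ⟨fun p hp => ?_, fun ρ t θ => ?_, ⟨_, ext_smooth hF, fun ρ hρ t θ => ?_⟩,
    ⟨_, ext_smooth hG, fun ρ hρ t θ => ?_⟩⟩
  · simp only [thetaLift, pullback, h0 (p.1, p.2.1) hp, mul_zero]
    ext i
    fin_cases i <;> rfl
  · simp only [thetaLift, pullback, expI_add_two_pi]
  · simp [hF' ρ hρ t, thetaLift, pullback]
  · simp only [hG' ρ hρ t, thetaLift, pullback]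
    ext i
    fin_cases i
    · simp [mul_left_comm]
    · simp

theorem fderiv_lift (k : ℤ) (hs : s ∈ lineSections N) (hp : p ∈ polarDomain)
    (w : ℝ × ℝ × ℝ) :
    fderiv ℝ (thetaLift k s) p w = expI k p.2.2 * fderiv ℝ s (p.1, p.2.1) (w.1, w.2.1)
      + w.2.2 * (Complex.I * k * thetaLift k s p) := by
  have h1 : HasFDerivAt (fun p : ℝ × ℝ × ℝ => expI k p.2.2) _ p :=
    HasFDerivAt.comp (g := expI k) p (hasDerivAt_expI k p.2.2).hasFDerivAt
      ((ContinuousLinearMap.snd ℝ ℝ ℝ).comp (ContinuousLinearMap.snd ℝ ℝ (ℝ × ℝ))).hasFDerivAt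
  have h2 : HasFDerivAt (thetaLift k s) _ p :=
    h1.mul ((smoothPeriodic_pullback hs).differentiableAt hp).hasFDerivAt
  rw [h2.fderiv, ← fderiv_pullback hs hp]
  simp [thetaLift]
  ring

theorem opT_lift (hs : s ∈ lineSections N) (hp : p ∈ polarDomain) :
    opT V r (thetaLift k s) p = (r / 2 - k / V : ℝ) * thetaLift k s p := by
  rw [opT, dTheta, fderiv_lift k hs hp]
  have h0 : fderiv ℝ s (p.1, p.2.1) (0, 0) = 0 := map_zero _
  simp only [h0]
  push_cast
  linear_combination ((k : ℂ) / V * thetaLift k s p) * Complex.I_sq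

/-- On e^{ikθ}s the operator T is the scalar r/2 − k/V, which reduces B to the Cauchy–Riemann
operator on S². -/
theorem opB_lift (hs : s ∈ lineSections N) (hp : p ∈ polarDomain) :
    opB V r g h (thetaLift k s) p = expI k p.2.2 * (fderiv ℝ s (p.1, p.2.1) (1, 0)
      - (1 / deriv h p.1 : ℝ) * (Complex.I * fderiv ℝ s (p.1, p.2.1) (0, 1)
        - (r * h p.1 + (r / 2 - k / V) * g p.1 : ℝ) * s (p.1, p.2.1))) := by
  rw [opB, opS, opT_lift hs hp, dRho, dT, fderiv_lift k hs hp, fderiv_lift k hs hp, thetaLift, pullback]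
  push_cast
  ring

theorem opB_lift_eq_zero_iff (hs : s ∈ lineSections N) (hp : p ∈ polarDomain) :
    opB V r g h (thetaLift k s) p = 0 ↔ dbar V r g h k s (p.1, p.2.1) = 0 := by
  rw [opB_lift hs hp, dbar_eq_zero_iff, mul_eq_zero, sub_eq_zero]
  simp [expI_ne_zero]

theorem opT_zero_fun (p : ℝ × ℝ × ℝ) : opT V r (fun _ => 0) p = 0 := by
  simp [opT, dTheta]

theorem opBadj_zero_fun (p : ℝ × ℝ × ℝ) : opBadj V r g h (fun _ => 0) p = 0 := by
  simp [opBadj, opS, opT_zero_fun, dRho, dT]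

theorem IsAdmissible.lift_mem_eigenspace (hA : IsAdmissible r ⌊r⌋ a g h) (hV : V ≠ 0)
    (hs : s ∈ kerDbar V r g h k) :
    (fun p => ![thetaLift k s p, 0]) ∈ eigenspace V r g h (r / 2 - k / V) := by
  rw [hA.mem_eigenspace_iff hV (lift_mem k hs.1)]
  intro p hp
  change opT V _ (thetaLift k s) p + opBadj V r g h (fun _ => 0) p = 0 ∧
    opB V r g h (thetaLift k s) p - opT V r (fun _ => 0) p - _ * 0 + _ * 0 = 0
  rw [opT_shift, opT_lift hs.1 hp, opBadj_zero_fun, opT_zero_fun,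
    (opB_lift_eq_zero_iff hs.1 hp).2 (hs.2 _ (mem_polarDomain.1 hp))]
  simp

theorem SmoothPeriodic.eq_expI_mul {u : ℝ × ℝ × ℝ → ℂ} (hu : SmoothPeriodic u)
    (h0 : ∀ p ∈ polarDomain, DiracHat.dTheta u p = Complex.I * k * u p) {ρ : ℝ} (hρ : ρ ∈ Ioo (0 : ℝ) 2)
    (t θ : ℝ) : u (ρ, t, θ) = expI k θ * u (ρ, t, 0) := by
  have h1 (x : ℝ) : HasDerivAt (fun x => expI (-k) x * u (ρ, t, x)) 0 x := by
    refine ((hasDerivAt_expI (-k) x).mul (hu.hasDerivAt_theta hρ t x)).congr_deriv ?_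
    rw [h0 (ρ, t, x) (mem_polarDomain.2 hρ)]
    push_cast
    ring
  have h2 := is_const_of_deriv_eq_zero (fun x => (h1 x).differentiableAt)
    (fun x => (h1 x).deriv) θ 0
  have h3 : expI (-k) 0 = 1 := by simp [expI]
  rw [h3, one_mul] at h2
  rw [← h2, ← mul_assoc, expI_mul_neg, one_mul]

theorem restrict_mem {ψ : ℝ × ℝ × ℝ → Fin 2 → ℂ} (hψ : ψ ∈ spinorSections N) :
    (fun q : ℝ × ℝ => ψ (q.1, q.2, 0) 0) ∈ lineSections N := by
  obtain ⟨h0, -, ⟨F, hF, hF'⟩, ⟨G, hG, hG'⟩⟩ := hψ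
  have restrict_smooth {F : ℂ × ℝ → Fin 2 → ℂ}
      (hF : ContDiffOn ℝ ∞ F (Metric.ball 0 2 ×ˢ univ)) :
      ContDiffOn ℝ ∞ (fun z : ℂ => F (z, 0) 0) (Metric.ball 0 2) :=
    (contDiffOn_pi.1 hF 0).comp (contDiff_prodMk_left (0 : ℝ)).contDiffOn
      fun z hz => ⟨hz, trivial⟩
  refine ⟨fun q hq => congrFun (h0 (q.1, q.2, 0) hq) 0, ⟨_, restrict_smooth hF, fun ρ hρ t => ?_⟩,
    ⟨_, restrict_smooth hG, fun ρ hρ t => ?_⟩⟩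
  · rw [hF' ρ hρ t 0]
    rfl
  · rw [hG' ρ hρ t 0]
    rfl

/-- An eigenspinor with vanishing second component comes from a holomorphic section. -/
theorem IsAdmissible.exists_lift_eq (hA : IsAdmissible r ⌊r⌋ a g h) (hV : V ≠ 0)
    {ψ : ℝ × ℝ × ℝ → Fin 2 → ℂ} (hψ : ψ ∈ eigenspace V r g h (r / 2 - k / V))
    (hβ : ∀ p, ψ p 1 = 0) :
    ∃ s ∈ kerDbar V r g h k, (fun p => ![thetaLift k s p, 0]) = ψ := by
  have h0 := (hA.mem_eigenspace_iff hV hψ.1).1 hψ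
  have hβ' : (fun x => ψ x 1) = fun _ => 0 := funext hβ
  have hu := (isSpinorPair_of_mem hψ.1).smooth_fst
  have hs := restrict_mem hψ.1
  -- With β = 0 the first component of the equation is (T − μ)α = 0, which fixes the dependence on
  -- θ.
  have hθ (p : ℝ × ℝ × ℝ) (hp : p ∈ polarDomain) :
      dTheta (fun x => ψ x 0) p = Complex.I * k * ψ p 0 := by
    have h1 := (h0 p hp).1
    rw [resFst, hβ', opBadj_zero_fun, add_zero, opT] at h1
    have hV' : (V : ℂ) ≠ 0 := by exact_mod_cast hV
    push_cast at h1
    field_simp at h1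
    linear_combination (-Complex.I / 2) * h1 + dTheta (fun x => ψ x 0) p * Complex.I_sq
  have e : thetaLift k (fun q : ℝ × ℝ => ψ (q.1, q.2, 0) 0) = fun p => ψ p 0 := by
    ext ⟨ρ, t, θ⟩
    by_cases hρ : ρ ∈ Ioo (0 : ℝ) 2
    · exact (hu.eq_expI_mul hθ hρ t θ).symm
    · simp only [thetaLift, pullback]
      rw [hψ.1.1 (ρ, t, 0) hρ, hψ.1.1 (ρ, t, θ) hρ]
      simp
  refine ⟨_, ⟨hs, fun q hq => ?_⟩, ?_⟩
  · have hp : (q.1, q.2, (0 : ℝ)) ∈ polarDomain := mem_polarDomain.2 hq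
    refine (opB_lift_eq_zero_iff hs hp).1 ?_
    have h1 := (h0 _ hp).2
    rw [resSnd, hβ', opT_zero_fun] at h1
    rw [e]
    simpa [hβ] using h1
  · ext p i
    fin_cases i
    · exact congrFun e p
    · exact (hβ p).symm

/-- The linear map `s ↦ (e^{ikθ} s, 0)`. -/
noncomputable def liftMap (hA : IsAdmissible r ⌊r⌋ a g h) (hV : V ≠ 0) (k : ℤ) :
    kerDbar V r g h k →ₗ[ℂ] eigenspace V r g h (r / 2 - k / V) where
  toFun s := ⟨fun p => ![thetaLift k s p, 0], hA.lift_mem_eigenspace hV s.2⟩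
  map_add' s s' := by
    refine Subtype.ext (funext fun p => ?_)
    ext i
    fin_cases i <;> simp [thetaLift, pullback, mul_add]
  map_smul' c s := by
    refine Subtype.ext (funext fun p => ?_)
    ext i
    fin_cases i <;> simp [thetaLift, pullback, mul_left_comm]

theorem liftMap_injective (hA : IsAdmissible r ⌊r⌋ a g h) (hV : V ≠ 0) (k : ℤ) :
    Function.Injective (liftMap hA hV k) := by
  intro s s' hss
  refine Subtype.ext (funext fun q => ?_)
  have h1 := congrFun (congrFun (congrArg Subtype.val hss) (q.1, q.2, 0)) 0
  exact mul_left_cancel₀ (expI_ne_zero k 0) h1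

/-- The condition on `μ` and `r` which gives the Bochner inequality. -/
def BochnerBound (r μ : ℝ) (g h : ℝ → ℝ) : Prop :=
  ∀ ρ ∈ Ioo (0 : ℝ) 2, r / 12 ≤ r / 2 - μ ^ 2 + μ * (deriv g ρ / deriv h ρ) / 2
    - deriv (deriv (deriv h)) ρ / deriv h ρ / 2

/-- The Bochner inequality enters here: it removes the second component of an eigenspinor. -/
theorem liftMap_surjective (hA : IsAdmissible r ⌊r⌋ a g h) (hV : V ≠ 0) (hr : 0 < r)
    (hk : (r / 2 - k / V) ^ 2 ≤ r / 3) (hb : BochnerBound r (r / 2 - k / V) g h) :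
    Function.Surjective (liftMap hA hV k) := by
  rintro ⟨ψ, hψ⟩
  have h0 := (hA.mem_eigenspace_iff hV hψ.1).1 hψ
  obtain ⟨s, hs, e⟩ := hA.exists_lift_eq hV hψ fun p => by
    by_cases hp : p ∈ polarDomain
    · exact hA.snd_eq_zero (isSpinorPair_of_mem hψ.1) hr hk hb (fun p hp => (h0 p hp).1)
        (fun p hp => (h0 p hp).2) hp
    · rw [hψ.1.1 p fun hρ => hp (mem_polarDomain.2 hρ)]
      rfl
  exact ⟨⟨s, hs⟩, Subtype.ext e⟩

/-- The linear equivalence `s ↦ (e^{ikθ} s, 0)`. -/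
noncomputable def liftEquiv (hA : IsAdmissible r ⌊r⌋ a g h) (hV : V ≠ 0) (hr : 0 < r)
    (hk : (r / 2 - k / V) ^ 2 ≤ r / 3) (hb : BochnerBound r (r / 2 - k / V) g h) :
    kerDbar V r g h k ≃ₗ[ℂ] eigenspace V r g h (r / 2 - k / V) :=
  LinearEquiv.ofBijective (liftMap hA hV k)
    ⟨liftMap_injective hA hV k, liftMap_surjective hA hV hr hk hb⟩

/-! ## The spectrum -/

theorem sqNorm_smul (c : ℂ) (ψ : ℝ × ℝ × ℝ → Fin 2 → ℂ) :
    sqNorm V h (c • ψ) = ‖c‖ ^ 2 * sqNorm V h ψ := by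
  rw [sqNorm, sqNorm, ← integral_const_mul]
  refine integral_congr_ae (Eventually.of_forall fun p => ?_)
  simp only [Pi.smul_apply, smul_eq_mul, norm_mul]
  ring

theorem measurableSet_polarBox : MeasurableSet (Ioo (0 : ℝ) 2 ×ˢ torusBox) :=
  measurableSet_Ioo.prod measurableSet_torusBox

theorem IsAdmissible.sqNorm_sub_smul (hA : IsAdmissible r N a g h) (hV : V ≠ 0)
    {ψ : ℝ × ℝ × ℝ → Fin 2 → ℂ} (hψ : ψ ∈ spinorSections N) :
    sqNorm V h (fun p => dirac V r g h ψ p - (μ : ℂ) • ψ p) =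
      ∫ p in Ioo (0 : ℝ) 2 ×ˢ torusBox, (‖resFst V r g h μ (fun x => ψ x 0) (fun x => ψ x 1) p‖ ^ 2
        + ‖resSnd V r g h μ (fun x => ψ x 0) (fun x => ψ x 1) p‖ ^ 2) * (V * deriv h p.1) := by
  refine setIntegral_congr_fun measurableSet_polarBox fun p hp => ?_
  simp only [hA.dirac_sub_smul hV hψ (mem_polarDomain.2 hp.1)]
  rfl

theorem IsAdmissible.sqNorm_pos (hA : IsAdmissible r N a g h) (hV : 0 < V)
    {ψ : ℝ × ℝ × ℝ → Fin 2 → ℂ} (hψ : ψ ∈ spinorSections N)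
    (hne : ∀ ρ ∈ Ioo (0 : ℝ) 2, ψ (ρ, 0, 0) 0 ≠ 0) : 0 < sqNorm V h ψ := by
  have hs := isSpinorPair_of_mem hψ
  have p0 := hA.pole_zero
  have p2 := hA.pole_two
  obtain ⟨i1, e1⟩ := integral_polar_eq (V := V) hA.h_smooth hs.smooth_fst hs.smooth_snd
    (exists_norm_le_of_poles hA.a_pos hs.smooth_fst
      (SmoothPeriodic.exists_norm_le p0.coord p0.abs_eq_one p0.lt_one hs.fst_zero hs.smooth_fst)
      (SmoothPeriodic.exists_norm_le p2.coord p2.abs_eq_one p2.lt_one hs.fst_two hs.smooth_fst))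
    (exists_norm_le_of_poles hA.a_pos hs.smooth_snd
      (SmoothPeriodic.exists_norm_le p0.coord p0.abs_eq_one p0.lt_one hs.snd_zero hs.smooth_snd)
      (SmoothPeriodic.exists_norm_le p2.coord p2.abs_eq_one p2.lt_one hs.snd_two hs.smooth_snd))
  refine lt_of_lt_of_eq (mul_pos hV ?_) e1.symm
  have hpos (ρ : ℝ) (hρ : ρ ∈ Ioo (0 : ℝ) 2) : 0 < deriv h ρ * (slice (fun p => ‖ψ p 0‖ ^ 2) ρ
      + slice (fun p => ‖ψ p 1‖ ^ 2) ρ) := by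
    refine mul_pos (hA.deriv_pos ρ hρ) (add_pos_of_pos_of_nonneg ?_
      (slice_nonneg (fun p => sq_nonneg _) ρ))
    refine lt_of_le_of_ne (slice_nonneg (fun p => sq_nonneg _) ρ) fun h0 => hne ρ hρ ?_
    exact hs.smooth_fst.eq_zero_of_slice hρ h0.symm (0, 0)
  rw [setIntegral_pos_iff_support_of_nonneg_ae
    (ae_restrict_of_forall_mem measurableSet_Ioo fun ρ hρ => (hpos ρ hρ).le) i1]
  refine lt_of_lt_of_le ?_ (measure_mono (s := Ioo (0 : ℝ) 2) fun ρ hρ => ⟨(hpos ρ hρ).ne', hρ⟩)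
  simp

/-- The mode n = 0 lies in the kernel for every k because [r] ≥ 0. Its radial factor is nowhere
zero, so it can be normalized to an exact eigenspinor. -/
theorem IsAdmissible.mem_diracSpectrum (hA : IsAdmissible r ⌊r⌋ a g h) (hV : 0 < V) (hr : 0 < r)
    (k : ℤ) : r / 2 - k / V ∈ diracSpectrum V r g h := by
  obtain ⟨G, hG0, hG, hGs⟩ := exists_radial_solution (contDiffOn_radialCoeff (r := r)
    (lam := r / 2 - k / V) (n := 0) hA.g_smooth hA.h_smooth hA.deriv_pos)
  have hs : modeSection 0 G ∈ kerDbar V r g h k := modeSection_mem hA le_rfl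
    (by have := Int.floor_nonneg.2 hr.le; omega) hG hGs
  have hψ := hA.lift_mem_eigenspace hV.ne' hs
  have hpos := hA.sqNorm_pos hV hψ.1 fun ρ hρ => by
    change expI k 0 * modeSection 0 G (ρ, 0) ≠ 0
    rw [modeSection, if_pos hρ]
    exact mul_ne_zero (expI_ne_zero _ _) (mul_ne_zero (expI_ne_zero _ _)
      (by exact_mod_cast (hG0 ρ).ne'))
  set ψ : ℝ × ℝ × ℝ → Fin 2 → ℂ := fun p => ![thetaLift k (modeSection 0 G) p, 0]
  set c : ℂ := ((1 / Real.sqrt (sqNorm V h ψ) : ℝ) : ℂ)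
  have hcψ : c • ψ ∈ eigenspace V r g h (r / 2 - k / V) := Submodule.smul_mem _ c hψ
  refine fun ε hε => ⟨c • ψ, hcψ.1, ?_, ?_⟩
  · rw [sqNorm_smul, Complex.norm_real, Real.norm_eq_abs, sq_abs, div_pow, one_pow,
      Real.sq_sqrt hpos.le]
    exact one_div_mul_cancel hpos.ne'
  · refine lt_of_eq_of_lt ?_ hε
    rw [hA.sqNorm_sub_smul hV.ne' hcψ.1]
    have h0 := (hA.mem_eigenspace_iff hV.ne' hcψ.1).1 hcψ
    refine setIntegral_eq_zero_of_forall_eq_zero fun p hp => ?_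
    obtain ⟨h1, h2⟩ := h0 p (mem_polarDomain.2 hp.1)
    rw [h1, h2]
    simp

/-- Otherwise the resolvent estimate with constant C contradicts the existence of a unit approximate
eigenspinor with error below 1/C. -/
theorem IsAdmissible.exists_eq_of_mem_diracSpectrum (hA : IsAdmissible r ⌊r⌋ a g h) (hV : 0 < V)
    (hr : 0 < r) (hμ : μ ^ 2 ≤ r / 3) (hb : BochnerBound r μ g h)
    (hmem : μ ∈ diracSpectrum V r g h) : ∃ k : ℤ, μ = r / 2 - k / V := by
  by_contra! hne
  obtain ⟨C, hC, hle⟩ := hA.exists_integral_le hV hne hr hμ hb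
  obtain ⟨ψ, hψ, h1, h2⟩ := hmem (1 / C) (by positivity)
  have h3 := hle _ _ (isSpinorPair_of_mem hψ)
  rw [← hA.sqNorm_sub_smul hV.ne' hψ] at h3
  change sqNorm V h ψ ≤ _ at h3
  rw [h1] at h3
  rw [lt_div_iff₀ hC] at h2
  linarith

end

end DiracHat

theorem mainTheorem6 (δ V : ℝ) (hδ : 0 < δ) (hδ' : δ < 1 / 100) (hV : 0 < V)
    (g : ℝ → ℝ) (hg : DiracHat.IsProfileG δ g)
    (h : ℝ → ℝ → ℝ) (hh : DiracHat.IsProfileH δ h) :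
    ∃ c₂ : ℝ, 20 < c₂ ∧ ∀ r : ℝ, c₂ ≤ r →
      DiracHat.diracSpectrum V r g (h (⌊r⌋ / r)) ∩ Set.Icc (-Real.sqrt (r / 3)) (Real.sqrt (r / 3))
        = {lam : ℝ | ∃ k : ℤ, lam = r / 2 - k / V ∧ |r / 2 - k / V| ≤ Real.sqrt (r / 3)} ∧
      ∀ k : ℤ, |r / 2 - k / V| ≤ Real.sqrt (r / 3) →
        (Module.finrank ℂ (DiracHat.eigenspace V r g (h (⌊r⌋ / r)) (r / 2 - k / V)) : ℤ)
          = 2 * ⌊r⌋ + 1 ∧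
        ∃ e : DiracHat.kerDbar V r g (h (⌊r⌋ / r)) k ≃ₗ[ℂ]
            DiracHat.eigenspace V r g (h (⌊r⌋ / r)) (r / 2 - k / V),
          ∀ (α : DiracHat.kerDbar V r g (h (⌊r⌋ / r)) k) (ρ t θ : ℝ),
            (e α : ℝ × ℝ × ℝ → Fin 2 → ℂ) (ρ, t, θ) =
              ![1 / (Real.sqrt (2 * Real.pi) : ℂ) * Complex.exp (Complex.I * k * θ)
                  * (α : ℝ × ℝ → ℂ) (ρ, t), 0] := by
  obtain ⟨C, -, hC⟩ := DiracHat.exists_curvature_bound hg hh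
  -- The 21 only secures 20 < c₂. The other entry is the threshold of `curvature_estimate` for the
  -- bound C uniform in σ.
  refine ⟨max 21 (12 * (C ^ 2 + C)), lt_max_of_lt_left (by norm_num), fun r hr => ?_⟩
  have hr20 : 20 < r := by linarith [(le_max_left _ _).trans hr]
  have hr0 : 0 < r := by linarith
  have hσ := DiracHat.floor_div_mem hr20
  have hA := DiracHat.isAdmissible_of_profiles (r := r) (N := ⌊r⌋) hδ hδ' hg hh hσ
    (mul_div_cancel₀ _ hr0.ne')
  have hsq {μ : ℝ} (hμ : |μ| ≤ Real.sqrt (r / 3)) : μ ^ 2 ≤ r / 3 := by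
    rw [← sq_abs, ← Real.le_sqrt (abs_nonneg μ) (by positivity)]
    exact hμ
  have hb {μ : ℝ} (hμ : |μ| ≤ Real.sqrt (r / 3)) :
      DiracHat.BochnerBound r μ g (h (⌊r⌋ / r)) := fun ρ hρ =>
    DiracHat.curvature_estimate (hsq hμ) ((le_max_right _ _).trans hr) (hC _ hσ ρ hρ).1
      (hC _ hσ ρ hρ).2
  refine ⟨?_, fun k hk => ?_⟩
  · ext μ
    constructor
    · rintro ⟨h1, h2⟩
      have hμ := abs_le.2 h2
      obtain ⟨k, rfl⟩ := hA.exists_eq_of_mem_diracSpectrum hV hr0 (hsq hμ) (hb hμ) h1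
      exact ⟨k, rfl, hμ⟩
    · rintro ⟨k, rfl, hk⟩
      exact ⟨hA.mem_diracSpectrum hV hr0 k, abs_le.1 hk⟩
  · have hM : ⌊r⌋ = (⌊r⌋.toNat : ℤ) := (Int.toNat_of_nonneg (Int.floor_nonneg.2 hr0.le)).symm
    have e := DiracHat.liftEquiv hA hV.ne' hr0 (hsq hk) (hb hk)
    refine ⟨?_, ?_⟩
    · rw [← e.finrank_eq, DiracHat.finrank_kerDbar hA hM]
      push_cast
      rw [← hM]
    · have hc : (1 / (Real.sqrt (2 * Real.pi) : ℂ)) ≠ 0 := by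
        have := (Real.sqrt_pos.2 Real.two_pi_pos).ne'
        exact one_div_ne_zero (by exact_mod_cast this)
      -- The normalization 1/√(2π) is a nonzero scalar composed with the unnormalized isomorphism.
      refine ⟨(LinearEquiv.smulOfNeZero ℂ _ _ hc).trans
        (DiracHat.liftEquiv hA hV.ne' hr0 (hsq hk) (hb hk)), fun α ρ t θ => ?_⟩
      change ![DiracHat.expI k θ * (1 / (Real.sqrt (2 * Real.pi) : ℂ) *
        (α : ℝ × ℝ → ℂ) (ρ, t)), 0] = _
      rw [DiracHat.expI, show (k : ℂ) * θ * Complex.I = Complex.I * k * θ by ring]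
      congr 1
      ring
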